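/- Let $(X,d,\mu)$ be a locally compact, complete metric measure space with a Radon measure $\mu$ such that, for some constants $C>0$ and $\lambda\ge 1$: (doubling) $0<\mu(B(x,2r))\le C\mu(B(x,r))<\infty$ for all $x\in X$, $r>0$; and, for a fixed $1<p<\infty$, the $(p,p)$-Poincaré inequality $$\int_{B(x,R)}|f-f_{B(x,R)}|^p\,d\mu\le C R^p\int_{B(x,\lambda R)}(\mathrm{Lip} f)^p\,d\mu$$ holds for all Lipschitz $f:X\to\mathbb R$, $x\in X$, $R>0$, where $f_{B}$ is the $\mu$-average of $f$ over $B$ and $(\mathrm{Lip} f)(y)=\limsup_{r\to0^+}\sup_{d(x,y)\le r}|f(x)-f(y)|/r$. For $r>0$, $f\in L^p(X,\mu)$ and open $U\subseteq X$ put $$E_{p,r}(f,U)=\frac1{r^p}\int_U\frac{1}{\mu(B(x,r))}\int_{B(x,r)}|f(y)-f(x)|^p\,d\mu(y)\,d\mu(x),\qquad E_{p,r}(f)=E_{p,r}(f,X),$$ and $KS^{1,p}(X)=\{f\in L^p(X,\mu):\limsup_{r\to0^+}E_{p,r}(f)<\infty\}$. Write $U\Subset V$ if $\overline U$ is compact and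 $\overline U\subseteq V$. Given $r_n>0$, $r_n\to0$, a functional $\mathcal E_p:L^p(X,\mu)\to[0,\infty]$ is the $\Gamma$-limit of $E_{p,r_n}$ if $\mathcal E_p(f)\le\liminf_n E_{p,r_n}(f_n)$ whenever $f_n\to f$ in $L^p$, and every $f\in L^p$ admits some $f_n\to f$ in $L^p$ with $\limsup_n E_{p,r_n}(f_n)\le\mathcal E_p(f)$. A functional $\Gamma_p$ of $f\in L^p(X,\mu)$ and of open $U\subseteq X$, with values $\Gamma_p(f)(U)\in[0,\infty]$, is a $\overline\Gamma$-limit of the localized energies $E_{p,r_n}$ if $\Gamma_p(f)(U)\le\liminf_n E_{p,r_n}(f_n,U)$ whenever $U$ is open and $f_n\to f$ in $L^p$, and for every $f\in L^p$ and all open $U\Subset V$ there is $f_n\to f$ in $L^p$ with $\limsup_n E_{p,r_n}(f_n,U)\le\Gamma_p(f)(V)$. Then every positive sequence tending to $0$ has a subsequence $(r_n)$ along which a $\Gamma$-limit $\mathcal E_p$ and a $\overline\Gamma$-limit $\Gamma_p$ exist. Moreover, there are constants $C_1,C_2>0$ such that for every positive sequence $r_n\to0$ along which both limits $\mathcal E_p$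 and $\Gamma_p$ exist, and for every $f\in KS^{1,p}(X)$: (a) the set function $U\mapsto\Gamma_p(f)(U)$ on open sets is the restriction of a finite Radon measure on $X$, whose total mass is $\Gamma_p(f)(X)=\mathcal E_p(f)$; (b) for all open sets $U\Subset V\Subset W$, $$C_1\limsup_{r\to0^+}E_{p,r}(f,U)\le\Gamma_p(f)(V)\le\liminf_{n\to\infty}E_{p,r_n}(f,V)\le C_2\liminf_{r\to0^+}E_{p,r}(f,W).$$ -/

import Mathlib

open MeasureTheory Filter Topology Metric TopologicalSpace
open scoped ENNReal NNReal

namespace KorevaarSchoen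

/-- The measure is positive, finite and doubling on open balls. -/
def IsDoubling {X : Type*} [MetricSpace X] [MeasurableSpace X] (μ : Measure X) : Prop :=
  ∃ C : ℝ≥0, ∀ (x : X) (r : ℝ), 0 < r →
    0 < μ (ball x (2 * r)) ∧ μ (ball x (2 * r)) ≤ C * μ (ball x r) ∧ μ (ball x r) < ∞

/-- The pointwise Lipschitz constant
`(Lip f)(y) = limsup_{r → 0+} sup_{d(x,y) ≤ r} |f x - f y| / r`. -/
noncomputable def lipConst {X : Type*} [MetricSpace X] (f : X → ℝ) (y : X) : ℝ≥0∞ :=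
  limsup (fun r : ℝ => ⨆ x ∈ closedBall y r, ‖f x - f y‖ₑ / ENNReal.ofReal r) (𝓝[>] (0 : ℝ))

/-- The `(p,p)`-Poincaré inequality with Lipschitz constants, for all Lipschitz functions and
all balls. -/
def SatisfiesPoincare {X : Type*} [MetricSpace X] [MeasurableSpace X] (μ : Measure X)
    (p : ℝ≥0∞) : Prop :=
  ∃ (C : ℝ≥0) (lam : ℝ), 1 ≤ lam ∧
    ∀ f : X → ℝ, (∃ K : ℝ≥0, LipschitzWith K f) → ∀ (x : X) (R : ℝ), 0 < R →
      ∫⁻ y in ball x R, ‖f y - ⨍ z in ball x R, f z ∂μ‖ₑ ^ p.toReal ∂μ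
        ≤ C * ENNReal.ofReal R ^ p.toReal *
            ∫⁻ y in ball x (lam * R), lipConst f y ^ p.toReal ∂μ

/-- The localized Korevaar-Schoen energy
`E_{p,r}(f,U) = r^{-p} ∫_U ⨍_{B(x,r)} |f y - f x|^p dμ(y) dμ(x)`. -/
noncomputable def energy {X : Type*} [MetricSpace X] [MeasurableSpace X] (μ : Measure X)
    (p : ℝ≥0∞) (r : ℝ) (f : X → ℝ) (U : Set X) : ℝ≥0∞ :=
  (ENNReal.ofReal r ^ p.toReal)⁻¹ *
    ∫⁻ x in U, ⨍⁻ y in ball x r, ‖f y - f x‖ₑ ^ p.toReal ∂μ ∂μ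

/-- The Korevaar-Schoen space `KS^{1,p}(X)`. -/
def KS {X : Type*} [MetricSpace X] [MeasurableSpace X] (μ : Measure X) (p : ℝ≥0∞) :
    Set (Lp ℝ p μ) :=
  {f | limsup (fun r : ℝ => energy μ p r f Set.univ) (𝓝[>] (0 : ℝ)) < ∞}

/-- `U ⋐ V`: the closure of `U` is compact and contained in `V`. -/
def CompactlyIn {X : Type*} [TopologicalSpace X] (U V : Opens X) : Prop :=
  IsCompact (closure (U : Set X)) ∧ closure (U : Set X) ⊆ V

/-- `Γ`-convergence of a sequence of nonnegative functionals (sequential form). -/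
def GammaConverges {Y : Type*} [TopologicalSpace Y] (E : ℕ → Y → ℝ≥0∞) (F : Y → ℝ≥0∞) : Prop :=
  (∀ (f : Y) (u : ℕ → Y), Tendsto u atTop (𝓝 f) →
      F f ≤ liminf (fun n => E n (u n)) atTop) ∧
  (∀ f : Y, ∃ u : ℕ → Y, Tendsto u atTop (𝓝 f) ∧
      limsup (fun n => E n (u n)) atTop ≤ F f)

/-- `Γ̄`-convergence of a sequence of nonnegative localized functionals, i.e. functionals that
also depend on an open subset of `X`. -/
def GammaBarConverges {X Y : Type*} [TopologicalSpace X] [TopologicalSpace Y]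
    (E : ℕ → Y → Opens X → ℝ≥0∞) (F : Y → Opens X → ℝ≥0∞) : Prop :=
  (∀ (f : Y) (U : Opens X) (u : ℕ → Y), Tendsto u atTop (𝓝 f) →
      F f U ≤ liminf (fun n => E n (u n) U) atTop) ∧
  (∀ (f : Y) (U V : Opens X), CompactlyIn U V → ∃ u : ℕ → Y, Tendsto u atTop (𝓝 f) ∧
      limsup (fun n => E n (u n) U) atTop ≤ F f V)

/-- Along the scales `r n`, the Korevaar-Schoen energies `Γ`-converge to `Ep` and the localized
energies `Γ̄`-converge to `Gp`. -/
def IsEnergyLimit {X : Type*} [MetricSpace X] [MeasurableSpace X] (μ : Measure X)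
    (p : ℝ≥0∞) [Fact (1 ≤ p)] (r : ℕ → ℝ) (Ep : Lp ℝ p μ → ℝ≥0∞)
    (Gp : Lp ℝ p μ → Opens X → ℝ≥0∞) : Prop :=
  GammaConverges (fun n (f : Lp ℝ p μ) => energy μ p (r n) f Set.univ) Ep ∧
  GammaBarConverges (fun n (f : Lp ℝ p μ) (U : Opens X) => energy μ p (r n) f U) Gp

end KorevaarSchoen

/-! Two facts drive the proof: the energies are almost monotone in the scale, and localized recovery
sequences can be glued with no loss in the limit.

Almost monotonicity (`exists_energy_le_energy`): for `s ≤ r`, the energy of `f` at scale `r` on a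
bounded set `U` is at most a constant times its energy at scale `s` on a neighbourhood of `U` of
width comparable to `r`. Split `f = T + (f - T)` with `T` a mollification at scale comparable to
`s`. By doubling, `|f - T|^p` and `s^p (Lip T)^p` at `x` are both bounded by the average of `|f(y) -
f(x)|^p` over `B(x,s)`. The Poincaré inequality passes from `Lip T` to the energy of `T` at scale
`r`, while `f - T` costs at most a multiple of `r^{-p} ‖f - T‖_p^p`. Applied to a recovery sequence
at scales `r n` below a fixed `t`, this gives the first inequality of (b) as `n → ∞`; applied to `f`
itself, it gives the last one. The middle one is the liminf inequality for the constant sequence.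

Existence of limits is compactness of `ℝ≥0∞` combined with separability of `L^p` and of `X`.

Part (a) is the De Giorgi-Letta criterion. Superadditivity on disjoint sets holds because the
energies are additive in the set. Subadditivity comes from interpolating two recovery sequences with
a Lipschitz cutoff: convexity of `t^p` controls the main terms with constant close to one, and the
term in which the cutoff varies is bounded by a multiple of `‖u_n - v_n‖_p^p`, which tends to zero.

The delicate point is inner regularity, since a `Γ̄`-limit only provides recovery on compactly
contained sets. What is needed is a finite measure that bounds the cost of recovery on every set, so
that `V \ K` is cheap for a large compact `K`. Consider pairs `(h, g)` with `h` Lipschitz and close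
to `f` in `L^p` and `g ≥ Lip h`, and almost minimize `∫ g^p`. Such pairs are stable under midpoints,
so uniform convexity (`p > 1`) makes the almost minimizing `g` Cauchy in `L^p`. Hence all `∫_A g^p`
are controlled by a single integrable function, and they dominate the small-scale energies of `h` by
the reverse Fatou lemma. -/

namespace KorevaarSchoen

/-! ### Doubling measures and separability -/

section Doubling

variable {X : Type*} [MetricSpace X] [MeasurableSpace X] {μ : Measure X}

theorem IsDoubling.ball_pos (hD : IsDoubling μ) (x : X) {r : ℝ} (hr : 0 < r) :
    0 < μ (ball x r) := by
  obtain ⟨C, hC⟩ := hD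
  have := (hC x (r / 2) (half_pos hr)).1
  rwa [mul_div_cancel₀ r two_ne_zero] at this

theorem IsDoubling.ball_lt_top (hD : IsDoubling μ) (x : X) (r : ℝ) : μ (ball x r) < ∞ := by
  obtain ⟨C, hC⟩ := hD
  rcases le_or_gt r 0 with hr | hr
  · simp [ball_eq_empty.2 hr]
  · exact (hC x r hr).2.2

/-- Balls of comparable radii and centres have comparable measures. -/
theorem IsDoubling.exists_ball_le (hD : IsDoubling μ) (a b : ℝ) :
    ∃ C : ℝ≥0, 0 < C ∧ ∀ (x y : X) (r : ℝ), 0 < r → dist x y ≤ a * r →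
      μ (ball y (b * r)) ≤ C * μ (ball x r) := by
  obtain ⟨C, hC⟩ := hD
  have key : ∀ (k : ℕ) (x : X) (r : ℝ), 0 < r →
      μ (ball x (2 ^ k * r)) ≤ ((C : ℝ≥0∞) ^ k) * μ (ball x r) := by
    intro k x r hr
    induction k with
    | zero => simp
    | succ k ih =>
      have h1 := (hC x (2 ^ k * r) (by positivity)).2.1
      rw [pow_succ', mul_assoc]
      refine h1.trans ?_
      rw [pow_succ', mul_assoc]
      gcongr
  -- With `2 ^ k > a + b` the ball around `y` lies in `B(x, 2 ^ k r)`. The `+ 1` below only makes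
  -- the constant positive, hence invertible.
  obtain ⟨k, hk⟩ := pow_unbounded_of_one_lt (a + b) (one_lt_two : (1 : ℝ) < 2)
  refine ⟨C ^ k + 1, by positivity, fun x y r hr hxy => ?_⟩
  calc μ (ball y (b * r)) ≤ μ (ball x (2 ^ k * r)) := by
        refine measure_mono (ball_subset_ball' ?_)
        rw [dist_comm]
        nlinarith
    _ ≤ ((C : ℝ≥0∞) ^ k) * μ (ball x r) := key k x r hr
    _ ≤ ((C ^ k + 1 : ℝ≥0) : ℝ≥0∞) * μ (ball x r) := by
        gcongr
        push_cast
        exact le_self_add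

theorem IsDoubling.sigmaFinite (hD : IsDoubling μ) : SigmaFinite μ := by
  rcases isEmpty_or_nonempty X with hX | ⟨⟨x₀⟩⟩
  · rw [Measure.eq_zero_of_isEmpty μ]; infer_instance
  · exact ⟨⟨{ set := fun n => ball x₀ n
              set_mem := fun _ => trivial
              finite := fun n => hD.ball_lt_top x₀ n
              spanning := iUnion_ball_nat x₀ }⟩⟩

/-- A Vitali family of disjoint balls of radius `ε / 5` is countable, because the measure is
σ-finite and charges every ball. The fivefold enlargements cover the space, so the centres are
`ε`-dense. -/
theorem IsDoubling.secondCountableTopology [BorelSpace X] (hD : IsDoubling μ) :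
    SecondCountableTopology X := by
  have := hD.sigmaFinite
  refine Metric.secondCountable_of_almost_dense_set fun ε hε => ?_
  obtain ⟨u, -, hdis, hcov⟩ := Vitali.exists_disjoint_subfamily_covering_enlargement_closedBall
    (Set.univ : Set X) id (fun _ => ε / 5) (ε / 5) (fun _ _ => le_rfl) 5 (by norm_num)
  refine ⟨u, ?_, fun x => ?_⟩
  · have h := Measure.countable_meas_pos_of_disjoint_iUnion (μ := μ)
      (As := fun a : u => closedBall (a : X) (ε / 5)) (fun _ => measurableSet_closedBall)
      (fun a b hab => hdis a.2 b.2 (fun h => hab (Subtype.ext h)))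
    have h2 : {i : u | 0 < μ (closedBall (i : X) (ε / 5))} = Set.univ :=
      Set.eq_univ_of_forall fun i =>
        (hD.ball_pos (i : X) (by positivity : 0 < ε / 5)).trans_le (measure_mono ball_subset_closedBall)
    rw [h2] at h
    exact Set.countable_coe_iff.1 (Set.countable_univ_iff.1 h)
  · obtain ⟨b, hb, hsub⟩ := hcov x trivial
    refine ⟨b, hb, ?_⟩
    have := hsub (mem_closedBall_self (by positivity))
    simpa [mul_div_cancel₀] using this

end Doubling

/-! ### Averaging over balls: Fubini estimates -/

section Averages

variable {X : Type*} [MetricSpace X] [MeasurableSpace X] [BorelSpace X]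
  [SecondCountableTopology X] {μ : Measure X} [SFinite μ]

theorem measurable_indicator_ball (r : ℝ) :
    Measurable fun z : X × X => (ball z.1 r).indicator (1 : X → ℝ≥0∞) z.2 := by
  have : (fun z : X × X => (ball z.1 r).indicator (1 : X → ℝ≥0∞) z.2)
      = {z : X × X | dist z.2 z.1 < r}.indicator 1 := by
    ext z; simp [Set.indicator, mem_ball]
  rw [this]
  exact measurable_one.indicator
    (measurableSet_lt (measurable_snd.dist measurable_fst) measurable_const)

omit [SecondCountableTopology X] [SFinite μ] in
theorem setLIntegral_ball_eq (x : X) (r : ℝ) (F : X → ℝ≥0∞) :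
    ∫⁻ y in ball x r, F y ∂μ = ∫⁻ y, (ball x r).indicator 1 y * F y ∂μ := by
  rw [← lintegral_indicator measurableSet_ball]
  refine lintegral_congr fun y => ?_
  by_cases h : y ∈ ball x r <;> simp [h]

theorem measurable_setLIntegral_ball {F : X → X → ℝ≥0∞} (hF : Measurable (Function.uncurry F))
    (r : ℝ) : Measurable fun x => ∫⁻ y in ball x r, F x y ∂μ := by
  simp_rw [setLIntegral_ball_eq]
  exact ((measurable_indicator_ball r).mul hF).lintegral_prod_right'

theorem measurable_measure_ball (r : ℝ) : Measurable fun x => μ (ball x r) := by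
  simpa using measurable_setLIntegral_ball (μ := μ) (F := fun _ _ => 1) measurable_const r

theorem measurable_setLAverage_ball {F : X → X → ℝ≥0∞} (hF : Measurable (Function.uncurry F))
    (r : ℝ) : Measurable fun x => ⨍⁻ y in ball x r, F x y ∂μ := by
  simp_rw [setLAverage_eq]
  exact (measurable_setLIntegral_ball hF r).div (measurable_measure_ball r)

omit [MeasurableSpace X] [BorelSpace X] [SecondCountableTopology X] in
theorem indicator_ball_comm (x y : X) (r : ℝ) :
    (ball x r).indicator (1 : X → ℝ≥0∞) y = (ball y r).indicator 1 x := by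
  simp [Set.indicator, mem_ball, dist_comm]

/-- Averaging over balls is bounded on `L¹`, with control of the domain. -/
theorem IsDoubling.exists_lintegral_average_le (hD : IsDoubling μ) {b : ℝ} (hb : 0 < b) :
    ∃ C : ℝ≥0, 0 < C ∧ ∀ (r : ℝ), 0 < r → ∀ (G : X → ℝ≥0∞), Measurable G → ∀ U : Set X,
      MeasurableSet U →
      ∫⁻ x in U, (∫⁻ y in ball x (b * r), G y ∂μ) / μ (ball x r) ∂μ
        ≤ C * ∫⁻ y in thickening (b * r) U, G y ∂μ := by
  -- By Fubini, `G y` is weighted by the integral of `1 / μ(B(x,r))` over those `x ∈ U` with `y ∈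
  -- B(x,br)`. Doubling bounds this by `C`, and no such `x` exists unless `y` lies in the
  -- thickening.
  obtain ⟨C, hC0, hC⟩ := hD.exists_ball_le b b
  refine ⟨C, hC0, fun r hr G hG U hU => ?_⟩
  have hm1 : Measurable fun z : X × X => (ball z.1 (b * r)).indicator (1 : X → ℝ≥0∞) z.2 :=
    measurable_indicator_ball _
  have hmm : Measurable fun z : X × X => (μ (ball z.1 r))⁻¹ :=
    ((measurable_measure_ball r).comp measurable_fst).inv
  calc ∫⁻ x in U, (∫⁻ y in ball x (b * r), G y ∂μ) / μ (ball x r) ∂μ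
      = ∫⁻ x in U, ∫⁻ y, (ball x (b * r)).indicator 1 y * G y * (μ (ball x r))⁻¹ ∂μ ∂μ := by
        refine lintegral_congr fun x => ?_
        rw [setLIntegral_ball_eq, div_eq_mul_inv, lintegral_mul_const]
        exact (hm1.comp measurable_prodMk_left).mul hG
    _ = ∫⁻ y, ∫⁻ x in U, (ball x (b * r)).indicator 1 y * G y * (μ (ball x r))⁻¹ ∂μ ∂μ := by
        rw [lintegral_lintegral_swap]
        exact ((hm1.mul (hG.comp measurable_snd)).mul hmm).aemeasurable
    _ ≤ ∫⁻ y, (thickening (b * r) U).indicator (fun y => C * G y) y ∂μ := by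
        refine lintegral_mono fun y => ?_
        by_cases hy : y ∈ thickening (b * r) U
        · rw [Set.indicator_of_mem hy]
          calc ∫⁻ x in U, (ball x (b * r)).indicator 1 y * G y * (μ (ball x r))⁻¹ ∂μ
              ≤ ∫⁻ x, (ball x (b * r)).indicator 1 y * G y * (μ (ball x r))⁻¹ ∂μ :=
                setLIntegral_le_lintegral _ _
            _ = ∫⁻ x in ball y (b * r), G y * (μ (ball x r))⁻¹ ∂μ := by
                rw [setLIntegral_ball_eq]
                refine lintegral_congr fun x => ?_
                rw [indicator_ball_comm, mul_assoc]
            _ ≤ ∫⁻ x in ball y (b * r), G y * (C * (μ (ball y (b * r)))⁻¹) ∂μ := by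
                refine setLIntegral_mono measurable_const fun x hx => ?_
                gcongr
                have h := hC x y r hr (mem_ball.1 hx).le
                rw [← ENNReal.inv_le_inv, ENNReal.mul_inv (by simp [hC0.ne']) (by simp)] at h
                calc (μ (ball x r))⁻¹ = C * ((C : ℝ≥0∞)⁻¹ * (μ (ball x r))⁻¹) := by
                      rw [← mul_assoc, ENNReal.mul_inv_cancel (by simp [hC0.ne']) (by simp), one_mul]
                  _ ≤ _ := by gcongr
            _ = C * G y := by
                rw [setLIntegral_const, mul_assoc, mul_assoc,
                  ENNReal.inv_mul_cancel (hD.ball_pos y (by positivity)).ne'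
                    (hD.ball_lt_top y _).ne, mul_one, mul_comm]
        · rw [Set.indicator_of_notMem hy]
          refine (setLIntegral_congr_fun hU fun x hx => ?_).trans_le (by simp : ∫⁻ _ in U, 0 ∂μ ≤ 0)
          have : y ∉ ball x (b * r) := fun h => hy (mem_thickening_iff.2 ⟨x, hx, h⟩)
          simp [this]
    _ = C * ∫⁻ y in thickening (b * r) U, G y ∂μ := by
        rw [lintegral_indicator isOpen_thickening.measurableSet, lintegral_const_mul _ hG]

/-- The integral of a function is controlled by the integral of its averages. -/
theorem IsDoubling.exists_lintegral_le_average (hD : IsDoubling μ) :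
    ∃ C : ℝ≥0, 0 < C ∧ ∀ (r : ℝ), 0 < r → ∀ (G : X → ℝ≥0∞), Measurable G → ∀ U : Set X,
      MeasurableSet U →
      ∫⁻ x in U, G x ∂μ ≤ C * ∫⁻ z in thickening r U, (∫⁻ x in ball z r, G x ∂μ) / μ (ball z r) ∂μ
      := by
  -- The converse Fubini argument: for `x ∈ U` the integral of `1 / μ(B(z,r))` over `z ∈ B(x,r)` is
  -- at least `1 / C`, and all these `z` lie in the thickening.
  obtain ⟨C, hC0, hC⟩ := hD.exists_ball_le 1 1
  refine ⟨C, hC0, fun r hr G hG U hU => ?_⟩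
  have hm1 : Measurable fun z : X × X => (ball z.1 r).indicator (1 : X → ℝ≥0∞) z.2 :=
    measurable_indicator_ball _
  have hm2 : Measurable fun w : X × X => (ball w.2 r).indicator (1 : X → ℝ≥0∞) w.1 :=
    hm1.comp measurable_swap
  have hm3 : Measurable fun w : X × X => (μ (ball w.2 r))⁻¹ :=
    (measurable_measure_ball r).inv.comp measurable_snd
  have hm4 : Measurable fun w : X × X =>
      (ball w.2 r).indicator 1 w.1 * G w.1 * (μ (ball w.2 r))⁻¹ :=
    (hm2.mul (hG.comp measurable_fst)).mul hm3
  calc ∫⁻ x in U, G x ∂μ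
      ≤ ∫⁻ x in U, C * ∫⁻ z in thickening r U, (ball z r).indicator 1 x * G x * (μ (ball z r))⁻¹ ∂μ ∂μ := by
        refine lintegral_mono_ae ((ae_restrict_mem hU).mono fun x hx => ?_)
        have hsub : ball x r ⊆ thickening r U := ball_subset_thickening hx r
        have hin : ∫⁻ z in ball x r, G x * ((C : ℝ≥0∞)⁻¹ * (μ (ball x r))⁻¹) ∂μ ≤
            ∫⁻ z in thickening r U, (ball z r).indicator 1 x * G x * (μ (ball z r))⁻¹ ∂μ := by
          refine le_trans ?_ (lintegral_mono_set hsub)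
          refine setLIntegral_mono ?_ fun z hz => ?_
          · refine Measurable.mul (Measurable.mul ?_ measurable_const) (measurable_measure_ball r).inv
            exact hm1.comp measurable_prodMk_right
          · rw [Set.indicator_of_mem (show x ∈ ball z r from mem_ball'.1 hz), Pi.one_apply, one_mul]
            gcongr
            have h := hC x z r hr (by simpa [dist_comm] using (mem_ball.1 hz).le)
            rw [one_mul] at h
            rw [← ENNReal.mul_inv (by simp [hC0.ne']) (by simp)]
            exact ENNReal.inv_le_inv.2 h
        calc G x = C * (G x * ((C : ℝ≥0∞)⁻¹ * (μ (ball x r))⁻¹) * μ (ball x r)) := by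
              rw [mul_assoc, mul_assoc, ENNReal.inv_mul_cancel (hD.ball_pos x hr).ne'
                (hD.ball_lt_top x _).ne, mul_one, mul_comm, mul_assoc, ENNReal.inv_mul_cancel
                (by simp [hC0.ne']) (by simp), mul_one]
          _ ≤ _ := by
              rw [setLIntegral_const] at hin
              gcongr
    _ = C * ∫⁻ x in U, ∫⁻ z in thickening r U, (ball z r).indicator 1 x * G x * (μ (ball z r))⁻¹ ∂μ ∂μ := by
        exact lintegral_const_mul _ hm4.lintegral_prod_right'
    _ = C * ∫⁻ z in thickening r U, ∫⁻ x in U, (ball z r).indicator 1 x * G x * (μ (ball z r))⁻¹ ∂μ ∂μ := by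
        rw [lintegral_lintegral_swap hm4.aemeasurable]
    _ ≤ _ := by
        gcongr with z
        rw [setLIntegral_ball_eq, div_eq_mul_inv, ← lintegral_mul_const]
        · exact setLIntegral_le_lintegral _ _
        · exact (hm1.comp measurable_prodMk_left).mul hG

end Averages

/-! ### Mollification by tent functions -/

section Mollifier

variable {X : Type*} [MetricSpace X]

/-- The tent function of height one and radius `s` centred at `x`. -/
noncomputable def tent (s : ℝ) (x y : X) : ℝ := max 0 (1 - dist x y / s)

theorem tent_nonneg (s : ℝ) (x y : X) : 0 ≤ tent s x y := le_max_left _ _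

theorem tent_le_one {s : ℝ} (hs : 0 < s) (x y : X) : tent s x y ≤ 1 :=
  max_le zero_le_one (by have : 0 ≤ dist x y / s := by positivity
                         linarith)

theorem tent_eq_zero {s : ℝ} (hs : 0 < s) {x y : X} (h : y ∉ ball x s) : tent s x y = 0 := by
  refine max_eq_left ?_
  rw [mem_ball', not_lt] at h
  have : 1 ≤ dist x y / s := (one_le_div hs).2 h
  linarith

theorem half_le_tent {s : ℝ} (hs : 0 < s) {x y : X} (h : y ∈ ball x (s / 2)) :
    1 / 2 ≤ tent s x y := by
  refine le_max_of_le_right ?_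
  rw [mem_ball'] at h
  have : dist x y / s ≤ 1 / 2 := by
    rw [div_le_iff₀ hs]; linarith
  linarith

theorem abs_tent_sub_tent_le {s : ℝ} (hs : 0 < s) (x x' y : X) :
    |tent s x y - tent s x' y| ≤ dist x x' / s := by
  unfold tent
  rw [max_comm 0, max_comm 0]
  refine (abs_max_sub_max_le_abs _ _ _).trans ?_
  have : (1 - dist x y / s) - (1 - dist x' y / s) = (dist x' y - dist x y) / s := by ring
  rw [this, abs_div, abs_of_pos hs]
  gcongr
  rw [dist_comm x x']
  exact abs_dist_sub_le _ _ _

theorem continuous_tent (s : ℝ) (x : X) : Continuous (tent s x) := by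
  unfold tent; fun_prop

variable [MeasurableSpace X]

/-- The average of `f` with respect to the tent function of radius `s`. -/
noncomputable def mollify (μ : Measure X) (s : ℝ) (f : X → ℝ) (x : X) : ℝ :=
  (∫ y, tent s x y * f y ∂μ) / ∫ y, tent s x y ∂μ

variable [BorelSpace X] {μ : Measure X}

omit [MeasurableSpace X] [BorelSpace X] in
theorem abs_tent_mul_le {s : ℝ} (hs : 0 < s) (x y : X) (t : ℝ) :
    |tent s x y * t| ≤ (ball x s).indicator (fun _ => |t|) y := by
  by_cases h : y ∈ ball x s
  · rw [Set.indicator_of_mem h, abs_mul, abs_of_nonneg (tent_nonneg s x y)]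
    exact mul_le_of_le_one_left (abs_nonneg _) (tent_le_one hs x y)
  · rw [tent_eq_zero hs h, zero_mul, abs_zero]
    exact Set.indicator_nonneg (fun _ _ => abs_nonneg _) _

theorem integrable_tent_mul {s : ℝ} (hs : 0 < s) (x : X) {f : X → ℝ}
    (hf : IntegrableOn f (ball x s) μ) : Integrable (fun y => tent s x y * f y) μ := by
  have h1 : IntegrableOn (fun y => tent s x y * f y) (ball x s) μ :=
    Integrable.bdd_mul (c := 1) hf (continuous_tent s x).aestronglyMeasurable
      (Eventually.of_forall fun y => by
        rw [Real.norm_eq_abs, abs_of_nonneg (tent_nonneg s x y)]; exact tent_le_one hs x y)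
  refine (integrableOn_iff_integrable_of_support_subset fun y hy => ?_).1 h1
  by_contra h
  exact hy (by simp [tent_eq_zero hs h])

omit [BorelSpace X] in
theorem IsDoubling.integrableOn_const (hD : IsDoubling μ) (x : X) (r c : ℝ) :
    IntegrableOn (fun _ => c) (ball x r) μ :=
  MeasureTheory.integrableOn_const (hD.ball_lt_top x r).ne

theorem IsDoubling.half_measure_le (hD : IsDoubling μ) {s : ℝ} (hs : 0 < s) (x : X) :
    μ.real (ball x (s / 2)) / 2 ≤ ∫ y, tent s x y ∂μ := by
  have hint : Integrable (tent s x) μ := by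
    simpa using integrable_tent_mul hs x (hD.integrableOn_const x s 1)
  calc μ.real (ball x (s / 2)) / 2 = ∫ y in ball x (s / 2), (1 / 2 : ℝ) ∂μ := by
        rw [setIntegral_const]; simp; ring
    _ ≤ ∫ y in ball x (s / 2), tent s x y ∂μ :=
        setIntegral_mono_on (hD.integrableOn_const _ _ _) hint.integrableOn measurableSet_ball
          fun y hy => half_le_tent hs hy
    _ ≤ _ := setIntegral_le_integral hint (Eventually.of_forall (tent_nonneg s x))

/-- Mollification fixes constants, so every estimate may be made on the oscillation `f - c` with a
freely chosen `c`. -/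
theorem mollify_sub_const (hD : IsDoubling μ) {s : ℝ} (hs : 0 < s) (x : X) {f : X → ℝ}
    (hf : IntegrableOn f (ball x s) μ) (c : ℝ) :
    mollify μ s f x - c = (∫ y, tent s x y * (f y - c) ∂μ) / ∫ y, tent s x y ∂μ := by
  have hpos : 0 < ∫ y, tent s x y ∂μ := by
    refine lt_of_lt_of_le ?_ (hD.half_measure_le hs x)
    have := ENNReal.toReal_pos (hD.ball_pos x (half_pos hs)).ne' (hD.ball_lt_top x _).ne
    exact half_pos this
  have h1 : ∫ y, tent s x y * (f y - c) ∂μ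
      = (∫ y, tent s x y * f y ∂μ) - (∫ y, tent s x y ∂μ) * c := by
    simp_rw [mul_sub]
    rw [integral_sub (integrable_tent_mul hs x hf)
      (integrable_tent_mul hs x (hD.integrableOn_const x s c)), integral_mul_const]
  rw [h1, mollify]
  field_simp

/-- Oscillation bounds for mollifications. -/
theorem IsDoubling.exists_mollify_bounds (hD : IsDoubling μ) :
    ∃ C : ℝ≥0, ∀ (f : X → ℝ), (∀ x r, IntegrableOn f (ball x r) μ) → ∀ s : ℝ, 0 < s → ∀ x : X,
      (∀ c : ℝ, ‖mollify μ s f x - c‖ₑ ≤ C * ⨍⁻ y in ball x (2 * s), ‖f y - c‖ₑ ∂μ) ∧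
      ∀ x', dist x x' ≤ s → ∀ c : ℝ, ‖mollify μ s f x - mollify μ s f x'‖ₑ ≤
        C * ENNReal.ofReal (dist x x' / s) * ⨍⁻ y in ball x (2 * s), ‖f y - c‖ₑ ∂μ := by
  -- Used at radius `s / 2`, where the tent is at least `1 / 2`: every normalizing factor `N x'`
  -- with `dist x x' ≤ s` is at least `m / (2C)`.
  obtain ⟨C, hC0, hC⟩ := hD.exists_ball_le 2 4
  refine ⟨2 * C + 4 * C ^ 2, fun f hf s hs x => ?_⟩
  set m := μ.real (ball x (2 * s)) with hm
  have hmpos : 0 < m :=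
    ENNReal.toReal_pos (hD.ball_pos x (by positivity)).ne' (hD.ball_lt_top x _).ne
  set N : X → ℝ := fun x => ∫ y, tent s x y ∂μ with hN
  have hmN : ∀ x', dist x x' ≤ s → m ≤ 2 * C * N x' := by
    intro x' hx'
    have h1 := hC x' x (s / 2) (half_pos hs) (by rw [dist_comm]; linarith)
    rw [show 4 * (s / 2) = 2 * s by ring] at h1
    have h2 := ENNReal.toReal_mono
      (ENNReal.mul_ne_top ENNReal.coe_ne_top (hD.ball_lt_top x' _).ne) h1
    rw [ENNReal.toReal_mul, ENNReal.coe_toReal] at h2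
    have h3 := hD.half_measure_le hs x'
    have h4 : m ≤ C * μ.real (ball x' (s / 2)) := h2
    have h5 : (0 : ℝ) ≤ C := C.2
    nlinarith
  have hCpos : (0 : ℝ) < C := hC0
  have hNpos : ∀ x', dist x x' ≤ s → 0 < N x' := fun x' hx' => by
    have := hmN x' hx'
    by_contra h
    nlinarith [mul_nonneg hCpos.le (neg_nonneg.2 (not_lt.1 h))]
  have hsub : ∀ x', dist x x' ≤ s → ball x' s ⊆ ball x (2 * s) := fun x' hx' =>
    ball_subset_ball' (by rw [dist_comm]; linarith)
  have hFint : ∀ c : ℝ, ∀ z r, IntegrableOn (fun y => f y - c) (ball z r) μ := fun c z r =>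
    (hf z r).sub (hD.integrableOn_const z r c)
  set I : ℝ → ℝ := fun c => ∫ y in ball x (2 * s), ‖f y - c‖ ∂μ with hI
  have hI0 : ∀ c, 0 ≤ I c := fun c => integral_nonneg fun _ => norm_nonneg _
  have hA : ∀ c x', dist x x' ≤ s → |∫ y, tent s x' y * (f y - c) ∂μ| ≤ I c := by
    intro c x' hx'
    simp only [hI]
    rw [← integral_indicator measurableSet_ball]
    rw [← Real.norm_eq_abs]
    refine norm_integral_le_of_norm_le ((integrable_indicator_iff measurableSet_ball).2
      (hFint c x (2 * s)).norm) (Eventually.of_forall fun y => ?_)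
    refine (abs_tent_mul_le hs x' y _).trans ?_
    exact Set.indicator_le_indicator_apply_of_subset (hsub x' hx') (by positivity)
  have hLavg : ∀ c, ENNReal.ofReal (I c / m) = ⨍⁻ y in ball x (2 * s), ‖f y - c‖ₑ ∂μ := by
    intro c
    rw [setLAverage_eq, ENNReal.ofReal_div_of_pos hmpos, hI,
      ofReal_integral_norm_eq_lintegral_enorm (hFint c x (2 * s)), hm, ofReal_measureReal
        (hD.ball_lt_top x _).ne]
  have hxx : dist x x ≤ s := by simpa using hs.le
  constructor
  · intro c
    have h1 : |mollify μ s f x - c| ≤ (2 * C + 4 * C ^ 2) * (I c / m) := by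
      rw [mollify_sub_const hD hs x (hf x s), abs_div, abs_of_pos (hNpos x hxx)]
      calc _ ≤ I c / N x := by gcongr; exacts [(hNpos x hxx).le, hA c x hxx]
        _ ≤ I c / (m / (2 * C)) := by
            have := hI0 c
            gcongr
            rw [div_le_iff₀ (by positivity)]; linarith [hmN x hxx]
        _ = 2 * C * (I c / m) := by field_simp
        _ ≤ _ := by
            have := hI0 c
            gcongr; nlinarith
    calc ‖mollify μ s f x - c‖ₑ = ENNReal.ofReal |mollify μ s f x - c| := by
          rw [Real.enorm_eq_ofReal_abs]
      _ ≤ ENNReal.ofReal ((2 * C + 4 * C ^ 2) * (I c / m)) := ENNReal.ofReal_le_ofReal h1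
      _ = _ := by
          rw [ENNReal.ofReal_mul (by positivity), hLavg]
          congr 1
          rw [ENNReal.ofReal, Real.toNNReal_of_nonneg (by positivity)]
          rfl
  · intro x' hx' c
    set d := dist x x' with hd
    have hdiff : ∀ y, |tent s x y - tent s x' y| ≤ (ball x (2 * s)).indicator (fun _ => d / s) y := by
      intro y
      by_cases h : y ∈ ball x (2 * s)
      · rw [Set.indicator_of_mem h]; exact abs_tent_sub_tent_le hs x x' y
      · rw [tent_eq_zero hs (fun h' => h (hsub x hxx h')),
          tent_eq_zero hs (fun h' => h (hsub x' hx' h'))]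
        simp [Set.indicator_of_notMem h]
    have hint1 : ∀ z, Integrable (tent s z) μ := fun z => by
      simpa using integrable_tent_mul hs z (hD.integrableOn_const z s 1)
    have hNN : |N x' - N x| ≤ d / s * m := by
      rw [abs_sub_comm, hN]
      simp only
      rw [← integral_sub (hint1 x) (hint1 x')]
      have : d / s * m = ∫ y, (ball x (2 * s)).indicator (fun _ => d / s) y ∂μ := by
        rw [integral_indicator measurableSet_ball, setIntegral_const]; simp [hm, mul_comm]
      rw [this, ← Real.norm_eq_abs]
      exact norm_integral_le_of_norm_le ((hD.integrableOn_const x _ _).integrable_indicator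
        measurableSet_ball) (Eventually.of_forall fun y => hdiff y)
    have hAA : |(∫ y, tent s x y * (f y - c) ∂μ) - ∫ y, tent s x' y * (f y - c) ∂μ|
        ≤ d / s * I c := by
      rw [← integral_sub (integrable_tent_mul hs x (hFint c x s))
        (integrable_tent_mul hs x' (hFint c x' s))]
      have : d / s * I c = ∫ y, (ball x (2 * s)).indicator (fun y => d / s * ‖f y - c‖) y ∂μ := by
        rw [integral_indicator measurableSet_ball, integral_const_mul]
      rw [this, ← Real.norm_eq_abs]
      refine norm_integral_le_of_norm_le ((integrable_indicator_iff measurableSet_ball).2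
        (((hFint c x (2 * s)).norm).const_mul _)) (Eventually.of_forall fun y => ?_)
      rw [← sub_mul, norm_mul, Real.norm_eq_abs]
      by_cases h : y ∈ ball x (2 * s)
      · rw [Set.indicator_of_mem h]
        gcongr
        exact abs_tent_sub_tent_le hs x x' y
      · have := hdiff y
        rw [Set.indicator_of_notMem h] at this ⊢
        rw [le_antisymm this (abs_nonneg _), zero_mul]
    have h1 : |mollify μ s f x - mollify μ s f x'| ≤ (2 * C + 4 * C ^ 2) * (d / s) * (I c / m) := by
      have e : mollify μ s f x - mollify μ s f x'
          = (mollify μ s f x - c) - (mollify μ s f x' - c) := by ring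
      rw [e, mollify_sub_const hD hs x (hf x s), mollify_sub_const hD hs x' (hf x' s)]
      set A := ∫ y, tent s x y * (f y - c) ∂μ
      set A' := ∫ y, tent s x' y * (f y - c) ∂μ
      change |A / N x - A' / N x'| ≤ _
      have p1 := hNpos x hxx
      have p2 := hNpos x' hx'
      -- The two terms vary the numerator and the denominator separately. Each carries a factor `d /
      -- s` from the Lipschitz bound on the tent; they contribute `2C` and `4C²` to the constant.
      have e2 : A / N x - A' / N x' = (A - A') / N x + A' * (N x' - N x) / (N x * N x') := by
        field_simp; ring
      have i1 : (N x)⁻¹ ≤ 2 * C / m := by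
        rw [inv_le_comm₀ p1 (by positivity), inv_div, div_le_iff₀ (by positivity)]
        linarith [hmN x hxx]
      have i2 : (N x')⁻¹ ≤ 2 * C / m := by
        rw [inv_le_comm₀ p2 (by positivity), inv_div, div_le_iff₀ (by positivity)]
        linarith [hmN x' hx']
      have := hI0 c
      have hd0 : 0 ≤ d := dist_nonneg
      calc |A / N x - A' / N x'| ≤ |A - A'| * (N x)⁻¹ + |A'| * |N x' - N x| * ((N x)⁻¹ * (N x')⁻¹) := by
            rw [e2]
            refine (abs_add_le _ _).trans (le_of_eq ?_)
            rw [abs_div, abs_div, abs_mul, abs_mul, abs_of_pos p1, abs_of_pos p2, div_eq_mul_inv,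
              div_eq_mul_inv, mul_inv]
        _ ≤ (d / s * I c) * (2 * C / m) + I c * (d / s * m) * ((2 * C / m) * (2 * C / m)) := by
            gcongr
            · exact hA c x' hx'
        _ = _ := by field_simp; ring
    calc ‖mollify μ s f x - mollify μ s f x'‖ₑ
        = ENNReal.ofReal |mollify μ s f x - mollify μ s f x'| := by rw [Real.enorm_eq_ofReal_abs]
      _ ≤ ENNReal.ofReal ((2 * C + 4 * C ^ 2) * (d / s) * (I c / m)) := ENNReal.ofReal_le_ofReal h1
      _ = _ := by
          rw [ENNReal.ofReal_mul (by positivity), hLavg, ENNReal.ofReal_mul (by positivity)]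
          congr 2
          rw [ENNReal.ofReal, Real.toNNReal_of_nonneg (by positivity)]
          rfl

end Mollifier

/-! ### Inequalities for averages and powers -/

section

variable {X : Type*} [MetricSpace X] [MeasurableSpace X] [BorelSpace X] {μ : Measure X}

omit [MetricSpace X] [BorelSpace X] in
theorem rpow_setLAverage_le {A : Set X} (h0 : μ A ≠ 0) (h1 : μ A ≠ ∞)
    {q : ℝ} (hq : 1 ≤ q) {F : X → ℝ≥0∞} (hF : AEMeasurable F μ) :
    (⨍⁻ y in A, F y ∂μ) ^ q ≤ ⨍⁻ y in A, F y ^ q ∂μ := by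
  rw [setLAverage_eq', setLAverage_eq']
  set ν := (μ A)⁻¹ • μ.restrict A
  have : IsProbabilityMeasure ν := ⟨by simp [ν, ENNReal.inv_mul_cancel h0 h1]⟩
  have hF' : AEMeasurable F ν := (hF.restrict).smul_measure _
  have := eLpNorm'_le_eLpNorm'_of_exponent_le one_pos hq ν hF'.aestronglyMeasurable
  simp only [eLpNorm', enorm_eq_self, ENNReal.rpow_one, one_div, inv_one] at this
  rwa [← ENNReal.le_rpow_inv_iff (by linarith)]

omit [MetricSpace X] [BorelSpace X] in
theorem setLAverage_mono {A : Set X} {F G : X → ℝ≥0∞} (hA : MeasurableSet A)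
    (h : ∀ y ∈ A, F y ≤ G y) : ⨍⁻ y in A, F y ∂μ ≤ ⨍⁻ y in A, G y ∂μ := by
  rw [setLAverage_eq, setLAverage_eq]
  exact ENNReal.div_le_div_right (setLIntegral_mono' hA h) _

omit [MetricSpace X] [BorelSpace X] in
theorem setLAverage_const_mul {A : Set X} (c : ℝ≥0∞) {F : X → ℝ≥0∞} (hF : Measurable F) :
    ⨍⁻ y in A, c * F y ∂μ = c * ⨍⁻ y in A, F y ∂μ := by
  rw [setLAverage_eq, setLAverage_eq, lintegral_const_mul _ hF, mul_div_assoc]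

omit [MetricSpace X] [BorelSpace X] in
theorem setLAverage_add {A : Set X} {F G : X → ℝ≥0∞} (hF : Measurable F) :
    ⨍⁻ y in A, F y + G y ∂μ = ⨍⁻ y in A, F y ∂μ + ⨍⁻ y in A, G y ∂μ := by
  rw [setLAverage_eq, setLAverage_eq, setLAverage_eq, lintegral_add_left hF, ENNReal.add_div]

theorem enorm_add_rpow_le {q : ℝ} (hq : 1 ≤ q) (a b : ℝ) :
    ‖a + b‖ₑ ^ q ≤ 2 ^ (q - 1) * (‖a‖ₑ ^ q + ‖b‖ₑ ^ q) := by
  refine (ENNReal.rpow_le_rpow (enorm_add_le a b) (by linarith)).trans ?_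
  exact ENNReal.rpow_add_le_mul_rpow_add_rpow _ _ hq

omit [BorelSpace X] in
theorem measurable_enorm_sub_rpow [SecondCountableTopology X] {f : X → ℝ} (hf : Measurable f)
    (q : ℝ) : Measurable (Function.uncurry fun x y => ‖f y - f x‖ₑ ^ q) :=
  ((hf.comp measurable_snd).sub (hf.comp measurable_fst)).enorm.pow_const q

end

/-! ### Elementary properties of the energies -/

section Energy

variable {X : Type*} [MetricSpace X] [MeasurableSpace X] {μ : Measure X} {p : ℝ≥0∞}

theorem energy_congr_ae {f g : X → ℝ} (h : f =ᵐ[μ] g) (r : ℝ) (U : Set X) :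
    energy μ p r f U = energy μ p r g U := by
  unfold energy
  congr 1
  refine lintegral_congr_ae (ae_restrict_of_ae (h.mono fun x hx => ?_))
  simp only [setLAverage_eq]
  congr 1
  refine lintegral_congr_ae (ae_restrict_of_ae (h.mono fun y hy => ?_))
  simp only [hx, hy]

theorem energy_mono_set {U V : Set X} (h : U ⊆ V) (r : ℝ) (f : X → ℝ) :
    energy μ p r f U ≤ energy μ p r f V := by
  unfold energy
  gcongr

theorem energy_union {U V : Set X} (hV : MeasurableSet V) (h : Disjoint U V) (r : ℝ)
    (f : X → ℝ) : energy μ p r f (U ∪ V) = energy μ p r f U + energy μ p r f V := by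
  unfold energy
  rw [← mul_add, lintegral_union hV h]

variable [BorelSpace X]

/-- The energy on `U` only sees `f` within distance `r` of `U`. This permits cutting `f` off far
away, where mollification needs bounded support. -/
theorem energy_congr_of_eqOn {U : Set X} (hU : MeasurableSet U) {r : ℝ} {f g : X → ℝ}
    (h : Set.EqOn f g (thickening r U)) (hr : 0 < r) :
    energy μ p r f U = energy μ p r g U := by
  unfold energy
  congr 1
  refine setLIntegral_congr_fun hU fun x hx => ?_
  have hsub : ball x r ⊆ thickening r U := ball_subset_thickening hx r
  simp only [setLAverage_eq]
  congr 1
  refine setLIntegral_congr_fun measurableSet_ball fun y hy => ?_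
  simp only [h (hsub hy), h (hsub (mem_ball_self hr))]

end Energy

/-! ### Mollification controlled by the energy density -/

section MollifyEnergy

variable {X : Type*} [MetricSpace X] [MeasurableSpace X] [BorelSpace X] {μ : Measure X}

/-- Pointwise bounds of a mollification by the integrand of the energy. -/
theorem IsDoubling.exists_mollify_rpow_bounds (hD : IsDoubling μ) {q : ℝ} (hq : 1 ≤ q) :
    ∃ C : ℝ≥0, ∀ (f : X → ℝ), Measurable f → (∀ x r, IntegrableOn f (ball x r) μ) →
      ∀ s : ℝ, 0 < s → ∀ x : X,
      ‖f x - mollify μ s f x‖ₑ ^ q ≤ C * ⨍⁻ y in ball x (2 * s), ‖f y - f x‖ₑ ^ q ∂μ ∧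
      lipConst (mollify μ s f) x ^ q ≤
        C * (ENNReal.ofReal (2 * s) ^ q)⁻¹ * ⨍⁻ y in ball x (2 * s), ‖f y - f x‖ₑ ^ q ∂μ := by
  obtain ⟨C, hC⟩ := hD.exists_mollify_bounds
  have hq0 : 0 ≤ q := by linarith
  -- The oscillation bounds are used with `c = f x`, followed by Jensen's inequality. The factor `2`
  -- rewrites `1 / s` as `2 / (2s)`, so that the scale matches the radius of the averaging ball.
  refine ⟨(2 * C) ^ q, fun f hfm hf s hs x => ?_⟩
  obtain ⟨h1, h2⟩ := hC f hf s hs x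
  set J := ⨍⁻ y in ball x (2 * s), ‖f y - f x‖ₑ ∂μ with hJ
  have hJq : J ^ q ≤ ⨍⁻ y in ball x (2 * s), ‖f y - f x‖ₑ ^ q ∂μ :=
    rpow_setLAverage_le (hD.ball_pos x (by positivity)).ne' (hD.ball_lt_top x _).ne hq
      (hfm.sub_const _).enorm.aemeasurable
  have hCC : ((C : ℝ≥0∞)) ^ q ≤ (((2 * C) ^ q : ℝ≥0) : ℝ≥0∞) := by
    rw [ENNReal.coe_rpow_of_nonneg _ hq0]
    push_cast
    gcongr
    exact le_mul_of_one_le_left (zero_le) one_le_two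
  constructor
  · rw [← enorm_neg, neg_sub]
    calc _ ≤ (C * J) ^ q := by gcongr; exact h1 _
      _ = C ^ q * J ^ q := ENNReal.mul_rpow_of_nonneg _ _ hq0
      _ ≤ _ := by gcongr
  · have hlip : lipConst (mollify μ s f) x ≤ C * (ENNReal.ofReal s)⁻¹ * J := by
      refine limsup_le_of_le (by isBoundedDefault) ?_
      filter_upwards [Ioo_mem_nhdsGT hs] with r hr
      refine iSup₂_le fun z hz => ?_
      have hr' : ENNReal.ofReal r ≠ 0 := by simpa using hr.1
      rw [ENNReal.div_le_iff hr' ENNReal.ofReal_ne_top, ← enorm_neg, neg_sub]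
      have hd : dist x z ≤ r := by rw [dist_comm]; exact hz
      refine (h2 z (hd.trans hr.2.le) (f x)).trans ?_
      rw [← hJ]
      calc C * ENNReal.ofReal (dist x z / s) * J ≤ C * ENNReal.ofReal (r / s) * J := by
            gcongr
        _ = _ := by
            rw [ENNReal.ofReal_div_of_pos hs, div_eq_mul_inv]; ring
    calc _ ≤ (C * (ENNReal.ofReal s)⁻¹ * J) ^ q := by gcongr
      _ = ((2 * C : ℝ≥0) * (ENNReal.ofReal (2 * s))⁻¹ * J) ^ q := by
          congr 2
          rw [ENNReal.ofReal_mul zero_le_two, ENNReal.mul_inv (by simp) (by simp)]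
          push_cast
          rw [ENNReal.ofReal_ofNat, show (2 : ℝ≥0∞) * C * (2⁻¹ * (ENNReal.ofReal s)⁻¹)
            = 2 * 2⁻¹ * (C * (ENNReal.ofReal s)⁻¹) by ring,
            ENNReal.mul_inv_cancel (by simp) (by simp), one_mul]
      _ = (((2 * C) ^ q : ℝ≥0) : ℝ≥0∞) * (ENNReal.ofReal (2 * s) ^ q)⁻¹ * J ^ q := by
          rw [ENNReal.mul_rpow_of_nonneg _ _ hq0, ENNReal.mul_rpow_of_nonneg _ _ hq0,
            ENNReal.inv_rpow, ENNReal.coe_rpow_of_nonneg _ hq0]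
      _ ≤ _ := by gcongr

/-- Mollifications of integrable functions with bounded support are Lipschitz functions with
bounded support. -/
theorem IsDoubling.mollify_lipschitz (hD : IsDoubling μ) {f : X → ℝ} (hf : Integrable f μ)
    {x₀ : X} {R : ℝ} (hR : ∀ x, x ∉ ball x₀ R → f x = 0) {s : ℝ} (hs : 0 < s) :
    (∃ K : ℝ≥0, LipschitzWith K (mollify μ s f)) ∧
      ∀ x, x ∉ ball x₀ (R + 2 * s) → mollify μ s f x = 0 := by
  obtain ⟨C, hC⟩ := hD.exists_mollify_bounds
  -- At radius `2s` this compares `B(x₀, 1)` with `B(x, 2s)` for all `x` in `B(x₀, R + 2s)`, which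
  -- gives a uniform bound for the averages of `|f|`; for other `x` they vanish.
  obtain ⟨C', hC'0, hC'⟩ := hD.exists_ball_le ((R + 2 * s) / (2 * s)) (1 / (2 * s))
  have hb := fun x => hC f (fun _ _ => hf.integrableOn) s hs x
  have hzero : ∀ x, x ∉ ball x₀ (R + 2 * s) → ⨍⁻ y in ball x (2 * s), ‖f y - 0‖ₑ ∂μ = 0 := by
    intro x hx
    rw [setLAverage_eq, setLIntegral_congr_fun (g := fun _ => 0) measurableSet_ball]
    · simp
    · intro y hy
      have : y ∉ ball x₀ R := by
        intro hy'
        refine hx (mem_ball.2 ?_)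
        have := dist_triangle x y x₀
        rw [mem_ball] at hy hy'
        rw [dist_comm] at hy
        linarith
      simp [hR y this]
  have havg : ∀ x, ⨍⁻ y in ball x (2 * s), ‖f y - 0‖ₑ ∂μ ≤
      C' * ((∫⁻ y, ‖f y‖ₑ ∂μ) / μ (ball x₀ 1)) := by
    intro x
    by_cases hx : x ∈ ball x₀ (R + 2 * s)
    · have h := hC' x x₀ (2 * s) (by positivity) (by
        rw [div_mul_cancel₀ _ (by positivity)]; exact (mem_ball.1 hx).le)
      rw [div_mul_cancel₀ _ (by positivity)] at h
      rw [setLAverage_eq, div_eq_mul_inv, div_eq_mul_inv]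
      calc _ ≤ (∫⁻ y, ‖f y‖ₑ ∂μ) * (C' * (μ (ball x₀ 1))⁻¹) := by
            refine mul_le_mul' ?_ ?_
            · simpa using setLIntegral_le_lintegral (μ := μ) (ball x (2 * s)) (fun y => ‖f y‖ₑ)
            · have h2 := ENNReal.inv_le_inv.2 h
              rw [ENNReal.mul_inv (by simp [hC'0.ne']) (by simp)] at h2
              calc (μ (ball x (2 * s)))⁻¹ = C' * ((C' : ℝ≥0∞)⁻¹ * (μ (ball x (2 * s)))⁻¹) := by
                    rw [← mul_assoc, ENNReal.mul_inv_cancel (by simp [hC'0.ne']) (by simp), one_mul]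
                _ ≤ _ := by gcongr
        _ = _ := by ring
    · rw [hzero x hx]; exact zero_le
  set M := C' * ((∫⁻ y, ‖f y‖ₑ ∂μ) / μ (ball x₀ 1)) with hM
  have hMtop : C * M ≠ ∞ := by
    refine ENNReal.mul_ne_top ENNReal.coe_ne_top (ENNReal.mul_ne_top ENNReal.coe_ne_top ?_)
    exact ENNReal.div_ne_top hf.2.ne (hD.ball_pos x₀ one_pos).ne'
  refine ⟨⟨((C * M).toNNReal * 2) * s.toNNReal⁻¹, fun x x' => ?_⟩, fun x hx => ?_⟩
  · have hcoe : ((((C * M).toNNReal * 2) * s.toNNReal⁻¹ : ℝ≥0) : ℝ≥0∞) * edist x x'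
        = C * M * 2 * ENNReal.ofReal (dist x x' / s) := by
      rw [ENNReal.ofReal_div_of_pos hs, edist_dist, ENNReal.coe_mul, ENNReal.coe_mul,
        ENNReal.coe_toNNReal hMtop, ENNReal.coe_inv (by simpa using hs), div_eq_mul_inv]
      simp only [ENNReal.coe_ofNat, ENNReal.ofReal]
      ring
    rw [hcoe, edist_eq_enorm_sub]
    -- Nearby points use the oscillation bound with `c = 0`; distant points use the sup bound twice,
    -- since then `dist x x' / s > 1`.
    by_cases hxx : dist x x' ≤ s
    · calc _ ≤ _ := (hb x).2 x' hxx 0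
        _ ≤ C * ENNReal.ofReal (dist x x' / s) * M := by gcongr; exact havg x
        _ = C * M * 1 * ENNReal.ofReal (dist x x' / s) := by ring
        _ ≤ _ := by gcongr; exact one_le_two
    · have h1 := fun x => ((hb x).1 0).trans (by gcongr; exact havg x : _ ≤ C * M)
      calc _ ≤ ‖mollify μ s f x‖ₑ + ‖mollify μ s f x'‖ₑ := enorm_sub_le
        _ ≤ C * M + C * M := add_le_add (by simpa using h1 x) (by simpa using h1 x')
        _ = C * M * 2 * 1 := by ring
        _ ≤ _ := by
            gcongr
            rw [← ENNReal.ofReal_one]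
            exact ENNReal.ofReal_le_ofReal ((one_le_div hs).2 (not_le.1 hxx).le)
  · have := (hb x).1 0
    rw [hzero x hx, mul_zero, sub_zero] at this
    simpa using this

end MollifyEnergy

/-! ### Poincaré inequality and monotonicity in the scale -/

section Monotonicity

variable {X : Type*} [MetricSpace X] [MeasurableSpace X] [BorelSpace X]
  [SecondCountableTopology X] {μ : Measure X} [SFinite μ] {p : ℝ≥0∞}

theorem energy_add_le (hq : 1 ≤ p.toReal) {f g : X → ℝ} (hf : Measurable f) (hg : Measurable g)
    (r : ℝ) (U : Set X) :
    energy μ p r (fun x => f x + g x) U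
      ≤ 2 ^ (p.toReal - 1) * (energy μ p r f U + energy μ p r g U) := by
  unfold energy
  rw [← mul_add, mul_left_comm, ← lintegral_add_left
    (measurable_setLAverage_ball (measurable_enorm_sub_rpow hf _) r), ← lintegral_const_mul' (2 ^ (p.toReal - 1)) _
    (by finiteness)]
  gcongr with x
  have h1 : Measurable fun y => ‖f y - f x‖ₑ ^ p.toReal := (hf.sub_const _).enorm.pow_const _
  have h2 : Measurable fun y => ‖g y - g x‖ₑ ^ p.toReal := (hg.sub_const _).enorm.pow_const _
  have h3 : Measurable fun y => ‖f y - f x‖ₑ ^ p.toReal + ‖g y - g x‖ₑ ^ p.toReal := h1.add h2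
  rw [← setLAverage_add h1, ← setLAverage_const_mul _ h3]
  refine setLAverage_mono measurableSet_ball fun y _ => ?_
  rw [show f y + g y - (f x + g x) = (f y - f x) + (g y - g x) by ring]
  exact enorm_add_rpow_le hq _ _

/-- Split `|w(y) - w(x)|^p` by convexity; the averages of `|w|^p` integrate back to `|w|^p` by
Fubini. At a fixed scale this makes the energy of an `L^p`-small error small. -/
theorem IsDoubling.exists_energy_le_lintegral (hD : IsDoubling μ) (hq : 1 ≤ p.toReal) :
    ∃ C : ℝ≥0∞, C ≠ ∞ ∧ ∀ r : ℝ, 0 < r → ∀ w : X → ℝ, Measurable w → ∀ U : Set X,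
      MeasurableSet U →
      energy μ p r w U ≤ (ENNReal.ofReal r ^ p.toReal)⁻¹ *
        (C * ∫⁻ x in thickening r U, ‖w x‖ₑ ^ p.toReal ∂μ) := by
  obtain ⟨C, -, hC⟩ := hD.exists_lintegral_average_le one_pos
  set q := p.toReal
  refine ⟨2 ^ (q - 1) * (C + 1), by finiteness, fun r hr w hw U hU => ?_⟩
  unfold energy
  gcongr
  have hwq : Measurable fun x => ‖w x‖ₑ ^ q := hw.enorm.pow_const _
  have hCr := hC r hr _ hwq U hU
  simp only [one_mul, ← setLAverage_eq] at hCr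
  have hmA : Measurable fun x => ⨍⁻ y in ball x r, ‖w y‖ₑ ^ q ∂μ :=
    measurable_setLAverage_ball (F := fun _ y => ‖w y‖ₑ ^ q) (hwq.comp measurable_snd) r
  calc ∫⁻ x in U, ⨍⁻ y in ball x r, ‖w y - w x‖ₑ ^ q ∂μ ∂μ
      ≤ ∫⁻ x in U, 2 ^ (q - 1) * (⨍⁻ y in ball x r, ‖w y‖ₑ ^ q ∂μ + ‖w x‖ₑ ^ q) ∂μ := by
        refine lintegral_mono fun x => ?_
        rw [← setLAverage_const (μ := μ) (hD.ball_pos x hr).ne' (hD.ball_lt_top x r).ne (‖w x‖ₑ ^ q),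
          ← setLAverage_add hwq, ← setLAverage_const_mul _ (hwq.add_const _)]
        refine setLAverage_mono measurableSet_ball fun y _ => ?_
        rw [sub_eq_add_neg, ← enorm_neg (w x)]
        exact enorm_add_rpow_le hq _ _
    _ = 2 ^ (q - 1) * (∫⁻ x in U, ⨍⁻ y in ball x r, ‖w y‖ₑ ^ q ∂μ ∂μ + ∫⁻ x in U, ‖w x‖ₑ ^ q ∂μ) := by
        rw [lintegral_const_mul' _ _ (by finiteness), lintegral_add_left hmA]
    _ ≤ 2 ^ (q - 1) * (C * ∫⁻ x in thickening r U, ‖w x‖ₑ ^ q ∂μ +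
          1 * ∫⁻ x in thickening r U, ‖w x‖ₑ ^ q ∂μ) := by
        gcongr
        rw [one_mul]
        exact lintegral_mono_set (self_subset_thickening hr U)
    _ = _ := by rw [← add_mul, mul_assoc]

/-- The Poincaré inequality bounds the energies of a Lipschitz function at all scales. -/
theorem exists_energy_le_lipConst (hD : IsDoubling μ) (hP : SatisfiesPoincare μ p)
    (hq : 1 ≤ p.toReal) :
    ∃ (C : ℝ≥0∞) (c : ℝ), C ≠ ∞ ∧ 1 ≤ c ∧ ∀ (h : X → ℝ), (∃ K : ℝ≥0, LipschitzWith K h) →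
      ∀ G : X → ℝ≥0∞, Measurable G → (∀ x, lipConst h x ^ p.toReal ≤ G x) →
      ∀ r : ℝ, 0 < r → ∀ U : Set X, MeasurableSet U →
      energy μ p r h U ≤ C * ∫⁻ x in thickening (c * r) U, G x ∂μ := by
  -- The integrand `D` is averaged over `B(z,r)`, where all balls `B(x,r)` sit inside `B(z,2r)` and
  -- both values are compared with the mean `m` there. Poincaré on `B(z,2r)` and the two Fubini
  -- estimates conclude; the neighbourhoods add up to width `2λr + r`. The measurable majorant `G`
  -- spares any measurability of `lipConst h`.
  obtain ⟨CP, lam, hlam, hPoin⟩ := hP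
  obtain ⟨C1, -, hC1⟩ := hD.exists_lintegral_le_average
  obtain ⟨C2, -, hC2⟩ := hD.exists_ball_le 1 2
  obtain ⟨C3, -, hC3⟩ := hD.exists_lintegral_average_le (b := 2 * lam) (by positivity)
  set q := p.toReal
  refine ⟨C1 * (C2 * 2 ^ (q - 1) * 2 * (CP * 2 ^ q)) * C3, 2 * lam + 1,
    by finiteness, by linarith, fun h hh G hG hhG r hr U hU => ?_⟩
  have hm : Measurable h := hh.choose_spec.continuous.measurable
  have hrq : ENNReal.ofReal r ^ q ≠ 0 := by
    rw [Ne, ENNReal.rpow_eq_zero_iff]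
    simp only [ENNReal.ofReal_eq_zero, ENNReal.ofReal_ne_top, false_and, or_false, not_and]
    exact fun h => absurd h (not_le.2 hr)
  have hrq' : ENNReal.ofReal r ^ q ≠ ∞ := by finiteness
  unfold energy
  rw [ENNReal.inv_mul_le_iff hrq hrq']
  set D : X → ℝ≥0∞ := fun x => ⨍⁻ y in ball x r, ‖h y - h x‖ₑ ^ q ∂μ with hDdef
  have hDm : Measurable D := measurable_setLAverage_ball (measurable_enorm_sub_rpow hm q) r
  have key : ∀ z, (∫⁻ x in ball z r, D x ∂μ) / μ (ball z r) ≤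
      (C2 * 2 ^ (q - 1) * 2 * (CP * 2 ^ q)) * ENNReal.ofReal r ^ q *
        ((∫⁻ y in ball z (2 * lam * r), G y ∂μ) / μ (ball z r)) := by
    intro z
    set m := ⨍ y in ball z (2 * r), h y ∂μ
    set J := ∫⁻ y in ball z (2 * r), ‖h y - m‖ₑ ^ q ∂μ
    have hB : μ (ball z r) ≠ 0 := (hD.ball_pos z hr).ne'
    have hB' : μ (ball z r) ≠ ∞ := (hD.ball_lt_top z r).ne
    have hmm : Measurable fun y => ‖h y - m‖ₑ ^ q := (hm.sub_const m).enorm.pow_const q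
    have hsub2 : ball z r ⊆ ball z (2 * r) := ball_subset_ball (by linarith)
    have hDx : ∀ x ∈ ball z r, D x ≤ C2 * 2 ^ (q - 1) * (J / μ (ball z r) + ‖h x - m‖ₑ ^ q) := by
      intro x hx
      have hsub : ball x r ⊆ ball z (2 * r) :=
        ball_subset_ball' (by linarith [mem_ball.1 hx])
      have hμ : μ (ball z (2 * r)) ≤ C2 * μ (ball x r) :=
        hC2 x z r hr (by rw [one_mul]; exact (mem_ball.1 hx).le)
      have h2 : 0 < μ (ball z (2 * r)) := hD.ball_pos z (by positivity)
      have h2' := (hD.ball_lt_top z (2 * r)).ne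
      have havg : ∀ F : X → ℝ≥0∞, ⨍⁻ y in ball x r, F y ∂μ ≤ C2 * ⨍⁻ y in ball z (2 * r), F y ∂μ := by
        intro F
        rw [setLAverage_eq, setLAverage_eq]
        refine ENNReal.div_le_of_le_mul ?_
        calc ∫⁻ y in ball x r, F y ∂μ ≤ ∫⁻ y in ball z (2 * r), F y ∂μ := lintegral_mono_set hsub
          _ = (∫⁻ y in ball z (2 * r), F y ∂μ) / μ (ball z (2 * r)) * μ (ball z (2 * r)) :=
              (ENNReal.div_mul_cancel h2.ne' h2').symm
          _ ≤ (∫⁻ y in ball z (2 * r), F y ∂μ) / μ (ball z (2 * r)) * (C2 * μ (ball x r)) := by gcongr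
          _ = _ := by ring
      calc D x ≤ C2 * ⨍⁻ y in ball z (2 * r), ‖h y - h x‖ₑ ^ q ∂μ := havg _
        _ ≤ C2 * ⨍⁻ y in ball z (2 * r), 2 ^ (q - 1) * (‖h y - m‖ₑ ^ q + ‖h x - m‖ₑ ^ q) ∂μ := by
            refine mul_le_mul' le_rfl (setLAverage_mono measurableSet_ball fun y _ => ?_)
            rw [← enorm_neg (h x - m), show h y - h x = (h y - m) + -(h x - m) by ring]
            exact enorm_add_rpow_le hq _ _
        _ = C2 * (2 ^ (q - 1) * (J / μ (ball z (2 * r)) + ‖h x - m‖ₑ ^ q)) := by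
            rw [setLAverage_const_mul _ (hmm.add_const _), setLAverage_add hmm,
              setLAverage_const h2.ne' h2', setLAverage_eq]
        _ ≤ C2 * (2 ^ (q - 1) * (J / μ (ball z r) + ‖h x - m‖ₑ ^ q)) := by
            gcongr
        _ = _ := by rw [mul_assoc]
    have hJ : J ≤ CP * ENNReal.ofReal (2 * r) ^ q * ∫⁻ y in ball z (2 * lam * r), G y ∂μ := by
      refine (hPoin h hh z (2 * r) (by positivity)).trans ?_
      rw [show lam * (2 * r) = 2 * lam * r by ring]
      gcongr with y
      exact hhG y
    rw [← setLAverage_eq]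
    calc ⨍⁻ x in ball z r, D x ∂μ
        ≤ ⨍⁻ x in ball z r, C2 * 2 ^ (q - 1) * (J / μ (ball z r) + ‖h x - m‖ₑ ^ q) ∂μ :=
          setLAverage_mono measurableSet_ball hDx
      _ = C2 * 2 ^ (q - 1) * (J / μ (ball z r) + (∫⁻ x in ball z r, ‖h x - m‖ₑ ^ q ∂μ) / μ (ball z r)) := by
          rw [setLAverage_const_mul _ (hmm.const_add _), setLAverage_add measurable_const,
            setLAverage_const hB hB', setLAverage_eq]
      _ ≤ C2 * 2 ^ (q - 1) * (J / μ (ball z r) + J / μ (ball z r)) := by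
          gcongr
          exact lintegral_mono_set hsub2
      _ = C2 * 2 ^ (q - 1) * 2 * (J / μ (ball z r)) := by ring
      _ ≤ C2 * 2 ^ (q - 1) * 2 * ((CP * ENNReal.ofReal (2 * r) ^ q *
            ∫⁻ y in ball z (2 * lam * r), G y ∂μ) / μ (ball z r)) := by gcongr
      _ = _ := by
          rw [ENNReal.ofReal_mul zero_le_two, ENNReal.mul_rpow_of_nonneg _ _ (by linarith),
            ENNReal.ofReal_ofNat]
          simp only [div_eq_mul_inv]
          ring
  calc ∫⁻ x in U, D x ∂μ
      ≤ C1 * ∫⁻ z in thickening r U, (∫⁻ x in ball z r, D x ∂μ) / μ (ball z r) ∂μ :=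
        hC1 r hr D hDm U hU
    _ ≤ C1 * ∫⁻ z in thickening r U, (C2 * 2 ^ (q - 1) * 2 * (CP * 2 ^ q)) * ENNReal.ofReal r ^ q *
        ((∫⁻ y in ball z (2 * lam * r), G y ∂μ) / μ (ball z r)) ∂μ := by
        gcongr with z
        exact key z
    _ = C1 * ((C2 * 2 ^ (q - 1) * 2 * (CP * 2 ^ q)) * ENNReal.ofReal r ^ q *
        ∫⁻ z in thickening r U, ((∫⁻ y in ball z (2 * lam * r), G y ∂μ) / μ (ball z r)) ∂μ) := by
        rw [lintegral_const_mul]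
        exact (measurable_setLIntegral_ball (F := fun _ y => G y) (hG.comp measurable_snd) _).div
          (measurable_measure_ball r)
    _ ≤ C1 * ((C2 * 2 ^ (q - 1) * 2 * (CP * 2 ^ q)) * ENNReal.ofReal r ^ q *
        (C3 * ∫⁻ y in thickening (2 * lam * r) (thickening r U), G y ∂μ)) := by
        gcongr
        exact hC3 r hr G hG _ isOpen_thickening.measurableSet
    _ ≤ C1 * ((C2 * 2 ^ (q - 1) * 2 * (CP * 2 ^ q)) * ENNReal.ofReal r ^ q *
        (C3 * ∫⁻ y in thickening ((2 * lam + 1) * r) U, G y ∂μ)) := by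
        gcongr
        refine (thickening_thickening_subset _ _ _).trans (thickening_mono (le_of_eq ?_) _)
        ring
    _ = _ := by ring

omit [BorelSpace X] [SecondCountableTopology X] [SFinite μ] in
theorem IsDoubling.integrableOn_ball (hD : IsDoubling μ) [hp : Fact (1 ≤ p)] {f : X → ℝ}
    (hf : MemLp f p μ) (x : X) (r : ℝ) : IntegrableOn f (ball x r) μ := by
  have : Fact (μ (ball x r) < ∞) := ⟨hD.ball_lt_top x r⟩
  exact (hf.restrict (ball x r)).integrable hp.out

/-- Weak monotonicity of the energies in the scale. -/
theorem exists_energy_le_energy (hD : IsDoubling μ) (hP : SatisfiesPoincare μ p)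
    [hp : Fact (1 ≤ p)] (hq : 1 ≤ p.toReal) :
    ∃ (C : ℝ≥0∞) (c : ℝ), C ≠ ∞ ∧ 1 ≤ c ∧ ∀ f : X → ℝ, Measurable f → MemLp f p μ →
      ∀ U : Set X, MeasurableSet U → Bornology.IsBounded U → ∀ s r : ℝ, 0 < s → s ≤ r →
      energy μ p r f U ≤ C * energy μ p s f (thickening (c * r) U) := by
  obtain ⟨C1, c, hC1, hc, H1⟩ := exists_energy_le_lipConst hD hP hq
  obtain ⟨C2, hC2⟩ := hD.exists_mollify_rpow_bounds hq
  obtain ⟨C3, hC3, H3⟩ := hD.exists_energy_le_lintegral (p := p) hq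
  set q := p.toReal with hqdef
  set C := 2 ^ (q - 1) * (C1 * C2 + C3 * C2) with hC
  have main : ∀ f : X → ℝ, Measurable f → Integrable f μ → ∀ (x₀ : X) (R : ℝ),
      (∀ x, x ∉ ball x₀ R → f x = 0) →
      ∀ U : Set X, MeasurableSet U → ∀ s r : ℝ, 0 < s → s ≤ r →
      energy μ p r f U ≤ C * energy μ p s f (thickening (c * r) U) := by
    intro f hfm hf x₀ R hR U hU s r hs hsr
    have hr := hs.trans_le hsr
    -- Mollifying at scale `s / 2` produces averages over balls of radius exactly `s`.
    obtain ⟨hLip, -⟩ := hD.mollify_lipschitz hf hR (half_pos hs)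
    have hb := hC2 f hfm (fun _ _ => hf.integrableOn) (s / 2) (half_pos hs)
    rw [mul_div_cancel₀ _ two_ne_zero] at hb
    set T := mollify μ (s / 2) f
    have hT : Measurable T := hLip.choose_spec.continuous.measurable
    set D : X → ℝ≥0∞ := fun x => ⨍⁻ y in ball x s, ‖f y - f x‖ₑ ^ q ∂μ with hDdef
    have hDm : Measurable D := measurable_setLAverage_ball (measurable_enorm_sub_rpow hfm q) s
    have e1 : energy μ p r T U ≤ C1 * C2 * energy μ p s f (thickening (c * r) U) := by
      refine (H1 T hLip (fun x => C2 * (ENNReal.ofReal s ^ q)⁻¹ * D x) (hDm.const_mul _)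
        (fun x => (hb x).2) r hr U hU).trans ?_
      rw [lintegral_const_mul _ hDm, mul_assoc C1, energy, mul_assoc]
    have e2 : energy μ p r (fun x => f x - T x) U
        ≤ C3 * C2 * energy μ p s f (thickening (c * r) U) := by
      refine (H3 r hr _ (hfm.sub hT) U hU).trans ?_
      calc _ ≤ (ENNReal.ofReal s ^ q)⁻¹ * (C3 * ∫⁻ x in thickening (c * r) U, C2 * D x ∂μ) := by
            refine mul_le_mul' ?_ (mul_le_mul' le_rfl ?_)
            · gcongr
            · refine (lintegral_mono fun x => (hb x).1).trans (lintegral_mono_set ?_)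
              exact thickening_mono (by nlinarith) U
        _ = _ := by
            rw [lintegral_const_mul _ hDm, energy]; ring
    calc energy μ p r f U = energy μ p r (fun x => T x + (f x - T x)) U := by simp
      _ ≤ 2 ^ (q - 1) * (energy μ p r T U + energy μ p r (fun x => f x - T x) U) :=
          energy_add_le hq hT (hfm.sub hT) r U
      _ ≤ 2 ^ (q - 1) * (C1 * C2 * energy μ p s f (thickening (c * r) U) +
          C3 * C2 * energy μ p s f (thickening (c * r) U)) := by gcongr
      _ = _ := by rw [hC]; ring
  refine ⟨C, c, by finiteness, hc, fun f hfm hf U hU hUb s r hs hsr => ?_⟩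
  have hr := hs.trans_le hsr
  rcases U.eq_empty_or_nonempty with rfl | ⟨x₀, -⟩
  · simp [energy]
  obtain ⟨R, hR⟩ := hUb.subset_ball x₀
  -- Truncating `f` to this ball changes neither energy, and makes it integrable with bounded
  -- support.
  set R' := s + (c * r + R)
  have hsub : thickening s (thickening (c * r) U) ⊆ ball x₀ R' := by
    refine (thickening_subset_of_subset _ ((thickening_subset_of_subset _ hR).trans
      (thickening_ball _ _ _))).trans (thickening_ball _ _ _)
  set g := (ball x₀ R').indicator f
  have hgf : Set.EqOn f g (ball x₀ R') := fun x hx => (Set.indicator_of_mem hx f).symm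
  have hcr : 0 < c * r := by positivity
  rw [energy_congr_of_eqOn hU (g := g) (hgf.mono ?_) hr,
    energy_congr_of_eqOn isOpen_thickening.measurableSet (g := g) (hgf.mono hsub) hs]
  · exact main g (hfm.indicator measurableSet_ball)
      ((integrable_indicator_iff measurableSet_ball).2 (hD.integrableOn_ball hf x₀ R')) x₀ R'
      (fun x hx => Set.indicator_of_notMem hx f) U hU s r hs hsr
  · exact (thickening_mono (by nlinarith) U).trans ((self_subset_thickening hs _).trans hsub)

end Monotonicity

/-! ### Compactness of Γ- and Γ̄-convergence -/

section Gamma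

/-- A diagonal argument: approximate recovery at every precision gives a recovery sequence. -/
theorem exists_recovery_sequence {Y : Type*} [PseudoMetricSpace Y] (E : ℕ → Y → ℝ≥0∞) (f : Y)
    (c : ℝ≥0∞) (h : ∀ ε : ℝ, 0 < ε → ∀ᶠ n in atTop, ∃ u, dist u f < ε ∧
      E n u ≤ c + ENNReal.ofReal ε) :
    ∃ u : ℕ → Y, Tendsto u atTop (𝓝 f) ∧ limsup (fun n => E n (u n)) atTop ≤ c := by
  classical
  have h' : ∀ k : ℕ, ∃ N, ∀ n ≥ N, ∃ u, dist u f < 1 / ((k : ℝ) + 1) ∧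
      E n u ≤ c + ENNReal.ofReal (1 / ((k : ℝ) + 1)) := fun k =>
    eventually_atTop.1 (h _ (by positivity))
  choose N hN using h'
  -- `κ n` is the finest precision `k ≤ n` whose threshold `N k` has been passed; it tends to
  -- infinity.
  set κ : ℕ → ℕ := fun n => Nat.findGreatest (fun k => N k ≤ n) n with hκ
  have hκN : ∀ n ≥ N 0, N (κ n) ≤ n := fun n hn =>
    Nat.findGreatest_spec (P := fun k => N k ≤ n) (Nat.zero_le n) hn
  have hκj : ∀ j, ∀ n ≥ max j (N j), j ≤ κ n := fun j n hn =>
    Nat.le_findGreatest ((le_max_left _ _).trans hn) ((le_max_right _ _).trans hn)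
  have hex : ∀ n, ∃ u, N 0 ≤ n → dist u f < 1 / ((κ n : ℝ) + 1) ∧
      E n u ≤ c + ENNReal.ofReal (1 / ((κ n : ℝ) + 1)) := by
    intro n
    by_cases hn : N 0 ≤ n
    · obtain ⟨u, hu⟩ := hN (κ n) n (hκN n hn)
      exact ⟨u, fun _ => hu⟩
    · exact ⟨f, fun h => absurd h hn⟩
  choose u hu using hex
  have hev : ∀ ε : ℝ, 0 < ε → ∀ᶠ n in atTop, dist (u n) f < ε ∧ E n (u n) ≤ c + ENNReal.ofReal ε := by
    intro ε hε
    obtain ⟨j, hj⟩ := exists_nat_one_div_lt hε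
    filter_upwards [eventually_ge_atTop (N 0), eventually_ge_atTop (max j (N j))] with n h0 hn
    have h1 : 1 / ((κ n : ℝ) + 1) ≤ ε := by
      refine le_trans ?_ hj.le
      have : (j : ℝ) ≤ κ n := by exact_mod_cast hκj j n hn
      gcongr
    exact ⟨(hu n h0).1.trans_le h1, (hu n h0).2.trans (by gcongr)⟩
  refine ⟨u, Metric.tendsto_nhds.2 fun ε hε => (hev ε hε).mono fun n hn => hn.1, ?_⟩
  refine ENNReal.le_of_forall_pos_le_add fun ε hε _ => ?_
  refine limsup_le_of_le (by isBoundedDefault) ((hev ε (by exact_mod_cast hε)).mono fun n hn => ?_)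
  simpa using hn.2

/-- Sequential compactness of `Γ`-convergence, simultaneously for countably many sequences. -/
theorem exists_gammaConverges_subseq {Y ι : Type*} [PseudoMetricSpace Y]
    [SecondCountableTopology Y] [Countable ι] (E : ι → ℕ → Y → ℝ≥0∞) :
    ∃ φ : ℕ → ℕ, StrictMono φ ∧ ∀ i, ∃ F, GammaConverges (fun n => E i (φ n)) F := by
  set β := countableBasis Y
  have : Countable β := (countable_countableBasis Y).to_subtype
  -- The infima over countably many basic open sets form a point of a countable power of `ℝ≥0∞`,
  -- which is sequentially compact. The `Γ`-limit at `f` is the supremum of the limiting infima over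
  -- basic neighbourhoods of `f`.
  obtain ⟨L, φ, hφ, hL⟩ := CompactSpace.tendsto_subseq
    (fun n => fun z : β × ι => ⨅ u ∈ (z.1 : Set Y), E z.2 n u)
  rw [tendsto_pi_nhds] at hL
  refine ⟨φ, hφ, fun i => ⟨fun f => ⨆ (b : β) (_ : f ∈ (b : Set Y)), L (b, i), ?_, ?_⟩⟩
  · intro f u hu
    refine iSup₂_le fun b hb => ?_
    rw [← (hL (b, i)).liminf_eq]
    refine liminf_le_liminf ?_
    filter_upwards [hu.eventually ((isOpen_of_mem_countableBasis b.2).mem_nhds hb)] with n hn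
    exact iInf₂_le (u n) hn
  · intro f
    set c := ⨆ (b : β) (_ : f ∈ (b : Set Y)), L (b, i) with hc
    rcases eq_or_ne c ∞ with h | h
    · exact ⟨fun _ => f, tendsto_const_nhds, le_top.trans_eq h.symm⟩
    refine exists_recovery_sequence _ f c fun ε hε => ?_
    obtain ⟨b, hb, hfb, hsub⟩ := (isBasis_countableBasis Y).exists_subset_of_mem_open
      (mem_ball_self hε) (isOpen_ball (x := f) (ε := ε))
    have hle : L (⟨b, hb⟩, i) ≤ c :=
      le_iSup₂ (f := fun (b : β) (_ : f ∈ (b : Set Y)) => L (b, i)) ⟨b, hb⟩ hfb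
    have hlt : L (⟨b, hb⟩, i) < c + ENNReal.ofReal ε :=
      hle.trans_lt (ENNReal.lt_add_right h (by simpa using hε))
    filter_upwards [(hL (⟨b, hb⟩, i)).eventually (gt_mem_nhds hlt)] with n hn
    simp only [Function.comp_apply, iInf_lt_iff] at hn
    obtain ⟨u, hu, hlt⟩ := hn
    exact ⟨u, hsub hu, hlt.le⟩

variable {X : Type*} [TopologicalSpace X]

theorem CompactlyIn.subset {U V : Opens X} (h : CompactlyIn U V) : U ≤ V :=
  fun _ hx => h.2 (subset_closure hx)

theorem CompactlyIn.mono {U U' V V' : Opens X} (h : CompactlyIn U V) (hU : U' ≤ U) (hV : V ≤ V') :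
    CompactlyIn U' V' :=
  ⟨h.1.of_isClosed_subset isClosed_closure (closure_mono hU),
    (closure_mono hU).trans (h.2.trans hV)⟩

theorem CompactlyIn.union {U U' V V' : Opens X} (h : CompactlyIn U V) (h' : CompactlyIn U' V') :
    CompactlyIn (U ⊔ U') (V ⊔ V') := by
  unfold CompactlyIn
  rw [Opens.coe_sup, closure_union]
  exact ⟨h.1.union h'.1, Set.union_subset_union h.2 h'.2⟩

theorem exists_compactlyIn_of_isCompact [LocallyCompactSpace X] [T2Space X] {K : Set X}
    (hK : IsCompact K) {V : Opens X} (hKV : K ⊆ V) :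
    ∃ W : Opens X, K ⊆ W ∧ CompactlyIn W V := by
  obtain ⟨W, hWo, hKW, hWV, hWc⟩ := exists_open_between_and_isCompact_closure hK V.2 hKV
  exact ⟨⟨W, hWo⟩, hKW, hWc, hWV⟩

theorem CompactlyIn.exists_between [LocallyCompactSpace X] [T2Space X] {U V : Opens X}
    (h : CompactlyIn U V) : ∃ W : Opens X, CompactlyIn U W ∧ CompactlyIn W V := by
  obtain ⟨W, h1, h2⟩ := exists_compactlyIn_of_isCompact h.1 h.2
  exact ⟨W, ⟨h.1, h1⟩, h2⟩

/-- Sequential compactness of `Γ`- and `Γ̄`-convergence for functionals that are increasing in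
the set variable. -/
theorem exists_gammaBarConverges_subseq [LocallyCompactSpace X] [T2Space X]
    [SecondCountableTopology X] {Y : Type*} [PseudoMetricSpace Y] [SecondCountableTopology Y]
    (E : ℕ → Y → Set X → ℝ≥0∞) (hE : ∀ n f, Monotone (E n f)) :
    ∃ (φ : ℕ → ℕ) (F : Y → ℝ≥0∞) (G : Y → Opens X → ℝ≥0∞), StrictMono φ ∧
      GammaConverges (fun n f => E (φ n) f Set.univ) F ∧
      GammaBarConverges (fun n f (U : Opens X) => E (φ n) f U) G := by
  set β := countableBasis X with hβ
  have : Countable β := (countable_countableBasis X).to_subtype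
  set O : Finset β → Set X := fun s => ⋃ b ∈ s, (b : Set X) with hO
  have hOo : ∀ s, IsOpen (O s) := fun s =>
    isOpen_biUnion fun b _ => isOpen_of_mem_countableBasis b.2
  -- Finite unions of basic open sets are a countable family that interpolates between any `U ⋐ V`,
  -- by compactness of the closure. The index `none` adds the whole space, so one subsequence serves
  -- both limits.
  obtain ⟨φ, hφ, H⟩ := exists_gammaConverges_subseq
    (fun (i : Option (Finset β)) n f => E n f (i.elim Set.univ O))
  obtain ⟨F, hF⟩ := H none
  choose G hG using fun s => H (some s)
  refine ⟨φ, F, fun f V => ⨆ (s : Finset β) (_ : CompactlyIn ⟨O s, hOo s⟩ V), G s f, hφ, hF, ?_, ?_⟩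
  · intro f U u hu
    refine iSup₂_le fun s hs => ((hG s).1 f u hu).trans ?_
    exact liminf_le_liminf (Eventually.of_forall fun n => hE _ _ hs.subset)
  · intro f U V hUV
    obtain ⟨W, hUW, hWV⟩ := hUV.exists_between
    have hcov : ∀ x : X, ∃ b : β, x ∈ W → x ∈ (b : Set X) ∧ (b : Set X) ⊆ W := by
      intro x
      by_cases hx : x ∈ W
      · obtain ⟨b, hb, hxb, hsub⟩ := (isBasis_countableBasis X).exists_subset_of_mem_open hx W.2
        exact ⟨⟨b, hb⟩, fun _ => ⟨hxb, hsub⟩⟩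
      · obtain ⟨b, hb, -⟩ := (isBasis_countableBasis X).exists_subset_of_mem_open
          (Set.mem_univ x) isOpen_univ
        exact ⟨⟨b, hb⟩, fun h => absurd h hx⟩
    choose b hb using hcov
    obtain ⟨t, ht, hsub⟩ := hUW.1.elim_nhds_subcover (fun x => (b x : Set X)) fun x hx =>
      (isOpen_of_mem_countableBasis (b x).2).mem_nhds (hb x (hUW.2 hx)).1
    classical
    set s := t.image b
    have hOs : O s = ⋃ x ∈ t, (b x : Set X) :=
      Finset.set_biUnion_finset_image
    have hsW : O s ⊆ W := by
      rw [hOs]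
      exact Set.iUnion₂_subset fun x hx => (hb x (hUW.2 (ht x hx))).2
    obtain ⟨u, hu, hlim⟩ := (hG s).2 f
    refine ⟨u, hu, ?_⟩
    calc limsup (fun n => E (φ n) (u n) U) atTop ≤ limsup (fun n => E (φ n) (u n) (O s)) atTop :=
          limsup_le_limsup (Eventually.of_forall fun n =>
            hE _ _ (subset_closure.trans (hsub.trans hOs.ge)))
      _ ≤ G s f := hlim
      _ ≤ _ := le_iSup₂ (f := fun (s : Finset β) (_ : CompactlyIn ⟨O s, hOo s⟩ V) => G s f) s
          (hWV.mono hsW le_rfl)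

end Gamma

/-! ### The De Giorgi-Letta criterion -/

section DeGiorgiLetta

/-- The De Giorgi-Letta criterion: a countably subadditive, increasing set function on open sets
which is superadditive on disjoint sets is the restriction of a Borel measure. -/
theorem exists_measure_eq_on_opens {X : Type*} [MetricSpace X] [MeasurableSpace X] [BorelSpace X]
    (α : Opens X → ℝ≥0∞) (h0 : α ⊥ = 0) (hmono : Monotone α)
    (hsub : ∀ U : ℕ → Opens X, α (⨆ i, U i) ≤ ∑' i, α (U i))
    (hadd : ∀ U V : Opens X, Disjoint (U : Set X) V → α U + α V ≤ α (U ⊔ V)) :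
    ∃ ν : Measure X, ∀ U : Opens X, ν U = α U := by
  set m : ∀ s : Set X, IsOpen s → ℝ≥0∞ := fun s hs => α ⟨s, hs⟩
  have m0 : m ∅ isOpen_empty = 0 := h0
  have PU : ∀ ⦃f : ℕ → Set X⦄, (∀ i, IsOpen (f i)) → IsOpen (⋃ i, f i) := fun f hf =>
    isOpen_iUnion hf
  have msU : ∀ ⦃f : ℕ → Set X⦄ (hm : ∀ i, IsOpen (f i)),
      m (⋃ i, f i) (PU hm) ≤ ∑' i, m (f i) (hm i) := by
    intro f hm
    refine le_trans (le_of_eq ?_) (hsub fun i => ⟨f i, hm i⟩)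
    congr 1
    ext x
    simp
  have mm : ∀ ⦃s t : Set X⦄ (hs : IsOpen s) (ht : IsOpen t), s ⊆ t → m s hs ≤ m t ht :=
    fun s t hs ht hst => hmono hst
  -- It suffices that this outer measure is additive on sets at positive distance: Carathéodory's
  -- criterion then makes every Borel set measurable.
  set o := inducedOuterMeasure m isOpen_empty m0
  have ho : ∀ U : Opens X, o U = α U := fun U => inducedOuterMeasure_eq' PU msU mm U.2
  have hmetric : o.IsMetric := by
    rintro s t ⟨r, hr, hst⟩
    refine le_antisymm (measure_union_le _ _) ?_
    have hoinf : o (s ∪ t) = ⨅ (W : Set X) (hW : IsOpen W) (_ : s ∪ t ⊆ W), m W hW :=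
      inducedOuterMeasure_eq_iInf PU msU mm _
    rw [hoinf]
    refine le_iInf fun W => le_iInf fun hW => le_iInf fun hWst => ?_
    -- For sets at distance at least `r`, neighbourhoods of radius `r / 2` are disjoint, so
    -- superadditivity on open sets applies inside any open cover `W`.
    set A : Set X → Opens X := fun u =>
      ⟨W ∩ ⋃ x ∈ u, eball x (r / 2), hW.inter (isOpen_biUnion fun x _ => isOpen_eball)⟩
    have hr2 : 0 < r / 2 := ENNReal.half_pos hr
    have hA : ∀ u, u ⊆ W → u ⊆ A u := fun u hu x hx =>
      ⟨hu hx, Set.mem_biUnion hx (mem_eball_self hr2)⟩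
    have hdisj : Disjoint (A s : Set X) (A t) := by
      rw [Set.disjoint_left]
      rintro z ⟨-, hz⟩ ⟨-, hz'⟩
      simp only [Set.mem_iUnion, exists_prop, mem_eball] at hz hz'
      obtain ⟨x, hx, hzx⟩ := hz
      obtain ⟨y, hy, hzy⟩ := hz'
      have h1 := hst x hx y hy
      have h2 : edist x y < r / 2 + r / 2 :=
        (edist_triangle_left x y z).trans_lt (ENNReal.add_lt_add hzx hzy)
      rw [ENNReal.add_halves] at h2
      exact absurd h1 (not_le.2 h2)
    calc o s + o t ≤ o (A s) + o (A t) := by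
          gcongr
          · exact hA s (Set.subset_union_left.trans hWst)
          · exact hA t (Set.subset_union_right.trans hWst)
      _ = α (A s) + α (A t) := by rw [ho, ho]
      _ ≤ α (A s ⊔ A t) := hadd _ _ hdisj
      _ ≤ α ⟨W, hW⟩ := hmono (sup_le (fun _ h => h.1) fun _ h => h.1)
  refine ⟨o.toMeasure hmetric.le_caratheodory, fun U => ?_⟩
  rw [toMeasure_apply _ _ U.isOpen.measurableSet, ho]

end DeGiorgiLetta

/-! ### Gluing with a cutoff function -/

section Gluing

/-- Convexity applied to `x + y = w (x / w) + (1 - w) (y / (1 - w))` gives the coefficient `w^{1-q}`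
for `x^q`, and `w` is chosen so that this equals `K`. Having `K` arbitrarily close to one is what
makes the `Γ̄`-limit subadditive without a constant. -/
theorem exists_add_rpow_le {q : ℝ} (hq : 1 < q) {K : ℝ≥0} (hK : 1 < K) :
    ∃ K' : ℝ≥0, ∀ x y : ℝ≥0∞, (x + y) ^ q ≤ K * x ^ q + K' * y ^ q := by
  have hq1 : 0 < q - 1 := by linarith
  set w : ℝ≥0 := K⁻¹ ^ (1 / (q - 1)) with hw
  have hK0 : 0 < K := zero_lt_one.trans hK
  have hw0 : 0 < w := NNReal.rpow_pos (inv_pos.2 hK0)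
  have hw1 : w < 1 := NNReal.rpow_lt_one (inv_lt_one_of_one_lt₀ hK) (by positivity)
  have hv0 : 0 < 1 - w := tsub_pos_of_lt hw1
  have hwK : w * (w⁻¹) ^ q = K := by
    have : w ^ (q - 1) = K⁻¹ := by
      rw [hw, ← NNReal.rpow_mul, one_div, inv_mul_cancel₀ hq1.ne', NNReal.rpow_one]
    rw [NNReal.inv_rpow, ← inv_inv K, ← this, ← NNReal.rpow_neg, ← NNReal.rpow_neg]
    nth_rewrite 1 [← NNReal.rpow_one w]
    rw [← NNReal.rpow_add hw0.ne']
    congr 1; ring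
  refine ⟨(1 - w) * ((1 - w)⁻¹) ^ q, fun x y => ?_⟩
  have h := ENNReal.rpow_arith_mean_le_arith_mean2_rpow (w : ℝ≥0∞) ((1 - w : ℝ≥0) : ℝ≥0∞)
    ((w : ℝ≥0∞)⁻¹ * x) (((1 - w : ℝ≥0) : ℝ≥0∞)⁻¹ * y)
    (by rw [← ENNReal.coe_add, add_tsub_cancel_of_le hw1.le, ENNReal.coe_one]) hq.le
  have hne : ∀ v : ℝ≥0, 0 < v → ∀ z : ℝ≥0∞, (v : ℝ≥0∞) * ((v : ℝ≥0∞)⁻¹ * z) = z := fun v hv z => by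
    rw [← mul_assoc, ENNReal.mul_inv_cancel (by simpa using hv.ne') ENNReal.coe_ne_top, one_mul]
  have hne2 : ∀ v : ℝ≥0, 0 < v → ∀ z : ℝ≥0∞, (v : ℝ≥0∞) * ((v : ℝ≥0∞)⁻¹ * z) ^ q
      = ((v * (v⁻¹) ^ q : ℝ≥0) : ℝ≥0∞) * z ^ q := fun v hv z => by
    rw [ENNReal.mul_rpow_of_nonneg _ _ (by linarith), ← mul_assoc, ENNReal.coe_mul,
      ENNReal.coe_rpow_of_nonneg _ (by linarith), ENNReal.coe_inv hv.ne']
  rwa [hne w hw0, hne _ hv0, hne2 w hw0, hne2 _ hv0, hwK] at h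

theorem enorm_convex_rpow_le {q : ℝ} (hq : 1 ≤ q) {t : ℝ} (h0 : 0 ≤ t) (h1 : t ≤ 1) (a b : ℝ) :
    ‖t * a + (1 - t) * b‖ₑ ^ q ≤ ENNReal.ofReal t * ‖a‖ₑ ^ q + ENNReal.ofReal (1 - t) * ‖b‖ₑ ^ q := by
  calc _ ≤ (ENNReal.ofReal t * ‖a‖ₑ + ENNReal.ofReal (1 - t) * ‖b‖ₑ) ^ q := by
        gcongr
        refine (enorm_add_le _ _).trans (le_of_eq ?_)
        rw [enorm_mul, enorm_mul, Real.enorm_of_nonneg h0, Real.enorm_of_nonneg (sub_nonneg.2 h1)]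
    _ ≤ _ := ENNReal.rpow_arith_mean_le_arith_mean2_rpow _ _ _ _
        (by rw [← ENNReal.ofReal_add h0 (sub_nonneg.2 h1)]; simp) hq

variable {X : Type*} [MetricSpace X] [MeasurableSpace X] [BorelSpace X]
  [SecondCountableTopology X] {μ : Measure X} [SFinite μ] {p : ℝ≥0∞}

/-- Gluing two functions with a Lipschitz cutoff almost adds up the energies. -/
theorem IsDoubling.exists_energy_glue_le (hD : IsDoubling μ) (hq : 1 < p.toReal) {K : ℝ≥0}
    (hK : 1 < K) : ∃ C : ℝ≥0, ∀ (L : ℝ≥0) (η : X → ℝ), LipschitzWith L η → (∀ x, 0 ≤ η x) →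
      (∀ x, η x ≤ 1) → ∀ A A' V : Set X, MeasurableSet A → MeasurableSet A' → MeasurableSet V →
      (∀ x ∈ A', η x = 1) → (∀ x, x ∉ A → η x = 0) → ∀ f g : X → ℝ, Measurable f → Measurable g →
      ∀ r : ℝ, 0 < r →
      energy μ p r (fun x => η x * f x + (1 - η x) * g x) (A' ∪ V) ≤
        K * (energy μ p r f A + energy μ p r g V) +
          C * (L ^ p.toReal : ℝ≥0∞) * ∫⁻ x, ‖f x - g x‖ₑ ^ p.toReal ∂μ := by
  obtain ⟨C, -, hC⟩ := hD.exists_lintegral_average_le one_pos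
  set q := p.toReal
  obtain ⟨K', hK'⟩ := exists_add_rpow_le hq hK
  have hq0 : 0 ≤ q := by linarith
  refine ⟨K' * C, fun L η hη h0 h1 A A' V hA hA' hV hηA' hηA f g hf hg r hr => ?_⟩
  have hrq : ENNReal.ofReal r ^ q ≠ 0 := by
    rw [Ne, ENNReal.rpow_eq_zero_iff]
    simp only [ENNReal.ofReal_eq_zero, ENNReal.ofReal_ne_top, false_and, or_false, not_and]
    exact fun h => absurd h (not_le.2 hr)
  have hrq' : ENNReal.ofReal r ^ q ≠ ∞ := by finiteness
  set Df : X → ℝ≥0∞ := fun x => ⨍⁻ y in ball x r, ‖f y - f x‖ₑ ^ q ∂μ with hDf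
  set Dg : X → ℝ≥0∞ := fun x => ⨍⁻ y in ball x r, ‖g y - g x‖ₑ ^ q ∂μ with hDg
  have hDfm : Measurable Df := measurable_setLAverage_ball (measurable_enorm_sub_rpow hf q) r
  have hDgm : Measurable Dg := measurable_setLAverage_ball (measurable_enorm_sub_rpow hg q) r
  have hfgm : Measurable fun x => ‖f x - g x‖ₑ ^ q := (hf.sub hg).enorm.pow_const _
  set M : X → ℝ≥0∞ := fun x => ⨍⁻ y in ball x r, ‖f y - g y‖ₑ ^ q ∂μ with hM
  have hMm : Measurable M := measurable_setLAverage_ball (F := fun _ y => ‖f y - g y‖ₑ ^ q)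
    (hfgm.comp measurable_snd) r
  have hMint : ∫⁻ x in A' ∪ V, M x ∂μ ≤ C * ∫⁻ x, ‖f x - g x‖ₑ ^ q ∂μ := by
    have := hC r hr _ hfgm (A' ∪ V) (hA'.union hV)
    simp only [one_mul, ← setLAverage_eq] at this
    exact this.trans (by gcongr; exact Measure.restrict_le_self)
  have hpt : ∀ x ∈ A' ∪ V, ⨍⁻ y in ball x r,
      ‖(η y * f y + (1 - η y) * g y) - (η x * f x + (1 - η x) * g x)‖ₑ ^ q ∂μ ≤
      K * (A.indicator Df x + V.indicator Dg x) + K' * ((L : ℝ≥0∞) ^ q * ENNReal.ofReal r ^ q) * M x := by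
    intro x hx
    have m1 : Measurable fun y => ‖f y - f x‖ₑ ^ q := (hf.sub_const _).enorm.pow_const _
    have m2 : Measurable fun y => ‖g y - g x‖ₑ ^ q := (hg.sub_const _).enorm.pow_const _
    have m3 : Measurable fun y => ENNReal.ofReal (η x) * ‖f y - f x‖ₑ ^ q := m1.const_mul _
    have m4 : Measurable fun y => ENNReal.ofReal (1 - η x) * ‖g y - g x‖ₑ ^ q := m2.const_mul _
    have m5 : Measurable fun y => ENNReal.ofReal (η x) * ‖f y - f x‖ₑ ^ q +
      ENNReal.ofReal (1 - η x) * ‖g y - g x‖ₑ ^ q := m3.add m4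
    have m6 : Measurable fun y => (K : ℝ≥0∞) * (ENNReal.ofReal (η x) * ‖f y - f x‖ₑ ^ q +
      ENNReal.ofReal (1 - η x) * ‖g y - g x‖ₑ ^ q) := m5.const_mul _
    calc _ ≤ ⨍⁻ y in ball x r, (K * (ENNReal.ofReal (η x) * ‖f y - f x‖ₑ ^ q +
          ENNReal.ofReal (1 - η x) * ‖g y - g x‖ₑ ^ q) +
          K' * ((L : ℝ≥0∞) ^ q * ENNReal.ofReal r ^ q) * ‖f y - g y‖ₑ ^ q) ∂μ := by
          refine setLAverage_mono measurableSet_ball fun y hy => ?_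
          -- The first two terms use the weight at the centre `x`, so after convexity the energies
          -- of `f` and `g` are localized exactly to `A` and `V`, without thickening. The last term
          -- is at most `L r |f y - g y|`, and its `r ^ q` cancels the normalization of the energy.
          have e : (η y * f y + (1 - η y) * g y) - (η x * f x + (1 - η x) * g x)
            = (η x * (f y - f x) + (1 - η x) * (g y - g x)) + (η y - η x) * (f y - g y) := by ring
          rw [e]
          refine (ENNReal.rpow_le_rpow (enorm_add_le _ _) hq0).trans ((hK' _ _).trans ?_)
          rw [mul_assoc]
          gcongr
          · exact enorm_convex_rpow_le hq.le (h0 x) (h1 x) _ _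
          · rw [enorm_mul, ENNReal.mul_rpow_of_nonneg _ _ hq0,
              ← ENNReal.mul_rpow_of_nonneg (L : ℝ≥0∞) _ hq0]
            gcongr
            rw [← edist_eq_enorm_sub]
            refine (hη y x).trans ?_
            gcongr
            rw [edist_dist]
            exact ENNReal.ofReal_le_ofReal (mem_ball.1 hy).le
      _ = K * (ENNReal.ofReal (η x) * Df x + ENNReal.ofReal (1 - η x) * Dg x) +
          K' * ((L : ℝ≥0∞) ^ q * ENNReal.ofReal r ^ q) * M x := by
          rw [setLAverage_add m6, setLAverage_const_mul _ m5, setLAverage_add m3,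
            setLAverage_const_mul _ m1, setLAverage_const_mul _ m2, setLAverage_const_mul _ hfgm]
      _ ≤ _ := by
          gcongr
          · by_cases hxA : x ∈ A
            · rw [Set.indicator_of_mem hxA]
              exact mul_le_of_le_one_left zero_le (ENNReal.ofReal_le_one.2 (h1 x))
            · simp [hηA x hxA]
          · by_cases hxV : x ∈ V
            · rw [Set.indicator_of_mem hxV]
              exact mul_le_of_le_one_left zero_le
                (ENNReal.ofReal_le_one.2 (by linarith [h0 x]))
            · simp [hηA' x (hx.resolve_right hxV)]
  have hint : ∫⁻ x in A' ∪ V, ⨍⁻ y in ball x r,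
      ‖(η y * f y + (1 - η y) * g y) - (η x * f x + (1 - η x) * g x)‖ₑ ^ q ∂μ ∂μ ≤
      K * (∫⁻ x in A, Df x ∂μ + ∫⁻ x in V, Dg x ∂μ) +
        K' * ((L : ℝ≥0∞) ^ q * ENNReal.ofReal r ^ q) * (C * ∫⁻ x, ‖f x - g x‖ₑ ^ q ∂μ) := by
    have m7 : Measurable fun x => A.indicator Df x + V.indicator Dg x :=
      (hDfm.indicator hA).add (hDgm.indicator hV)
    calc _ ≤ ∫⁻ x in A' ∪ V, (K * (A.indicator Df x + V.indicator Dg x) +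
          K' * ((L : ℝ≥0∞) ^ q * ENNReal.ofReal r ^ q) * M x) ∂μ :=
          setLIntegral_mono' (hA'.union hV) hpt
      _ = K * ∫⁻ x in A' ∪ V, (A.indicator Df x + V.indicator Dg x) ∂μ +
          K' * ((L : ℝ≥0∞) ^ q * ENNReal.ofReal r ^ q) * ∫⁻ x in A' ∪ V, M x ∂μ := by
          rw [lintegral_add_left (m7.const_mul _), lintegral_const_mul _ m7,
            lintegral_const_mul _ hMm]
      _ ≤ K * ∫⁻ x, (A.indicator Df x + V.indicator Dg x) ∂μ +
          K' * ((L : ℝ≥0∞) ^ q * ENNReal.ofReal r ^ q) * (C * ∫⁻ x, ‖f x - g x‖ₑ ^ q ∂μ) := by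
          gcongr
          exact Measure.restrict_le_self
      _ = _ := by
          rw [lintegral_add_left (hDfm.indicator hA), lintegral_indicator hA,
            lintegral_indicator hV]
  unfold energy
  rw [ENNReal.inv_mul_le_iff hrq hrq']
  refine hint.trans (le_of_eq ?_)
  have hcancel := ENNReal.mul_inv_cancel hrq hrq'
  have halg : ∀ R R' a b m : ℝ≥0∞, R * R' = 1 → K * (a + b) + K' * ((L : ℝ≥0∞) ^ q * R) * (C * m)
      = R * (K * (R' * a + R' * b) + ((K' * C : ℝ≥0) : ℝ≥0∞) * (L : ℝ≥0∞) ^ q * m) := by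
    intro R R' a b m hR
    calc _ = 1 * (K * (a + b)) + K' * ((L : ℝ≥0∞) ^ q * R) * (C * m) := by rw [one_mul]
      _ = _ := by rw [← hR, ENNReal.coe_mul]; ring
  exact halg _ _ _ _ _ hcancel

end Gluing

/-! ### Upper and lower limits of sums -/

section Limits

theorem limsup_add_le_ennreal {ι : Type*} (l : Filter ι) (u v : ι → ℝ≥0∞) :
    limsup (fun i => u i + v i) l ≤ limsup u l + limsup v l := by
  refine ENNReal.le_of_forall_pos_le_add fun ε hε hlt => ?_
  have hε2 : ((ε / 2 : ℝ≥0) : ℝ≥0∞) ≠ 0 := by simpa using hε.ne'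
  have h1 := ENNReal.lt_add_right (ENNReal.add_lt_top.1 hlt).1.ne hε2
  have h2 := ENNReal.lt_add_right (ENNReal.add_lt_top.1 hlt).2.ne hε2
  refine limsup_le_of_le (by isBoundedDefault) ?_
  filter_upwards [eventually_lt_of_limsup_lt h1, eventually_lt_of_limsup_lt h2] with i hi1 hi2
  calc u i + v i ≤ _ := add_le_add hi1.le hi2.le
    _ = limsup u l + limsup v l + ((ε / 2 + ε / 2 : ℝ≥0) : ℝ≥0∞) := by
        rw [ENNReal.coe_add]; ring
    _ = _ := by rw [add_halves]

theorem le_liminf_add_ennreal (u v : ℕ → ℝ≥0∞) :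
    liminf u atTop + liminf v atTop ≤ liminf (fun i => u i + v i) atTop := by
  simp only [liminf_eq_iSup_iInf_of_nat]
  rw [ENNReal.iSup_add_iSup_of_monotone]
  · exact iSup_mono fun n => le_iInf₂ fun i hi => add_le_add (iInf₂_le i hi) (iInf₂_le i hi)
  · exact fun m n hmn => le_iInf₂ fun i hi => iInf₂_le i (hmn.trans hi)
  · exact fun m n hmn => le_iInf₂ fun i hi => iInf₂_le i (hmn.trans hi)

end Limits

/-! ### Uniform convexity of powers -/

section UniformConvexity

/-- Quantitative strict convexity of `t ↦ t ^ q` on the nonnegative reals. -/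
theorem exists_abs_sub_rpow_le {q : ℝ} (hq : 1 < q) {ε : ℝ} (hε : 0 < ε) :
    ∃ C : ℝ, 0 ≤ C ∧ ∀ a b : ℝ, 0 ≤ a → 0 ≤ b →
      |a - b| ^ q + C * ((a + b) / 2) ^ q ≤ (ε + C / 2) * (a ^ q + b ^ q) := by
  have hq0 : 0 < q := by linarith
  -- By homogeneity only the ratio `t = b / a ∈ [0,1]` matters. The convexity defect `F` vanishes
  -- there only at `t = 1`, so it has a positive minimum on the compact set `S` where `(1 - t) ^ q ≥
  -- ε`; its inverse serves as `C`, because `(1 - t) ^ q ≤ 1`.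
  set F : ℝ → ℝ := fun t => (1 + t ^ q) / 2 - ((1 + t) / 2) ^ q with hF
  have hFc : Continuous F := by
    have h1 : Continuous fun t : ℝ => t ^ q := Real.continuous_rpow_const hq0.le
    have h2 : Continuous fun t : ℝ => ((1 + t) / 2) ^ q := h1.comp (by fun_prop)
    simp only [hF]
    fun_prop
  have hFpos : ∀ t, 0 ≤ t → t < 1 → 0 < F t := by
    intro t ht0 ht1
    have := (strictConvexOn_rpow hq).2 (Set.mem_Ici.2 zero_le_one) (Set.mem_Ici.2 ht0) ht1.ne'
      (by norm_num : (0 : ℝ) < 1 / 2) (by norm_num : (0 : ℝ) < 1 / 2) (by norm_num)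
    simp only [smul_eq_mul, Real.one_rpow] at this
    rw [show (1 / 2 * 1 + 1 / 2 * t : ℝ) = (1 + t) / 2 by ring] at this
    simp only [hF]
    linarith
  have hF0 : ∀ t, 0 ≤ t → t ≤ 1 → 0 ≤ F t := by
    intro t ht0 ht1
    rcases ht1.lt_or_eq with h | rfl
    · exact (hFpos t ht0 h).le
    · simp [hF]
  set S : Set ℝ := {t | t ∈ Set.Icc (0 : ℝ) 1 ∧ ε ≤ (1 - t) ^ q}
  have hSc : IsCompact S := by
    refine isCompact_Icc.of_isClosed_subset ?_ (fun t ht => ht.1)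
    have hc : Continuous fun t : ℝ => (1 - t) ^ q :=
      (Real.continuous_rpow_const hq0.le).comp (by fun_prop : Continuous fun t : ℝ => 1 - t)
    exact isClosed_Icc.inter (isClosed_le continuous_const hc)
  obtain ⟨C, hC0, hC⟩ : ∃ C : ℝ, 0 ≤ C ∧ ∀ t ∈ Set.Icc (0 : ℝ) 1,
      (1 - t) ^ q ≤ ε * (1 + t ^ q) + C * F t := by
    have hle : ∀ t ∈ Set.Icc (0 : ℝ) 1, ∀ C : ℝ, 0 ≤ C → (1 - t) ^ q < ε →
        (1 - t) ^ q ≤ ε * (1 + t ^ q) + C * F t := by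
      intro t ht C hC h
      have h1 := mul_nonneg hC (hF0 t ht.1 ht.2)
      have h2 := mul_nonneg hε.le (Real.rpow_nonneg ht.1 q)
      nlinarith
    rcases S.eq_empty_or_nonempty with hS | hS
    · refine ⟨0, le_rfl, fun t ht => hle t ht 0 le_rfl ?_⟩
      by_contra h
      have : t ∈ S := ⟨ht, not_lt.1 h⟩
      rw [hS] at this
      exact this
    · obtain ⟨t₀, ht₀, hmin⟩ := hSc.exists_isMinOn hS hFc.continuousOn
      have hm : 0 < F t₀ := by
        refine hFpos t₀ ht₀.1.1 (lt_of_le_of_ne ht₀.1.2 ?_)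
        rintro rfl
        have := ht₀.2
        rw [sub_self, Real.zero_rpow hq0.ne'] at this
        linarith
      refine ⟨1 / F t₀, by positivity, fun t ht => ?_⟩
      by_cases h : (1 - t) ^ q < ε
      · exact hle t ht _ (by positivity) h
      · have h1 : F t₀ ≤ F t := hmin (show t ∈ S from ⟨ht, not_lt.1 h⟩)
        have h2 : 1 ≤ 1 / F t₀ * F t := by
          rw [one_div, inv_mul_eq_div, one_le_div hm]; exact h1
        have h3 : (1 - t) ^ q ≤ 1 := Real.rpow_le_one (by linarith [ht.2]) (by linarith [ht.1]) hq0.le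
        have h4 := mul_nonneg hε.le (Real.rpow_nonneg ht.1 q)
        nlinarith
  refine ⟨C, hC0, ?_⟩
  have main : ∀ a b : ℝ, 0 ≤ b → b ≤ a →
      |a - b| ^ q + C * ((a + b) / 2) ^ q ≤ (ε + C / 2) * (a ^ q + b ^ q) := by
    intro a b hb hba
    rcases (hb.trans hba).eq_or_lt with rfl | ha
    · have : b = 0 := le_antisymm hba hb
      subst this
      simp [Real.zero_rpow hq0.ne']
    · have ht : b / a ∈ Set.Icc (0 : ℝ) 1 := ⟨by positivity, (div_le_one ha).2 hba⟩
      have h := hC _ ht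
      have e1 : |a - b| ^ q = a ^ q * (1 - b / a) ^ q := by
        rw [← Real.mul_rpow ha.le (by linarith [ht.2]), abs_of_nonneg (by linarith)]
        congr 1; field_simp
      have e2 : ((a + b) / 2) ^ q = a ^ q * ((1 + b / a) / 2) ^ q := by
        rw [← Real.mul_rpow ha.le (by linarith [ht.1])]
        congr 1; field_simp
      have e3 : b ^ q = a ^ q * (b / a) ^ q := by
        rw [← Real.mul_rpow ha.le ht.1]
        congr 1; field_simp
      rw [e1, e2, e3]
      have hpos : 0 ≤ a ^ q := by positivity
      simp only [hF] at h
      have := mul_le_mul_of_nonneg_left h hpos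
      linarith
  intro a b ha hb
  rcases le_total b a with h | h
  · exact main a b hb h
  · rw [abs_sub_comm, add_comm a b, add_comm (a ^ q)]
    exact main b a ha h

end UniformConvexity

/-! ### Lipschitz functions with upper bounds for their slopes -/

section Approximation

variable {X : Type*} [MetricSpace X] [MeasurableSpace X] [BorelSpace X] {μ : Measure X} {p : ℝ≥0∞}

omit [MetricSpace X] [BorelSpace X] in
theorem eLpNorm_rpow_toReal (hp0 : p ≠ 0) (hp : p ≠ ∞) (f : X → ℝ) (ν : Measure X) :
    eLpNorm f p ν ^ p.toReal = ∫⁻ x, ‖f x‖ₑ ^ p.toReal ∂ν := by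
  rw [eLpNorm_eq_lintegral_rpow_enorm_toReal hp0 hp, ← ENNReal.rpow_mul, one_div,
    inv_mul_cancel₀ (ENNReal.toReal_pos hp0 hp).ne', ENNReal.rpow_one]

omit [MetricSpace X] [BorelSpace X] in
theorem Lp_edist_rpow_toReal (hp0 : p ≠ 0) (hp : p ≠ ∞) (f g : Lp ℝ p μ) :
    edist f g ^ p.toReal = ∫⁻ x, ‖f x - g x‖ₑ ^ p.toReal ∂μ := by
  rw [Lp.edist_def, eLpNorm_rpow_toReal hp0 hp]
  rfl

/-- A Lipschitz function with bounded support together with a finite measurable upper bound of its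
pointwise Lipschitz constant. -/
structure IsLipPair (h : X → ℝ) (g : X → ℝ≥0) : Prop where
  lipschitz : ∃ K : ℝ≥0, LipschitzWith K h
  bounded : Bornology.IsBounded (Function.support h)
  measurable : Measurable g
  lipConst_le : ∀ x, lipConst h x ≤ g x

omit [MeasurableSpace X] [BorelSpace X] in
theorem lipConst_le_of_lipschitzWith {K : ℝ≥0} {h : X → ℝ} (hh : LipschitzWith K h) (x : X) :
    lipConst h x ≤ K := by
  refine limsup_le_of_le (by isBoundedDefault) ?_
  filter_upwards [self_mem_nhdsWithin] with r hr
  refine iSup₂_le fun z hz => ?_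
  have hr' : ENNReal.ofReal r ≠ 0 := by simpa using hr
  rw [ENNReal.div_le_iff hr' ENNReal.ofReal_ne_top, ← edist_eq_enorm_sub]
  refine (hh z x).trans ?_
  gcongr
  rw [edist_dist]
  exact ENNReal.ofReal_le_ofReal hz

omit [MeasurableSpace X] [BorelSpace X] in
-- Convexity of the slope: it makes admissible pairs stable under midpoints, so that uniform
-- convexity can be applied to minimizing sequences.
theorem lipConst_midpoint_le (h k : X → ℝ) (x : X) :
    lipConst (fun y => (h y + k y) / 2) x ≤ (lipConst h x + lipConst k x) / 2 := by
  set Ψ : (X → ℝ) → ℝ → ℝ≥0∞ := fun h r => ⨆ z ∈ closedBall x r, ‖h z - h x‖ₑ / ENNReal.ofReal r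
  have hΨ : ∀ r, Ψ (fun y => (h y + k y) / 2) r ≤ 2⁻¹ * Ψ h r + 2⁻¹ * Ψ k r := by
    intro r
    refine iSup₂_le fun z hz => ?_
    have h1 : ‖h z - h x‖ₑ / ENNReal.ofReal r ≤ Ψ h r :=
      le_iSup₂ (f := fun z (_ : z ∈ closedBall x r) => ‖h z - h x‖ₑ / ENNReal.ofReal r) z hz
    have h2 : ‖k z - k x‖ₑ / ENNReal.ofReal r ≤ Ψ k r :=
      le_iSup₂ (f := fun z (_ : z ∈ closedBall x r) => ‖k z - k x‖ₑ / ENNReal.ofReal r) z hz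
    calc ‖(h z + k z) / 2 - (h x + k x) / 2‖ₑ / ENNReal.ofReal r
        ≤ (2⁻¹ * ‖h z - h x‖ₑ + 2⁻¹ * ‖k z - k x‖ₑ) / ENNReal.ofReal r := by
          gcongr
          rw [show (h z + k z) / 2 - (h x + k x) / 2
            = 2⁻¹ * (h z - h x) + 2⁻¹ * (k z - k x) by ring]
          refine (enorm_add_le _ _).trans (le_of_eq ?_)
          rw [enorm_mul, enorm_mul, enorm_inv two_ne_zero, Real.enorm_of_nonneg zero_le_two,
            ENNReal.ofReal_ofNat]
      _ = 2⁻¹ * (‖h z - h x‖ₑ / ENNReal.ofReal r) + 2⁻¹ * (‖k z - k x‖ₑ / ENNReal.ofReal r) := by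
          simp only [div_eq_mul_inv]; ring
      _ ≤ _ := by gcongr
  have h2 : (2⁻¹ : ℝ≥0∞) ≠ ∞ := by simp
  calc lipConst (fun y => (h y + k y) / 2) x
      ≤ limsup (fun r => 2⁻¹ * Ψ h r + 2⁻¹ * Ψ k r) (𝓝[>] (0 : ℝ)) :=
        limsup_le_limsup (Eventually.of_forall hΨ)
    _ ≤ limsup (fun r => 2⁻¹ * Ψ h r) (𝓝[>] (0 : ℝ)) + limsup (fun r => 2⁻¹ * Ψ k r) (𝓝[>] (0 : ℝ)) :=
        limsup_add_le_ennreal _ _ _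
    _ = 2⁻¹ * lipConst h x + 2⁻¹ * lipConst k x := by
        rw [ENNReal.limsup_const_mul_of_ne_top h2, ENNReal.limsup_const_mul_of_ne_top h2]
        rfl
    _ = _ := by rw [div_eq_mul_inv]; ring

omit [MeasurableSpace X] [BorelSpace X] in
theorem _root_.LipschitzWith.midpoint {K K' : ℝ≥0} {h k : X → ℝ} (hh : LipschitzWith K h)
    (hk : LipschitzWith K' k) : LipschitzWith (K + K') fun y => (h y + k y) / 2 := by
  refine LipschitzWith.of_dist_le_mul fun x y => ?_
  have h1 := hh.dist_le_mul x y
  have h2 := hk.dist_le_mul x y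
  rw [Real.dist_eq] at *
  push_cast
  have h3 : |(h x + k x) / 2 - (h y + k y) / 2| ≤ (|h x - h y| + |k x - k y|) / 2 := by
    rw [show (h x + k x) / 2 - (h y + k y) / 2 = ((h x - h y) + (k x - k y)) / 2 by ring, abs_div,
      abs_two]
    gcongr
    exact abs_add_le _ _
  have h4 := abs_nonneg (h x - h y)
  have h5 := abs_nonneg (k x - k y)
  linarith

omit [BorelSpace X] in
theorem IsLipPair.midpoint {h k : X → ℝ} {g l : X → ℝ≥0} (H : IsLipPair h g)
    (H' : IsLipPair k l) : IsLipPair (fun x => (h x + k x) / 2) fun x => (g x + l x) / 2 where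
  lipschitz := ⟨_, H.lipschitz.choose_spec.midpoint H'.lipschitz.choose_spec⟩
  bounded := by
    refine (H.bounded.union H'.bounded).subset fun x hx => ?_
    by_contra hne
    simp only [Set.mem_union, Function.mem_support, not_or, not_not] at hne
    exact hx (by simp [hne.1, hne.2])
  measurable := (H.measurable.add H'.measurable).div_const 2
  lipConst_le x := by
    refine (lipConst_midpoint_le h k x).trans ?_
    rw [ENNReal.coe_div two_ne_zero]
    push_cast
    gcongr
    · exact H.lipConst_le x
    · exact H'.lipConst_le x

end Approximation

/-! ### Lipschitz approximation in the Korevaar-Schoen space -/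

section

theorem exists_enorm_sub_rpow_le {q : ℝ} (hq : 1 < q) {ε : ℝ≥0} (hε : 0 < ε) :
    ∃ C : ℝ≥0, ∀ a b : ℝ≥0, ‖(a : ℝ) - b‖ₑ ^ q + C * (((a + b) / 2 : ℝ≥0) : ℝ≥0∞) ^ q ≤
      (ε + C / 2 : ℝ≥0) * ((a : ℝ≥0∞) ^ q + (b : ℝ≥0∞) ^ q) := by
  have hq0 : 0 ≤ q := by linarith
  obtain ⟨C, hC0, hC⟩ := exists_abs_sub_rpow_le hq (ε := ε) (by exact_mod_cast hε)
  lift C to ℝ≥0 using hC0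
  refine ⟨C, fun a b => ?_⟩
  rw [enorm_eq_nnnorm]
  simp only [← ENNReal.coe_rpow_of_nonneg _ hq0, ← ENNReal.coe_mul, ← ENNReal.coe_add]
  rw [ENNReal.coe_le_coe, ← NNReal.coe_le_coe]
  have := hC a b a.2 b.2
  simpa using this

variable {X : Type*} [MetricSpace X] [MeasurableSpace X] [BorelSpace X]
  [SecondCountableTopology X] {μ : Measure X} [SFinite μ] {p : ℝ≥0∞}

/-- The energies of a Lipschitz function are asymptotically bounded by the integral of its
pointwise Lipschitz constant. -/
theorem IsLipPair.limsup_energy_le (hD : IsDoubling μ) (hq : 1 < p.toReal) {h : X → ℝ}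
    {g : X → ℝ≥0} (H : IsLipPair h g) {r : ℕ → ℝ} (hr : ∀ n, 0 < r n)
    (hr0 : Tendsto r atTop (𝓝 0)) (A : Set X) :
    limsup (fun n => energy μ p (r n) h A) atTop ≤ ∫⁻ x in A, (g x : ℝ≥0∞) ^ p.toReal ∂μ := by
  set q := p.toReal
  have hq0 : 0 < q := by linarith
  obtain ⟨K, hK⟩ := H.lipschitz
  have hm : Measurable h := hK.continuous.measurable
  set Ψ : X → ℝ → ℝ≥0∞ := fun x s => ⨆ z ∈ closedBall x s, ‖h z - h x‖ₑ / ENNReal.ofReal s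
  set D : ℝ → X → ℝ≥0∞ := fun s x => (ENNReal.ofReal s ^ q)⁻¹ * ⨍⁻ y in ball x s, ‖h y - h x‖ₑ ^ q ∂μ
  have hDm : ∀ s, Measurable (D s) := fun s =>
    (measurable_setLAverage_ball (measurable_enorm_sub_rpow hm q) s).const_mul _
  have hE : ∀ s, energy μ p s h A = ∫⁻ x in A, D s x ∂μ := fun s => by
    rw [lintegral_const_mul _ (measurable_setLAverage_ball (measurable_enorm_sub_rpow hm q) s)]
    rfl
  have hDΨ : ∀ s, 0 < s → ∀ x, D s x ≤ Ψ x s ^ q := by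
    intro s hs x
    have hs' : ENNReal.ofReal s ≠ 0 := by simpa using hs
    have : ⨍⁻ y in ball x s, ‖h y - h x‖ₑ ^ q ∂μ ≤ (ENNReal.ofReal s * Ψ x s) ^ q := by
      rw [← setLAverage_const (μ := μ) (hD.ball_pos x hs).ne' (hD.ball_lt_top x s).ne
        ((ENNReal.ofReal s * Ψ x s) ^ q)]
      refine setLAverage_mono measurableSet_ball fun y hy => ?_
      gcongr
      rw [mul_comm, ← ENNReal.div_le_iff hs' ENNReal.ofReal_ne_top]
      exact le_iSup₂ (f := fun z (_ : z ∈ closedBall x s) => ‖h z - h x‖ₑ / ENNReal.ofReal s) y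
        (ball_subset_closedBall hy)
    calc D s x ≤ (ENNReal.ofReal s ^ q)⁻¹ * (ENNReal.ofReal s * Ψ x s) ^ q :=
          mul_le_mul' le_rfl this
      _ = _ := by
          rw [ENNReal.mul_rpow_of_nonneg _ _ hq0.le, ← mul_assoc, ENNReal.inv_mul_cancel, one_mul]
          · rw [Ne, ENNReal.rpow_eq_zero_iff]
            simp [hs, hq0.not_gt]
          · finiteness
  have hΨK : ∀ s, 0 < s → ∀ x, Ψ x s ≤ K := by
    intro s hs x
    refine iSup₂_le fun z hz => ?_
    rw [ENNReal.div_le_iff (by simpa using hs) ENNReal.ofReal_ne_top, ← edist_eq_enorm_sub]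
    refine (hK z x).trans ?_
    gcongr
    rw [edist_dist]
    exact ENNReal.ofReal_le_ofReal hz
  have hpt : ∀ x, limsup (fun n => D (r n) x) atTop ≤ (g x : ℝ≥0∞) ^ q := by
    intro x
    have htend : Tendsto r atTop (𝓝[>] 0) :=
      tendsto_nhdsWithin_iff.2 ⟨hr0, Eventually.of_forall hr⟩
    have h1 : limsup (fun n => Ψ x (r n)) atTop ≤ g x :=
      (limsup_le_limsup_of_le htend).trans (H.lipConst_le x)
    calc limsup (fun n => D (r n) x) atTop ≤ limsup (fun n => Ψ x (r n) ^ q) atTop :=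
          limsup_le_limsup (Eventually.of_forall fun n => hDΨ _ (hr n) x)
      _ = limsup (fun n => Ψ x (r n)) atTop ^ q :=
          ((ENNReal.orderIsoRpow q hq0).limsup_apply (u := fun n => Ψ x (r n)) (f := atTop)).symm
      _ ≤ _ := by gcongr
  have hfin : ∫⁻ x in A, (thickening 1 (Function.support h)).indicator
      (fun _ => (K : ℝ≥0∞) ^ q) x ∂μ ≠ ∞ := by
    refine ne_top_of_le_ne_top ?_ (setLIntegral_le_lintegral _ _)
    rw [lintegral_indicator isOpen_thickening.measurableSet, setLIntegral_const]
    refine ENNReal.mul_ne_top (by finiteness) ?_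
    rcases isEmpty_or_nonempty X with hX | ⟨⟨x₀⟩⟩
    · simp [Measure.eq_zero_of_isEmpty μ]
    · obtain ⟨R, hR⟩ := (H.bounded.thickening (δ := 1)).subset_ball x₀
      exact ((measure_mono hR).trans_lt (hD.ball_lt_top x₀ R)).ne
  -- Capping the scale at one leaves the upper limit unchanged. All integrands are then dominated by
  -- `K ^ q` on the unit neighbourhood of the support, a set of finite measure, as the reverse Fatou
  -- lemma requires.
  have hlim : limsup (fun n => energy μ p (r n) h A) atTop
      = limsup (fun n => ∫⁻ x in A, D (min (r n) 1) x ∂μ) atTop := by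
    refine limsup_congr ?_
    filter_upwards [hr0.eventually (gt_mem_nhds one_pos)] with n hn
    rw [hE, min_eq_left hn.le]
  rw [hlim]
  refine (limsup_lintegral_le _ (fun n => hDm _) (fun n => Eventually.of_forall fun x => ?_) hfin).trans
    (lintegral_mono fun x => ?_)
  · have hpos : 0 < min (r n) 1 := lt_min (hr n) one_pos
    by_cases hx : x ∈ thickening 1 (Function.support h)
    · rw [Set.indicator_of_mem hx]
      exact (hDΨ _ hpos x).trans (by gcongr; exact hΨK _ hpos x)
    · rw [Set.indicator_of_notMem hx]
      have hz : ∀ y ∈ ball x (min (r n) 1), h y = 0 := by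
        intro y hy
        by_contra hne
        refine hx (mem_thickening_iff.2 ⟨y, hne, ?_⟩)
        rw [dist_comm]
        exact (mem_ball.1 hy).trans_le (min_le_right _ _)
      have : ⨍⁻ y in ball x (min (r n) 1), ‖h y - h x‖ₑ ^ q ∂μ ≤
          ⨍⁻ y in ball x (min (r n) 1), (0 : ℝ≥0∞) ∂μ :=
        setLAverage_mono measurableSet_ball fun y hy => by
          rw [hz y hy, hz x (mem_ball_self hpos)]
          simp [hq0]
      simp only [D]
      rw [le_antisymm this (by simp [setLAverage_eq])]
      simp
  · refine le_trans (le_of_eq (limsup_congr ?_)) (hpt x)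
    filter_upwards [hr0.eventually (gt_mem_nhds one_pos)] with n hn
    rw [min_eq_left hn.le]

/-- Functions of the Korevaar-Schoen space are limits of Lipschitz functions with bounded
support and bounded energy. -/
theorem exists_isLipPair_of_mem_KS (hD : IsDoubling μ) [hp1 : Fact (1 ≤ p)] (hp : p ≠ ∞)
    (hq : 1 < p.toReal) (f : Lp ℝ p μ) (hf : f ∈ KS μ p) :
    ∃ M : ℝ≥0∞, M ≠ ∞ ∧ ∀ δ : ℝ≥0∞, δ ≠ 0 → ∃ (h : X → ℝ) (g : X → ℝ≥0), IsLipPair h g ∧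
      ∫⁻ x, ‖h x - f x‖ₑ ^ p.toReal ∂μ ≤ δ ∧ ∫⁻ x, (g x : ℝ≥0∞) ^ p.toReal ∂μ ≤ M := by
  rcases isEmpty_or_nonempty X with hX | ⟨⟨x₀⟩⟩
  · refine ⟨0, by simp, fun δ _ => ⟨fun _ => 0, fun _ => 0, ⟨⟨0, LipschitzWith.const 0⟩, by simp,
      measurable_const, fun x => isEmptyElim x⟩, ?_, ?_⟩⟩ <;> simp [Measure.eq_zero_of_isEmpty μ]
  have hp0 : p ≠ 0 := (zero_lt_one.trans_le hp1.out).ne'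
  obtain ⟨C₁, hC₁⟩ := hD.exists_energy_glue_le (p := p) hq (K := 2) one_lt_two
  obtain ⟨C₂, hC₂⟩ := hD.exists_mollify_rpow_bounds hq.le
  set q := p.toReal with hqdef
  have hq0 : 0 < q := by linarith
  have hfm : Measurable f := (Lp.stronglyMeasurable f).measurable
  have hfp : ∫⁻ x, ‖f x‖ₑ ^ q ∂μ ≠ ∞ := by
    rw [← eLpNorm_rpow_toReal hp0 hp]
    exact ENNReal.rpow_ne_top_of_nonneg hq0.le (Lp.eLpNorm_ne_top f)
  obtain ⟨M₀, hM₀, hM₀'⟩ := exists_between (show _ < ∞ from hf)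
  have hev := eventually_lt_of_limsup_lt hM₀
  set M₁ := 2 * M₀ + C₁ * ∫⁻ x, ‖f x‖ₑ ^ q ∂μ with hM₁
  have hM₁top : M₁ ≠ ∞ := by
    have := hM₀'.ne
    finiteness
  refine ⟨C₂ * M₁, by finiteness, fun δ hδ => ?_⟩
  -- The cutoffs are all `1`-Lipschitz, so the energy bound `M₁` for the truncations does not depend
  -- on `n`.
  set F : ℕ → X → ℝ := fun n x => thickenedIndicator one_pos (ball x₀ n) x * f x with hF
  have hFm : ∀ n, Measurable (F n) := fun n =>
    (measurable_coe_nnreal_real.comp (thickenedIndicator one_pos (ball x₀ n)).continuous.measurable).mul hfm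
  have hle1 : ∀ n x, ((thickenedIndicator one_pos (ball x₀ (n : ℕ)) x : ℝ≥0) : ℝ) ≤ 1 := fun n x => by
    exact_mod_cast thickenedIndicator_le_one one_pos _ x
  have hFle : ∀ n x, ‖F n x - f x‖ₑ ≤ ‖f x‖ₑ := by
    intro n x
    have e : F n x - f x = -((1 - thickenedIndicator one_pos (ball x₀ (n : ℕ)) x) * f x) := by
      simp only [hF]; ring
    rw [e, enorm_neg, enorm_mul, Real.enorm_of_nonneg (sub_nonneg.2 (hle1 n x))]
    refine mul_le_of_le_one_left zero_le (ENNReal.ofReal_le_one.2 ?_)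
    linarith [(thickenedIndicator one_pos (ball x₀ (n : ℕ)) x).2]
  have htend : Tendsto (fun n => ∫⁻ x, ‖F n x - f x‖ₑ ^ q ∂μ) atTop (𝓝 0) := by
    have := tendsto_lintegral_of_dominated_convergence (μ := μ) (F := fun n x => ‖F n x - f x‖ₑ ^ q)
      (f := fun _ => 0) (fun x => ‖f x‖ₑ ^ q) (fun n => ((hFm n).sub hfm).enorm.pow_const q)
      (fun n => Eventually.of_forall fun x => ENNReal.rpow_le_rpow (hFle n x) hq0.le) hfp
      (Eventually.of_forall fun x => by
        refine tendsto_const_nhds.congr' ?_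
        obtain ⟨N, hN⟩ := exists_nat_gt (dist x x₀)
        filter_upwards [eventually_ge_atTop N] with n hn
        have hx : x ∈ ball x₀ (n : ℝ) := mem_ball.2 (hN.trans_le (by exact_mod_cast hn))
        simp only [hF]
        rw [thickenedIndicator_one one_pos _ hx]
        simp [hq0])
    simpa using this
  have hK2 : (2 : ℝ≥0∞) ^ (q - 1) ≠ ∞ := by finiteness
  have hη : ∃ η : ℝ≥0∞, η ≠ 0 ∧ 2 ^ (q - 1) * (η + η) ≤ δ := by
    refine ⟨δ / (2 ^ (q - 1) * 2), ?_, ?_⟩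
    · exact ENNReal.div_ne_zero.2 ⟨hδ, by finiteness⟩
    · rw [← two_mul, ← mul_assoc]
      exact ENNReal.mul_div_le
  obtain ⟨η, hη0, hη⟩ := hη
  obtain ⟨n, hn⟩ := (htend.eventually (gt_mem_nhds (pos_iff_ne_zero.2 hη0))).exists
  have hFE : ∀ s, 0 < s → energy μ p s f Set.univ < M₀ → energy μ p s (F n) Set.univ ≤ M₁ := by
    intro s hs hsM
    -- Gluing `f` to zero: zero has no energy, and the cutoff term is a multiple of `‖f‖_p^p`.
    have := hC₁ 1 (fun x => (thickenedIndicator one_pos (ball x₀ n) x : ℝ))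
      (by
        have h := lipschitzWith_thickenedIndicator one_pos (ball x₀ (n : ℝ))
        simp only [Real.toNNReal_one, inv_one] at h
        exact h)
      (fun x => NNReal.coe_nonneg _) (hle1 n) Set.univ ∅ Set.univ MeasurableSet.univ
      MeasurableSet.empty MeasurableSet.univ (by simp) (by simp) f (fun _ => 0) hfm
      measurable_const s hs
    simp only [Set.empty_union, mul_zero, add_zero, sub_zero, ENNReal.coe_one, ENNReal.one_rpow,
      mul_one] at this
    refine this.trans ?_
    have h0 : energy μ p s (fun _ : X => (0 : ℝ)) Set.univ = 0 := by
      simp [energy, hq0, ← hqdef]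
    rw [h0, add_zero, hM₁]
    push_cast
    gcongr
  have hsmall : Tendsto (fun s : ℝ => C₂ * (ENNReal.ofReal s ^ q * M₁)) (𝓝[>] 0) (𝓝 0) := by
    have h1 : Tendsto (fun s : ℝ => ENNReal.ofReal s ^ q) (𝓝[>] 0) (𝓝 (ENNReal.ofReal 0 ^ q)) :=
      ((ENNReal.continuous_rpow_const.comp ENNReal.continuous_ofReal).tendsto 0).mono_left
        nhdsWithin_le_nhds
    rw [ENNReal.ofReal_zero, ENNReal.zero_rpow_of_pos hq0] at h1
    have h2 := ENNReal.Tendsto.const_mul (a := C₂)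
      (ENNReal.Tendsto.mul_const (b := M₁) h1 (Or.inr hM₁top)) (Or.inr ENNReal.coe_ne_top)
    simpa using h2
  -- The scale is chosen after the truncation `n`: small enough for the energy bound to hold and for
  -- mollification to move `F n` by at most `η`.
  obtain ⟨s, ⟨hs1, hs2⟩, hs⟩ := ((hev.and (hsmall.eventually
    (gt_mem_nhds (pos_iff_ne_zero.2 hη0)))).and self_mem_nhdsWithin).exists
  have hs : 0 < s := hs
  have hFn := hFE s hs hs1
  have hFsupp : ∀ x, x ∉ ball x₀ (1 + n : ℝ) → F n x = 0 := fun x hx => by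
    have : thickenedIndicator one_pos (ball x₀ (n : ℝ)) x = 0 :=
      thickenedIndicator_zero one_pos _ fun h => hx (thickening_ball _ _ _ h)
    simp only [hF]
    rw [this, NNReal.coe_zero, zero_mul]
  have hFint : Integrable (F n) μ := by
    have h1 : Integrable ((ball x₀ (1 + n)).indicator f) μ :=
      (integrable_indicator_iff measurableSet_ball).2 (hD.integrableOn_ball (Lp.memLp f) _ _)
    refine h1.mono (hFm n).aestronglyMeasurable (Eventually.of_forall fun x => ?_)
    by_cases hx : x ∈ ball x₀ (1 + n : ℝ)
    · rw [Set.indicator_of_mem hx, norm_mul, Real.norm_of_nonneg (NNReal.coe_nonneg _)]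
      exact mul_le_of_le_one_left (norm_nonneg _) (hle1 n x)
    · rw [hFsupp x hx, norm_zero]
      exact norm_nonneg _
  obtain ⟨⟨K, hK⟩, hsupp⟩ := hD.mollify_lipschitz hFint hFsupp (half_pos hs)
  have hb := hC₂ (F n) (hFm n) (fun _ _ => hFint.integrableOn) (s / 2) (half_pos hs)
  rw [mul_div_cancel₀ _ two_ne_zero] at hb
  set T := mollify μ (s / 2) (F n)
  set D : X → ℝ≥0∞ := fun x => ⨍⁻ y in ball x s, ‖F n y - F n x‖ₑ ^ q ∂μ with hDdef
  have hDm : Measurable D := measurable_setLAverage_ball (measurable_enorm_sub_rpow (hFm n) q) s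
  have hDE : (ENNReal.ofReal s ^ q)⁻¹ * ∫⁻ x, D x ∂μ ≤ M₁ := by
    simpa [energy] using hFn
  -- Both entries of the minimum bound the slope of `T`: the first has controlled `L^q` norm, the
  -- second makes `g` finite everywhere.
  set g : X → ℝ≥0 := fun x => (min ((C₂ * (ENNReal.ofReal s ^ q)⁻¹ * D x) ^ q⁻¹) K).toNNReal with hg
  have hgcoe : ∀ x, (g x : ℝ≥0∞) = min ((C₂ * (ENNReal.ofReal s ^ q)⁻¹ * D x) ^ q⁻¹) K := fun x =>
    ENNReal.coe_toNNReal (ne_top_of_le_ne_top ENNReal.coe_ne_top (min_le_right _ _))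
  refine ⟨T, g, ⟨⟨K, hK⟩, ?_, ?_, fun x => ?_⟩, ?_, ?_⟩
  · refine (isBounded_ball (x := x₀) (r := 1 + n + 2 * (s / 2))).subset fun x hx => ?_
    by_contra h
    exact hx (hsupp x h)
  · exact (((hDm.const_mul _).pow_const _).min measurable_const).ennreal_toNNReal
  · rw [hgcoe]
    refine le_min ?_ (lipConst_le_of_lipschitzWith hK x)
    rw [ENNReal.le_rpow_inv_iff hq0]
    exact (hb x).2
  · have hT : Measurable T := hK.continuous.measurable
    calc ∫⁻ x, ‖T x - f x‖ₑ ^ q ∂μ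
        ≤ ∫⁻ x, 2 ^ (q - 1) * (‖F n x - T x‖ₑ ^ q + ‖F n x - f x‖ₑ ^ q) ∂μ := by
          refine lintegral_mono fun x => ?_
          rw [show T x - f x = -(F n x - T x) + (F n x - f x) by ring, ← enorm_neg (F n x - T x)]
          exact enorm_add_rpow_le hq.le _ _
      _ = 2 ^ (q - 1) * (∫⁻ x, ‖F n x - T x‖ₑ ^ q ∂μ + ∫⁻ x, ‖F n x - f x‖ₑ ^ q ∂μ) := by
          rw [lintegral_const_mul' _ _ hK2, lintegral_add_left]
          exact ((hFm n).sub hT).enorm.pow_const q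
      _ ≤ 2 ^ (q - 1) * (η + η) := by
          gcongr
          refine (lintegral_mono fun x => (hb x).1).trans ?_
          rw [lintegral_const_mul _ hDm]
          refine le_trans ?_ hs2.le
          gcongr
          rw [ENNReal.inv_mul_le_iff] at hDE
          · exact hDE
          · rw [Ne, ENNReal.rpow_eq_zero_iff]
            simp [hs, hq0.not_gt]
          · finiteness
      _ ≤ δ := hη
  · calc ∫⁻ x, (g x : ℝ≥0∞) ^ q ∂μ ≤ ∫⁻ x, C₂ * (ENNReal.ofReal s ^ q)⁻¹ * D x ∂μ := by
          refine lintegral_mono fun x => ?_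
          rw [hgcoe, ← ENNReal.le_rpow_inv_iff hq0]
          exact min_le_left _ _
      _ ≤ _ := by
          rw [lintegral_const_mul _ hDm, mul_assoc]
          gcongr

end

/-! ### A finite measure dominating the cost of recovery -/

section

variable {X : Type*} [MetricSpace X] [MeasurableSpace X] [BorelSpace X]
  [SecondCountableTopology X] {μ : Measure X} [SFinite μ] {p : ℝ≥0∞}

omit [MetricSpace X] [BorelSpace X] [SecondCountableTopology X] [SFinite μ] in
/-- Almost minimizing sequences for a functional with the midpoint property are `L^q`-Cauchy. -/
theorem exists_forall_lintegral_sub_le {q : ℝ} (hq : 1 < q) (d : ℕ → ℝ≥0∞) (hd : Monotone d)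
    {D : ℝ≥0∞} (hD : D ≠ ∞) (hdD : ∀ n, d n ≤ D) (g : ℕ → X → ℝ≥0) (hgm : ∀ n, Measurable (g n))
    (hg : ∀ n : ℕ, ∫⁻ x, (g n x : ℝ≥0∞) ^ q ∂μ ≤ d n + ((n : ℝ≥0∞) + 1)⁻¹)
    (hmid : ∀ n m, n ≤ m → d n ≤ ∫⁻ x, (((g n x + g m x) / 2 : ℝ≥0) : ℝ≥0∞) ^ q ∂μ)
    {δ : ℝ≥0} (hδ : 0 < δ) :
    ∃ N, ∀ n ≥ N, ∀ m ≥ n, ∫⁻ x, ‖(g n x : ℝ) - g m x‖ₑ ^ q ∂μ ≤ δ := by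
  set L := ⨆ n, d n with hL
  have hLD : L ≤ D := iSup_le hdD
  have hLtop : L ≠ ∞ := ne_top_of_le_ne_top hD hLD
  lift L to ℝ≥0 using hLtop with l
  have hdl : ∀ n, d n ≤ l := fun n => hL ▸ le_iSup d n
  -- Uniform convexity will give `J ≤ 2ε(l + η) + C(l + η - d n)`. The choices of `ε` and `η` make
  -- each of the two terms at most `δ / 2`.
  set ε : ℝ≥0 := δ / (4 * (l + 1)) with hε
  have hε0 : 0 < ε := by positivity
  obtain ⟨C, hC⟩ := exists_enorm_sub_rpow_le hq hε0
  set η : ℝ≥0 := min 1 (δ / (4 * (C + 1))) with hη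
  have hη0 : 0 < η := by positivity
  have htend : Tendsto d atTop (𝓝 (l : ℝ≥0∞)) := hL ▸ tendsto_atTop_iSup hd
  have hev1 : ∀ᶠ n in atTop, (l : ℝ≥0∞) ≤ d n + η := by
    rcases eq_or_ne l 0 with h | h
    · exact Eventually.of_forall fun n => by simp [h]
    · have : (l : ℝ≥0∞) - η < l := ENNReal.sub_lt_self ENNReal.coe_ne_top (by simpa using h)
        (by simpa using hη0.ne')
      filter_upwards [htend.eventually (lt_mem_nhds this)] with n hn
      exact tsub_le_iff_right.1 hn.le
  have hev2 : ∀ᶠ n : ℕ in atTop, ((n : ℝ≥0∞) + 1)⁻¹ ≤ η := by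
    have h1 : Tendsto (fun n : ℕ => ((n : ℝ≥0∞) + 1)⁻¹) atTop (𝓝 0) := by
      have := (tendsto_add_atTop_iff_nat 1).2 ENNReal.tendsto_inv_nat_nhds_zero
      simpa using this
    exact (h1.eventually (gt_mem_nhds (by simpa using hη0 : (0 : ℝ≥0∞) < η))).mono fun n hn => hn.le
  obtain ⟨N, hN⟩ := eventually_atTop.1 (hev1.and hev2)
  refine ⟨N, fun n hn m hm => ?_⟩
  have hgn : ∀ k ≥ N, ∫⁻ x, (g k x : ℝ≥0∞) ^ q ∂μ ≤ l + η := fun k hk =>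
    (hg k).trans (add_le_add (hdl k) (hN k hk).2)
  set J := ∫⁻ x, ‖(g n x : ℝ) - g m x‖ₑ ^ q ∂μ
  have mc : ∀ k, Measurable fun x => (g k x : ℝ≥0∞) ^ q := fun k =>
    (measurable_coe_nnreal_ennreal.comp (hgm k)).pow_const q
  have mmid : Measurable fun x => (((g n x + g m x) / 2 : ℝ≥0) : ℝ≥0∞) ^ q :=
    (measurable_coe_nnreal_ennreal.comp (((hgm n).add (hgm m)).div_const 2)).pow_const q
  have h1 : J + C * d n ≤ (ε + C / 2 : ℝ≥0) * ((l + η) + (l + η)) := by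
    calc J + C * d n
        ≤ J + C * ∫⁻ x, (((g n x + g m x) / 2 : ℝ≥0) : ℝ≥0∞) ^ q ∂μ := by
          gcongr; exact hmid n m hm
      _ = ∫⁻ x, (‖(g n x : ℝ) - g m x‖ₑ ^ q + C * (((g n x + g m x) / 2 : ℝ≥0) : ℝ≥0∞) ^ q) ∂μ := by
          rw [lintegral_add_right _ (mmid.const_mul _), lintegral_const_mul _ mmid]
      _ ≤ ∫⁻ x, (ε + C / 2 : ℝ≥0) * ((g n x : ℝ≥0∞) ^ q + (g m x : ℝ≥0∞) ^ q) ∂μ :=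
          lintegral_mono fun x => hC _ _
      _ = (ε + C / 2 : ℝ≥0) * (∫⁻ x, (g n x : ℝ≥0∞) ^ q ∂μ + ∫⁻ x, (g m x : ℝ≥0∞) ^ q ∂μ) := by
          rw [lintegral_const_mul' _ _ ENNReal.coe_ne_top, lintegral_add_left (mc n)]
      _ ≤ _ := by
          gcongr
          exacts [hgn n hn, hgn m (hn.trans hm)]
  have hdn : d n ≠ ∞ := ne_top_of_le_ne_top ENNReal.coe_ne_top (hdl n)
  have hln := (hN n hn).1
  lift d n to ℝ≥0 using hdn with dn
  have hJ : J ≠ ∞ := ne_top_of_le_ne_top (by finiteness) (le_self_add.trans h1)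
  lift J to ℝ≥0 using hJ with j
  norm_cast at h1 hln ⊢
  rw [← NNReal.coe_le_coe] at h1 hln ⊢
  push_cast at h1 hln
  have hη1 : (η : ℝ) ≤ 1 := by exact_mod_cast min_le_left _ _
  have hCη : (C : ℝ) * η ≤ δ / 4 := by
    have h2 : (η : ℝ) ≤ δ / (4 * (C + 1)) := by exact_mod_cast min_le_right _ _
    calc (C : ℝ) * η ≤ C * (δ / (4 * (C + 1))) := by gcongr
      _ = (C / (C + 1)) * (δ / 4) := by field_simp
      _ ≤ 1 * (δ / 4) := by
          gcongr
          rw [div_le_one (by positivity)]; linarith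
      _ = _ := one_mul _
  have hεl : (ε : ℝ) * (l + 1) = δ / 4 := by
    rw [hε]; push_cast; field_simp
  have hC0 : (0 : ℝ) ≤ C := C.2
  have hε0' : (0 : ℝ) ≤ ε := ε.2
  have h3 : (ε : ℝ) * (l + η) ≤ δ / 4 := by rw [← hεl]; gcongr
  have h4 : (C : ℝ) * l ≤ C * (dn + η) := by gcongr
  nlinarith

/-- For a function of the Korevaar-Schoen space, some integrable function bounds asymptotically
the energies on all sets of a sequence of Lipschitz approximations. -/
theorem exists_density_of_mem_KS (hD : IsDoubling μ) [hp1 : Fact (1 ≤ p)] (hp : p ≠ ∞)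
    (hq : 1 < p.toReal) (f : Lp ℝ p μ) (hf : f ∈ KS μ p) :
    ∃ G : X → ℝ≥0∞, ∫⁻ x, G x ∂μ ≠ ∞ ∧ ∀ δ : ℝ≥0∞, δ ≠ 0 →
      ∃ (h : X → ℝ) (g : X → ℝ≥0), IsLipPair h g ∧ ∫⁻ x, ‖h x - f x‖ₑ ^ p.toReal ∂μ ≤ δ ∧
        ∀ A : Set X, ∫⁻ x in A, (g x : ℝ≥0∞) ^ p.toReal ∂μ ≤ ∫⁻ x in A, G x ∂μ + δ := by
  have hp0 : p ≠ 0 := (zero_lt_one.trans_le hp1.out).ne'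
  obtain ⟨M, hM, hMδ⟩ := exists_isLipPair_of_mem_KS hD hp hq f hf
  set q := p.toReal with hqdef
  have hq0 : 0 < q := by linarith
  have hfm : Measurable f := (Lp.stronglyMeasurable f).measurable
  -- Relaxation: `d n` is the least cost of a slope bound among Lipschitz functions that are `1 / (n
  -- + 1)`-close to `f`. The cost `d n` increases with `n` and stays below `M`.
  set P : ℕ → Set ((X → ℝ) × (X → ℝ≥0)) := fun n =>
    {w | IsLipPair w.1 w.2 ∧ ∫⁻ x, ‖w.1 x - f x‖ₑ ^ q ∂μ ≤ ((n : ℝ≥0∞) + 1)⁻¹} with hP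
  set I : (X → ℝ) × (X → ℝ≥0) → ℝ≥0∞ := fun w => ∫⁻ x, (w.2 x : ℝ≥0∞) ^ q ∂μ with hI
  have hinv : ∀ n : ℕ, ((n : ℝ≥0∞) + 1)⁻¹ ≠ 0 := fun n => by simp
  have hPanti : ∀ n m, n ≤ m → P m ⊆ P n := fun n m hnm w hw =>
    ⟨hw.1, hw.2.trans (by gcongr)⟩
  set d : ℕ → ℝ≥0∞ := fun n => ⨅ w ∈ P n, I w with hd
  have hdmono : Monotone d := fun n m hnm => le_iInf₂ fun w hw => iInf₂_le w (hPanti n m hnm hw)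
  have hdM : ∀ n, d n ≤ M := fun n => by
    obtain ⟨h, g, h1, h2, h3⟩ := hMδ _ (hinv n)
    exact (iInf₂_le (h, g) ⟨h1, h2⟩).trans h3
  have hex : ∀ n, ∃ w ∈ P n, I w ≤ d n + ((n : ℝ≥0∞) + 1)⁻¹ := by
    intro n
    have hlt : d n < d n + ((n : ℝ≥0∞) + 1)⁻¹ :=
      ENNReal.lt_add_right (ne_top_of_le_ne_top hM (hdM n)) (hinv n)
    obtain ⟨w, hw⟩ := iInf_lt_iff.1 hlt
    obtain ⟨hwP, hw⟩ := iInf_lt_iff.1 hw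
    exact ⟨w, hwP, hw.le⟩
  choose w hwP hwI using hex
  have hmid : ∀ n m, n ≤ m →
      d n ≤ ∫⁻ x, ((((w n).2 x + (w m).2 x) / 2 : ℝ≥0) : ℝ≥0∞) ^ q ∂μ := by
    intro n m hnm
    have h1 := hwP n
    have h2 := hPanti n m hnm (hwP m)
    refine iInf₂_le (f := fun w (_ : w ∈ P n) => I w)
      (fun x => ((w n).1 x + (w m).1 x) / 2, fun x => ((w n).2 x + (w m).2 x) / 2)
      ⟨h1.1.midpoint h2.1, ?_⟩
    have hm1 : Measurable fun x => ‖(w n).1 x - f x‖ₑ ^ q :=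
      ((h1.1.lipschitz.choose_spec.continuous.measurable).sub hfm).enorm.pow_const q
    calc ∫⁻ x, ‖((w n).1 x + (w m).1 x) / 2 - f x‖ₑ ^ q ∂μ
        ≤ ∫⁻ x, (2⁻¹ * ‖(w n).1 x - f x‖ₑ ^ q + 2⁻¹ * ‖(w m).1 x - f x‖ₑ ^ q) ∂μ := by
          refine lintegral_mono fun x => ?_
          have := enorm_convex_rpow_le hq.le (t := 2⁻¹) (by norm_num) (by norm_num)
            ((w n).1 x - f x) ((w m).1 x - f x)
          rw [show (1 - 2⁻¹ : ℝ) = 2⁻¹ by norm_num, ENNReal.ofReal_inv_of_pos two_pos,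
            ENNReal.ofReal_ofNat] at this
          refine le_trans (le_of_eq ?_) this
          congr 2
          ring
      _ = 2⁻¹ * ∫⁻ x, ‖(w n).1 x - f x‖ₑ ^ q ∂μ + 2⁻¹ * ∫⁻ x, ‖(w m).1 x - f x‖ₑ ^ q ∂μ := by
          rw [lintegral_add_left (hm1.const_mul _), lintegral_const_mul' _ _ (by simp),
            lintegral_const_mul' _ _ (by simp)]
      _ ≤ 2⁻¹ * ((n : ℝ≥0∞) + 1)⁻¹ + 2⁻¹ * ((n : ℝ≥0∞) + 1)⁻¹ := by
          gcongr
          exacts [h1.2, h2.2]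
      _ = _ := by rw [← add_mul, ENNReal.inv_two_add_inv_two, one_mul]
  have hCauchy := fun (δ : ℝ≥0) (hδ : 0 < δ) => exists_forall_lintegral_sub_le (μ := μ) hq d hdmono
    hM hdM (fun n => (w n).2) (fun n => (hwP n).1.measurable) hwI hmid hδ
  have hgm : ∀ n, Measurable fun x => ((w n).2 x : ℝ) := fun n =>
    measurable_coe_nnreal_real.comp (hwP n).1.measurable
  have hgE : ∀ n, ∀ x, ‖((w n).2 x : ℝ)‖ₑ = ((w n).2 x : ℝ≥0∞) := fun n x => by
    rw [Real.enorm_of_nonneg (NNReal.coe_nonneg _), ENNReal.ofReal_coe_nnreal]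
  have hgL : ∀ n, MemLp (fun x => ((w n).2 x : ℝ)) p μ := fun n => by
    refine ⟨(hgm n).aestronglyMeasurable, ?_⟩
    rw [← ENNReal.rpow_lt_top_iff_of_pos hq0, eLpNorm_rpow_toReal hp0 hp]
    simp only [hgE]
    refine (hwI n).trans_lt ?_
    exact ENNReal.add_lt_top.2 ⟨(hdM n).trans_lt hM.lt_top, by simp⟩
  set u : ℕ → Lp ℝ p μ := fun n => (hgL n).toLp _ with hu
  have hucoe : ∀ n, (u n : X → ℝ) =ᵐ[μ] fun x => ((w n).2 x : ℝ) := fun n => (hgL n).coeFn_toLp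
  have huC : CauchySeq u := by
    refine EMetric.cauchySeq_iff'.2 fun ε hε => ?_
    obtain ⟨δ, hδ0, hδ⟩ := ENNReal.lt_iff_exists_nnreal_btwn.1
      (ENNReal.rpow_pos_of_nonneg hε hq0.le : 0 < ε ^ q)
    obtain ⟨N, hN⟩ := hCauchy δ (by exact_mod_cast hδ0)
    refine ⟨N, fun n hn => ?_⟩
    rw [← ENNReal.rpow_lt_rpow_iff hq0, edist_comm, Lp_edist_rpow_toReal hp0 hp]
    refine lt_of_le_of_lt (le_of_eq (lintegral_congr_ae ?_)) ((hN N le_rfl n hn).trans_lt hδ)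
    filter_upwards [hucoe N, hucoe n] with x hx1 hx2
    rw [hx1, hx2]
  obtain ⟨v, hv⟩ := cauchySeq_tendsto_of_complete huC
  have hvm : Measurable v := (Lp.stronglyMeasurable v).measurable
  have hK2 : (2 : ℝ≥0∞) ^ (q - 1) ≠ ∞ := by finiteness
  -- Strong convergence of the slope bounds to `v` rules out concentration: on every set, `∫ g_n^q`
  -- exceeds the integral of this density by at most a multiple of `‖g_n - v‖_q^q`.
  refine ⟨fun x => 2 ^ (q - 1) * ‖v x‖ₑ ^ q, ?_, fun δ hδ => ?_⟩
  · rw [lintegral_const_mul' _ _ hK2, ← eLpNorm_rpow_toReal hp0 hp]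
    exact ENNReal.mul_ne_top hK2 (ENNReal.rpow_ne_top_of_nonneg hq0.le (Lp.eLpNorm_ne_top v))
  · have hed : Tendsto (fun n => 2 ^ (q - 1) * edist (u n) v ^ q) atTop (𝓝 0) := by
      have h1 := tendsto_iff_edist_tendsto_0.1 hv
      have h2 := (ENNReal.continuous_rpow_const (y := q)).tendsto 0 |>.comp h1
      rw [ENNReal.zero_rpow_of_pos hq0] at h2
      simpa using ENNReal.Tendsto.const_mul h2 (Or.inr hK2)
    have hin : Tendsto (fun n : ℕ => ((n : ℝ≥0∞) + 1)⁻¹) atTop (𝓝 0) := by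
      have := (tendsto_add_atTop_iff_nat 1).2 ENNReal.tendsto_inv_nat_nhds_zero
      simpa using this
    obtain ⟨n, hn1, hn2⟩ := ((hed.eventually (gt_mem_nhds (pos_iff_ne_zero.2 hδ))).and
      (hin.eventually (gt_mem_nhds (pos_iff_ne_zero.2 hδ)))).exists
    refine ⟨(w n).1, (w n).2, (hwP n).1, (hwP n).2.trans hn2.le, fun A => ?_⟩
    have hm2 : Measurable fun x => 2 ^ (q - 1) * ‖v x‖ₑ ^ q := (hvm.enorm.pow_const q).const_mul _
    calc ∫⁻ x in A, ((w n).2 x : ℝ≥0∞) ^ q ∂μ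
        ≤ ∫⁻ x in A, (2 ^ (q - 1) * ‖v x‖ₑ ^ q + 2 ^ (q - 1) * ‖((w n).2 x : ℝ) - v x‖ₑ ^ q) ∂μ := by
          refine lintegral_mono fun x => ?_
          rw [← hgE, ← mul_add]
          refine le_trans (le_of_eq ?_) (enorm_add_rpow_le hq.le _ _)
          congr 2
          ring
      _ = ∫⁻ x in A, 2 ^ (q - 1) * ‖v x‖ₑ ^ q ∂μ +
          ∫⁻ x in A, 2 ^ (q - 1) * ‖((w n).2 x : ℝ) - v x‖ₑ ^ q ∂μ := lintegral_add_left hm2 _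
      _ ≤ ∫⁻ x in A, 2 ^ (q - 1) * ‖v x‖ₑ ^ q ∂μ + δ := by
          gcongr
          refine (setLIntegral_le_lintegral _ _).trans ?_
          refine le_trans (le_of_eq ?_) hn1.le
          rw [lintegral_const_mul' _ _ hK2, Lp_edist_rpow_toReal hp0 hp]
          congr 1
          refine lintegral_congr_ae ?_
          filter_upwards [hucoe n] with x hx
          rw [hx]

/-- For a function of the Korevaar-Schoen space, the upper `Γ`-limits of the localized energies
are bounded by a finite measure. -/
theorem exists_limsup_energy_le_of_mem_KS (hD : IsDoubling μ) [hp1 : Fact (1 ≤ p)] (hp : p ≠ ∞)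
    (hq : 1 < p.toReal) (f : Lp ℝ p μ) (hf : f ∈ KS μ p) :
    ∃ G : X → ℝ≥0∞, ∫⁻ x, G x ∂μ ≠ ∞ ∧ ∀ r : ℕ → ℝ, (∀ n, 0 < r n) → Tendsto r atTop (𝓝 0) →
      ∀ A : Set X, ∃ u : ℕ → Lp ℝ p μ, Tendsto u atTop (𝓝 f) ∧
        limsup (fun n => energy μ p (r n) (u n) A) atTop ≤ ∫⁻ x in A, G x ∂μ := by
  have hp0 : p ≠ 0 := (zero_lt_one.trans_le hp1.out).ne'
  have hq0 : 0 < p.toReal := by linarith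
  obtain ⟨G, hG, hGδ⟩ := exists_density_of_mem_KS hD hp hq f hf
  refine ⟨G, hG, fun r hr hr0 A => ?_⟩
  refine exists_recovery_sequence (fun n (u : Lp ℝ p μ) => energy μ p (r n) u A) f _ fun ε hε => ?_
  set ε' : ℝ≥0∞ := ENNReal.ofReal (ε / 2)
  have hε' : ε' ≠ 0 := by simpa [ε'] using hε
  set δ := min (ε' / 2) (ε' ^ p.toReal)
  have hδ : δ ≠ 0 := by
    refine (lt_min (ENNReal.half_pos hε') ?_).ne'
    exact ENNReal.rpow_pos_of_nonneg (pos_iff_ne_zero.2 hε') hq0.le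
  obtain ⟨h, g, hhg, h1, h2⟩ := hGδ δ hδ
  have hm : Measurable h := hhg.lipschitz.choose_spec.continuous.measurable
  have hδtop : δ < ∞ := (min_le_left _ _).trans_lt (ENNReal.div_lt_top (by finiteness) (by simp))
  have hsub : MemLp (fun x => h x - f x) p μ := by
    refine ⟨(hm.sub (Lp.stronglyMeasurable f).measurable).aestronglyMeasurable, ?_⟩
    rw [← ENNReal.rpow_lt_top_iff_of_pos hq0, eLpNorm_rpow_toReal hp0 hp]
    exact h1.trans_lt hδtop
  have hL : MemLp h p μ := by
    have := hsub.add (Lp.memLp f)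
    refine this.ae_eq (Eventually.of_forall fun x => ?_)
    simp
  have hlim := hhg.limsup_energy_le hD hq hr hr0 A
  have hlt : limsup (fun n => energy μ p (r n) h A) atTop < ∫⁻ x in A, G x ∂μ + ENNReal.ofReal ε := by
    refine (hlim.trans (h2 A)).trans_lt ?_
    refine ENNReal.add_lt_add_left (ne_top_of_le_ne_top hG (setLIntegral_le_lintegral _ _)) ?_
    refine (min_le_left _ _).trans_lt ((ENNReal.half_lt_self hε' (by finiteness)).trans ?_)
    exact (ENNReal.ofReal_lt_ofReal_iff hε).2 (half_lt_self hε)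
  filter_upwards [eventually_lt_of_limsup_lt hlt] with n hn
  refine ⟨hL.toLp h, ?_, ?_⟩
  · have h3 : edist (hL.toLp h) f ≤ ε' := by
      rw [← ENNReal.rpow_le_rpow_iff hq0, Lp_edist_rpow_toReal hp0 hp]
      refine le_trans (le_of_eq (lintegral_congr_ae ?_)) (h1.trans (min_le_right _ _))
      filter_upwards [hL.coeFn_toLp] with x hx
      rw [hx]
    rw [edist_dist, ENNReal.ofReal_le_ofReal_iff (by positivity)] at h3
    linarith
  · rw [energy_congr_ae hL.coeFn_toLp]
    exact hn.le

end

/-! ### Glued recovery sequences and the limit measure -/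

section

variable {X : Type*} [MetricSpace X] [MeasurableSpace X] [BorelSpace X]
  [SecondCountableTopology X] {μ : Measure X} [SFinite μ] {p : ℝ≥0∞}

omit [MetricSpace X] [BorelSpace X] [SecondCountableTopology X] [SFinite μ] in
theorem tendsto_Lp_iff_lintegral [hp1 : Fact (1 ≤ p)] (hp : p ≠ ∞) {ι : Type*} {l : Filter ι}
    {u : ι → Lp ℝ p μ} {f : Lp ℝ p μ} :
    Tendsto u l (𝓝 f) ↔ Tendsto (fun n => ∫⁻ x, ‖u n x - f x‖ₑ ^ p.toReal ∂μ) l (𝓝 0) := by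
  have hp0 : p ≠ 0 := (zero_lt_one.trans_le hp1.out).ne'
  have hq0 : 0 < p.toReal := ENNReal.toReal_pos hp0 hp
  have hpow : ∀ (z : ℝ), 0 < z → ∀ v : ι → ℝ≥0∞, Tendsto v l (𝓝 0) →
      Tendsto (fun n => v n ^ z) l (𝓝 0) := fun z hz v hv => by
    have := (ENNReal.continuous_rpow_const (y := z)).tendsto 0 |>.comp hv
    rwa [ENNReal.zero_rpow_of_pos hz] at this
  rw [tendsto_iff_edist_tendsto_0]
  refine ⟨fun h => ?_, fun h => ?_⟩
  · exact (hpow _ hq0 _ h).congr fun n => Lp_edist_rpow_toReal hp0 hp _ _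
  · exact (hpow _ (inv_pos.2 hq0) _ h).congr fun n => by
      rw [← Lp_edist_rpow_toReal hp0 hp, ENNReal.rpow_rpow_inv hq0.ne']

/-- Recovery sequences on two sets can be glued to a recovery sequence on their union. -/
theorem exists_glued_recovery (hD : IsDoubling μ) [hp1 : Fact (1 ≤ p)] (hp : p ≠ ∞)
    (hq : 1 < p.toReal) {r : ℕ → ℝ} (hr : ∀ n, 0 < r n) {f : Lp ℝ p μ} {A' A : Opens X}
    (hA : CompactlyIn A' A) {V : Set X} (hV : MeasurableSet V) {a b : ℝ≥0∞}
    (ha : ∃ u : ℕ → Lp ℝ p μ, Tendsto u atTop (𝓝 f) ∧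
      limsup (fun n => energy μ p (r n) (u n) A) atTop ≤ a)
    (hb : ∃ u : ℕ → Lp ℝ p μ, Tendsto u atTop (𝓝 f) ∧
      limsup (fun n => energy μ p (r n) (u n) V) atTop ≤ b) :
    ∃ u : ℕ → Lp ℝ p μ, Tendsto u atTop (𝓝 f) ∧
      limsup (fun n => energy μ p (r n) (u n) (A' ∪ V)) atTop ≤ a + b := by
  have hp0 : p ≠ 0 := (zero_lt_one.trans_le hp1.out).ne'
  have hq0 : 0 < p.toReal := by linarith
  set q := p.toReal with hqdef
  obtain ⟨u, hu, hua⟩ := ha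
  obtain ⟨v, hv, hvb⟩ := hb
  obtain ⟨δ, hδ, hδA⟩ := hA.1.exists_thickening_subset_open A.isOpen hA.2
  set θ := thickenedIndicator hδ (A' : Set X)
  set η : X → ℝ := fun x => θ x
  have hη0 : ∀ x, 0 ≤ η x := fun x => NNReal.coe_nonneg _
  have hη1 : ∀ x, η x ≤ 1 := fun x => by exact_mod_cast thickenedIndicator_le_one hδ _ x
  have hηL : LipschitzWith δ.toNNReal⁻¹ η := lipschitzWith_thickenedIndicator hδ _
  have hηA' : ∀ x ∈ (A' : Set X), η x = 1 := fun x hx => by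
    simp only [η, θ]
    rw [thickenedIndicator_one hδ _ hx, NNReal.coe_one]
  have hηA : ∀ x, x ∉ (A : Set X) → η x = 0 := fun x hx => by
    simp only [η, θ]
    rw [thickenedIndicator_zero hδ _ fun h => hx (hδA (thickening_subset_of_subset _ subset_closure h)),
      NNReal.coe_zero]
  have hum : ∀ n, Measurable (u n) := fun n => (Lp.stronglyMeasurable (u n)).measurable
  have hvm : ∀ n, Measurable (v n) := fun n => (Lp.stronglyMeasurable (v n)).measurable
  have hηm : Measurable η := hηL.continuous.measurable
  set w : ℕ → X → ℝ := fun n x => η x * u n x + (1 - η x) * v n x with hw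
  have hwL : ∀ n, MemLp (w n) p μ := by
    intro n
    have h1 : MemLp (fun x => η x * u n x) p μ :=
      (Lp.memLp (u n)).of_le (hηm.mul (hum n)).aestronglyMeasurable (Eventually.of_forall fun x => by
        rw [norm_mul, Real.norm_of_nonneg (hη0 x)]
        exact mul_le_of_le_one_left (norm_nonneg _) (hη1 x))
    have h2 : MemLp (fun x => (1 - η x) * v n x) p μ :=
      (Lp.memLp (v n)).of_le ((measurable_const.sub hηm).mul (hvm n)).aestronglyMeasurable
        (Eventually.of_forall fun x => by
          rw [norm_mul, Real.norm_of_nonneg (sub_nonneg.2 (hη1 x))]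
          exact mul_le_of_le_one_left (norm_nonneg _) (by linarith [hη0 x]))
    exact h1.add h2
  have huI := (tendsto_Lp_iff_lintegral hp).1 hu
  have hvI := (tendsto_Lp_iff_lintegral hp).1 hv
  have hfm : Measurable f := (Lp.stronglyMeasurable f).measurable
  refine ⟨fun n => (hwL n).toLp _, (tendsto_Lp_iff_lintegral hp).2 ?_, ?_⟩
  · have hsum := huI.add hvI
    rw [add_zero] at hsum
    refine tendsto_of_tendsto_of_tendsto_of_le_of_le tendsto_const_nhds hsum (fun n => zero_le)
      fun n => ?_
    simp only
    have hmu : Measurable fun x => ‖u n x - f x‖ₑ ^ p.toReal :=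
      ((hum n).sub hfm).enorm.pow_const _
    rw [← lintegral_add_left hmu]
    refine lintegral_mono_ae ?_
    filter_upwards [(hwL n).coeFn_toLp] with x hx
    rw [hx, show w n x - f x = η x * (u n x - f x) + (1 - η x) * (v n x - f x) by
      simp only [hw]; ring]
    refine (enorm_convex_rpow_le hq.le (hη0 x) (hη1 x) _ _).trans ?_
    gcongr
    · exact mul_le_of_le_one_left zero_le (ENNReal.ofReal_le_one.2 (hη1 x))
    · exact mul_le_of_le_one_left zero_le (ENNReal.ofReal_le_one.2 (by linarith [hη0 x]))
  · have huv : Tendsto (fun n => ∫⁻ x, ‖u n x - v n x‖ₑ ^ q ∂μ) atTop (𝓝 0) := by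
      have h1 : Tendsto (fun n => edist (u n) (v n)) atTop (𝓝 0) := by
        have := hu.edist hv
        rwa [edist_self] at this
      have h2 := (ENNReal.continuous_rpow_const (y := q)).tendsto 0 |>.comp h1
      rw [ENNReal.zero_rpow_of_pos hq0] at h2
      simpa only [Function.comp_def, Lp_edist_rpow_toReal hp0 hp, hqdef] using h2
    -- The glued sequence does not depend on `K`; only the constant in front of the vanishing error
    -- does. Hence `K` may tend to one after `n → ∞`.
    have hK : ∀ K : ℝ≥0, 1 < K →
        limsup (fun n => energy μ p (r n) ((hwL n).toLp _) (A' ∪ V)) atTop ≤ K * (a + b) := by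
      intro K hK
      obtain ⟨C, hC⟩ := hD.exists_energy_glue_le (p := p) hq hK
      have hrem : Tendsto (fun n => C * (((δ.toNNReal⁻¹ : ℝ≥0) : ℝ≥0∞) ^ q) *
          ∫⁻ x, ‖u n x - v n x‖ₑ ^ q ∂μ) atTop (𝓝 0) := by
        have := ENNReal.Tendsto.const_mul (a := C * (((δ.toNNReal⁻¹ : ℝ≥0) : ℝ≥0∞) ^ q)) huv
          (Or.inr (by finiteness))
        rwa [mul_zero] at this
      calc limsup (fun n => energy μ p (r n) ((hwL n).toLp _) (A' ∪ V)) atTop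
          ≤ limsup (fun n => K * (energy μ p (r n) (u n) A + energy μ p (r n) (v n) V) +
              C * (((δ.toNNReal⁻¹ : ℝ≥0) : ℝ≥0∞) ^ q) * ∫⁻ x, ‖u n x - v n x‖ₑ ^ q ∂μ) atTop := by
            refine limsup_le_limsup (Eventually.of_forall fun n => ?_)
            simp only
            rw [energy_congr_ae (hwL n).coeFn_toLp]
            exact hC _ η hηL hη0 hη1 A A' V A.isOpen.measurableSet A'.isOpen.measurableSet hV hηA'
              hηA (u n) (v n) (hum n) (hvm n) (r n) (hr n)
        _ ≤ _ := limsup_add_le_ennreal _ _ _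
        _ ≤ K * (limsup (fun n => energy μ p (r n) (u n) A) atTop +
              limsup (fun n => energy μ p (r n) (v n) V) atTop) + 0 := by
            rw [hrem.limsup_eq, ENNReal.limsup_const_mul_of_ne_top ENNReal.coe_ne_top]
            gcongr
            exact limsup_add_le_ennreal _ _ _
        _ ≤ _ := by rw [add_zero]; gcongr
    rcases eq_or_ne (a + b) ∞ with htop | htop
    · rw [htop]; exact le_top
    have ht : Tendsto (fun K : ℝ≥0 => (K : ℝ≥0∞) * (a + b)) (𝓝[>] 1) (𝓝 (1 * (a + b))) :=
      ENNReal.Tendsto.mul_const ((ENNReal.continuous_coe.tendsto 1).mono_left nhdsWithin_le_nhds)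
        (Or.inr htop)
    rw [one_mul] at ht
    exact ge_of_tendsto ht (eventually_mem_nhdsWithin.mono fun K hK' => hK K hK')

/-- Along scales for which the `Γ`- and `Γ̄`-limits exist, the `Γ̄`-limit of a function of the
Korevaar-Schoen space is a finite Radon measure whose total mass is the `Γ`-limit. -/
theorem exists_measure_eq_gammaBar [LocallyCompactSpace X] (hD : IsDoubling μ)
    [hp1 : Fact (1 ≤ p)] (hp : p ≠ ∞)
    (hq : 1 < p.toReal) {r : ℕ → ℝ} (hr : ∀ n, 0 < r n) (hr0 : Tendsto r atTop (𝓝 0))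
    {Ep : Lp ℝ p μ → ℝ≥0∞} {Gp : Lp ℝ p μ → Opens X → ℝ≥0∞} (H : IsEnergyLimit μ p r Ep Gp)
    {f : Lp ℝ p μ} (hf : f ∈ KS μ p) :
    ∃ ν : Measure X, IsFiniteMeasure ν ∧ ν.Regular ∧
      (∀ U : Opens X, ν (U : Set X) = Gp f U) ∧ ν Set.univ = Ep f := by
  obtain ⟨⟨hE1, hE2⟩, hG1, hG2⟩ := H
  obtain ⟨G, hGfin, hG⟩ := exists_limsup_energy_le_of_mem_KS hD hp hq f hf
  have hG := hG r hr hr0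
  -- `R U c` says that `f` can be recovered on `U` at asymptotic cost `c`. The liminf inequality
  -- bounds `Gp f U` by any such `c`; the converse, up to `ε`, is `R_add`.
  set R : Set X → ℝ≥0∞ → Prop := fun U c => ∃ u : ℕ → Lp ℝ p μ, Tendsto u atTop (𝓝 f) ∧
    limsup (fun n => energy μ p (r n) (u n) U) atTop ≤ c with hR
  have le_of_R : ∀ (U : Opens X) c, R U c → Gp f U ≤ c := fun U c ⟨u, hu, hc⟩ =>
    (hG1 f U u hu).trans ((liminf_le_limsup (by isBoundedDefault) (by isBoundedDefault)).trans hc)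
  have R_mono : ∀ {U V : Set X} {c}, U ⊆ V → R V c → R U c := fun hUV ⟨u, hu, hc⟩ =>
    ⟨u, hu, (limsup_le_limsup (Eventually.of_forall fun n => energy_mono_set hUV _ _)).trans hc⟩
  have R_of : ∀ {U V : Opens X}, CompactlyIn U V → R U (Gp f V) := fun hUV => hG2 f _ _ hUV
  have : IsFiniteMeasure (μ.withDensity G) := isFiniteMeasure_withDensity hGfin
  have key : ∀ (V : Opens X) (ε : ℝ≥0∞), ε ≠ 0 → ∃ A : Opens X, CompactlyIn A V ∧
      ∀ c, R A c → R V (c + ε) := by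
    intro V ε hε
    -- The finite measure with density `G` leaves less than `ε` outside a compact set, so recovery
    -- on some `A ⋐ V` extends to all of `V` by gluing at extra cost `ε`.
    obtain ⟨K, hKV, hK, hKε⟩ := V.isOpen.measurableSet.exists_isCompact_sdiff_lt
      (measure_ne_top (μ.withDensity G) V) hε
    obtain ⟨A', hKA', hA'⟩ := exists_compactlyIn_of_isCompact hK hKV
    obtain ⟨A, hA'A, hA⟩ := hA'.exists_between
    have hm : MeasurableSet ((V : Set X) \ K) := V.isOpen.measurableSet.diff hK.isClosed.measurableSet
    have hVK : R ((V : Set X) \ K) ε := by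
      obtain ⟨u, hu, hc⟩ := hG ((V : Set X) \ K)
      refine ⟨u, hu, hc.trans ?_⟩
      rw [← withDensity_apply _ hm]
      exact hKε.le
    refine ⟨A, hA, fun c hc => R_mono ?_ (exists_glued_recovery hD hp hq hr hA'A hm hc hVK)⟩
    intro x hx
    by_cases hxK : x ∈ K
    · exact Or.inl (hKA' hxK)
    · exact Or.inr ⟨hx, hxK⟩
  have hle_eps : ∀ {a b : ℝ≥0∞}, (∀ ε : ℝ≥0∞, ε ≠ 0 → a ≤ b + ε) → a ≤ b := fun h =>
    ENNReal.le_of_forall_pos_le_add fun ε hε _ => h ε (by simpa using hε.ne')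
  have R_add : ∀ (V : Opens X) (ε : ℝ≥0∞), ε ≠ 0 → R V (Gp f V + ε) := fun V ε hε => by
    obtain ⟨A, hA, hAR⟩ := key V ε hε
    exact hAR _ (R_of hA)
  have mono : Monotone (Gp f) := fun U V hUV =>
    hle_eps fun ε hε => le_of_R U _ (R_mono hUV (R_add V ε hε))
  have inner : ∀ (V : Opens X) (ε : ℝ≥0∞), ε ≠ 0 → ∃ W : Opens X, CompactlyIn W V ∧
      Gp f V ≤ Gp f W + ε := fun V ε hε => by
    obtain ⟨A, hA, hAR⟩ := key V ε hε
    obtain ⟨W, hAW, hW⟩ := hA.exists_between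
    exact ⟨W, hW, le_of_R V _ (hAR _ (R_of hAW))⟩
  have empty : Gp f ⊥ = 0 := by
    refine le_antisymm (le_of_R ⊥ 0 ⟨fun _ => f, tendsto_const_nhds, ?_⟩) zero_le
    simp [energy]
  have subadd : ∀ U V : Opens X, Gp f (U ⊔ V) ≤ Gp f U + Gp f V := by
    intro U V
    refine hle_eps fun ε hε => ?_
    have hε2 := (ENNReal.half_pos hε).ne'
    obtain ⟨W, hW, hWle⟩ := inner (U ⊔ V) (ε / 2) hε2
    -- After shrinking the union to `W`, the part of its closure outside `V` is a compact subset of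
    -- `U`; recovery near it is glued to recovery on `V`.
    have hKc : IsCompact (closure (W : Set X) \ V) := hW.1.diff V.isOpen
    obtain ⟨A', hKA', hA'⟩ := exists_compactlyIn_of_isCompact (V := U) hKc (by
      rintro x ⟨hx, hxV⟩
      exact (hW.2 hx).resolve_right hxV)
    obtain ⟨A, hA'A, hA⟩ := hA'.exists_between
    have hglue := exists_glued_recovery hD hp hq hr hA'A V.isOpen.measurableSet (R_of hA)
      (R_add V (ε / 2) hε2)
    have hRW : R W (Gp f U + (Gp f V + ε / 2)) := by
      refine R_mono ?_ hglue
      intro x hx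
      by_cases hxV : x ∈ (V : Set X)
      · exact Or.inr hxV
      · exact Or.inl (hKA' ⟨subset_closure hx, hxV⟩)
    calc Gp f (U ⊔ V) ≤ Gp f U + (Gp f V + ε / 2) + ε / 2 := hWle.trans (by
          gcongr; exact le_of_R W _ hRW)
      _ = Gp f U + Gp f V + (ε / 2 + ε / 2) := by ring
      _ = _ := by rw [ENNReal.add_halves]
  have sigma : ∀ U : ℕ → Opens X, Gp f (⨆ i, U i) ≤ ∑' i, Gp f (U i) := by
    intro U
    refine hle_eps fun ε hε => ?_
    obtain ⟨W, hW, hWle⟩ := inner (⨆ i, U i) ε hε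
    obtain ⟨t, ht⟩ := hW.1.elim_finite_subcover (fun i => (U i : Set X)) (fun i => (U i).isOpen)
      (by rw [← Opens.coe_iSup]; exact hW.2)
    have hfin : ∀ t : Finset ℕ, Gp f (t.sup U) ≤ ∑ i ∈ t, Gp f (U i) := by
      classical
      intro t
      induction t using Finset.induction_on with
      | empty => simp [empty]
      | insert i s hi ih =>
        rw [Finset.sup_insert, Finset.sum_insert hi]
        exact (subadd _ _).trans (by gcongr)
    refine hWle.trans ?_
    gcongr
    calc Gp f W ≤ Gp f (t.sup U) := mono (by
          intro x hx
          have := ht (subset_closure hx)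
          simp only [Set.mem_iUnion] at this
          obtain ⟨i, hi, hxi⟩ := this
          exact (Finset.le_sup (f := U) hi) hxi)
      _ ≤ ∑ i ∈ t, Gp f (U i) := hfin t
      _ ≤ _ := ENNReal.sum_le_tsum t
  have superadd : ∀ U V : Opens X, Disjoint (U : Set X) V → Gp f U + Gp f V ≤ Gp f (U ⊔ V) := by
    intro U V hUV
    refine hle_eps fun ε hε => ?_
    obtain ⟨U', hU', hU'le⟩ := inner U (ε / 2) (ENNReal.half_pos hε).ne'
    obtain ⟨V', hV', hV'le⟩ := inner V (ε / 2) (ENNReal.half_pos hε).ne'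
    -- One recovery sequence on the union competes on both pieces, and the energies of disjoint sets
    -- add exactly.
    obtain ⟨u, hu, hc⟩ := R_of (hU'.union hV')
    have hdis : Disjoint (U' : Set X) V' := hUV.mono hU'.subset hV'.subset
    calc Gp f U + Gp f V ≤ (Gp f U' + ε / 2) + (Gp f V' + ε / 2) := add_le_add hU'le hV'le
      _ = Gp f U' + Gp f V' + (ε / 2 + ε / 2) := by ring
      _ = Gp f U' + Gp f V' + ε := by rw [ENNReal.add_halves]
      _ ≤ Gp f (U ⊔ V) + ε := by
          gcongr
          calc Gp f U' + Gp f V' ≤ _ := add_le_add (hG1 f U' u hu) (hG1 f V' u hu)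
            _ ≤ _ := le_liminf_add_ennreal _ _
            _ = liminf (fun n => energy μ p (r n) (u n) (U' ⊔ V' : Opens X)) atTop := by
                simp only [Opens.coe_sup, energy_union V'.isOpen.measurableSet hdis]
            _ ≤ _ := (liminf_le_limsup (by isBoundedDefault) (by isBoundedDefault)).trans hc
  obtain ⟨ν, hν⟩ := exists_measure_eq_on_opens (Gp f) empty mono sigma superadd
  have huniv : ν Set.univ = Gp f ⊤ := by rw [← hν ⊤, Opens.coe_top]
  have hfinite : IsFiniteMeasure ν := by
    refine ⟨?_⟩
    rw [huniv]
    have hle := le_of_R ⊤ _ (by simpa using hG Set.univ)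
    exact hle.trans_lt hGfin.lt_top
  refine ⟨ν, hfinite, inferInstance, hν, ?_⟩
  rw [huniv]
  -- A recovery sequence for `Ep` competes for `Gp f ⊤`; conversely, recovery on the whole space at
  -- cost `Gp f ⊤ + ε` bounds `Ep f`.
  refine le_antisymm (le_of_R ⊤ _ (by simpa using hE2 f)) (hle_eps fun ε hε => ?_)
  obtain ⟨u, hu, hc⟩ := R_add ⊤ ε hε
  exact (hE1 f u hu).trans ((liminf_le_limsup (by isBoundedDefault) (by isBoundedDefault)).trans hc)

end

/-! ### Comparison of the energies with the Γ̄-limit -/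

section

variable {X : Type*} [MetricSpace X] [MeasurableSpace X] [BorelSpace X]
  [SecondCountableTopology X] {μ : Measure X} [SFinite μ] {p : ℝ≥0∞}

omit [MeasurableSpace X] [BorelSpace X] [SecondCountableTopology X] in
theorem CompactlyIn.exists_thickening {U V : Opens X} (h : CompactlyIn U V) :
    ∃ δ, 0 < δ ∧ thickening δ (U : Set X) ⊆ V := by
  obtain ⟨δ, hδ, hsub⟩ := h.1.exists_thickening_subset_open V.isOpen h.2
  exact ⟨δ, hδ, (thickening_subset_of_subset _ subset_closure).trans hsub⟩

omit [MeasurableSpace X] [BorelSpace X] [SecondCountableTopology X] in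
theorem CompactlyIn.isBounded {U V : Opens X} (h : CompactlyIn U V) :
    Bornology.IsBounded (U : Set X) :=
  h.1.isBounded.subset subset_closure

/-- The energies at small scales are bounded by the `Γ̄`-limit. -/
theorem exists_limsup_energy_le_gammaBar [LocallyCompactSpace X] (hD : IsDoubling μ)
    (hP : SatisfiesPoincare μ p) [hp1 : Fact (1 ≤ p)] (hp : p ≠ ∞) (hq : 1 ≤ p.toReal) :
    ∃ C : ℝ≥0∞, C ≠ ∞ ∧ ∀ r : ℕ → ℝ, (∀ n, 0 < r n) → Tendsto r atTop (𝓝 0) →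
      ∀ Gp : Lp ℝ p μ → Opens X → ℝ≥0∞,
      GammaBarConverges (fun n (f : Lp ℝ p μ) (U : Opens X) => energy μ p (r n) f U) Gp →
      ∀ (f : Lp ℝ p μ) (U V : Opens X), CompactlyIn U V →
      limsup (fun t : ℝ => energy μ p t f U) (𝓝[>] (0 : ℝ)) ≤ C * Gp f V := by
  obtain ⟨C, c, hC, hc, H⟩ := exists_energy_le_energy hD hP hq
  obtain ⟨C', hC', H'⟩ := hD.exists_energy_le_lintegral (p := p) hq
  set q := p.toReal with hqdef
  refine ⟨2 ^ (q - 1) * C, by finiteness, fun r hr hr0 Gp hG f U V hUV => ?_⟩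
  obtain ⟨W, hUW, hWV⟩ := hUV.exists_between
  obtain ⟨u, hu, hlim⟩ := hG.2 f W V hWV
  obtain ⟨δ, hδ, hδW⟩ := hUW.exists_thickening
  have hfm : Measurable f := (Lp.stronglyMeasurable f).measurable
  have hum : ∀ n, Measurable (u n) := fun n => (Lp.stronglyMeasurable (u n)).measurable
  have huI := (tendsto_Lp_iff_lintegral hp).1 hu
  refine limsup_le_of_le (by isBoundedDefault) ?_
  -- The scale `t` is fixed while `n → ∞`. The constant `Kt` blows up as `t → 0`, but for fixed `t`
  -- the error term vanishes in the limit, leaving a bound uniform in `t`. The condition `t < δ / c`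
  -- keeps the thickened set inside `W`.
  filter_upwards [Ioo_mem_nhdsGT (show 0 < δ / c by positivity)] with t ht
  have hct : c * t ≤ δ := by
    have := (lt_div_iff₀ (by positivity : 0 < c)).1 ht.2
    linarith
  set Kt : ℝ≥0∞ := (ENNReal.ofReal t ^ q)⁻¹ * C' with hKt
  have hKttop : Kt ≠ ∞ := by
    refine ENNReal.mul_ne_top (ENNReal.inv_ne_top.2 ?_) hC'
    rw [Ne, ENNReal.rpow_eq_zero_iff]
    have : 0 < q := by linarith
    simp [ht.1, this.not_gt]
  have hrem : Tendsto (fun n => Kt * ∫⁻ x, ‖u n x - f x‖ₑ ^ q ∂μ) atTop (𝓝 0) := by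
    have := ENNReal.Tendsto.const_mul (a := Kt) huI (Or.inr hKttop)
    rwa [mul_zero] at this
  have hev : ∀ᶠ n in atTop, energy μ p t f U ≤
      2 ^ (q - 1) * (C * energy μ p (r n) (u n) W + Kt * ∫⁻ x, ‖u n x - f x‖ₑ ^ q ∂μ) := by
    filter_upwards [hr0.eventually (gt_mem_nhds ht.1)] with n hn
    calc energy μ p t f U = energy μ p t (fun x => u n x + (f x - u n x)) U := by simp
      _ ≤ 2 ^ (q - 1) * (energy μ p t (u n) U + energy μ p t (fun x => f x - u n x) U) :=
          energy_add_le hq (hum n) (hfm.sub (hum n)) t U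
      _ ≤ _ := by
          gcongr
          · refine (H (u n) (hum n) (Lp.memLp _) U U.isOpen.measurableSet hUW.isBounded (r n) t
              (hr n) hn.le).trans ?_
            gcongr
            exact energy_mono_set ((thickening_mono hct _).trans hδW) _ _
          · refine (H' t ht.1 _ (hfm.sub (hum n)) U U.isOpen.measurableSet).trans ?_
            rw [← mul_assoc]
            refine mul_le_mul' le_rfl
              ((setLIntegral_le_lintegral _ _).trans (le_of_eq (lintegral_congr fun x => ?_)))
            rw [Pi.sub_apply, ← enorm_neg, neg_sub]
  have hK2 : (2 : ℝ≥0∞) ^ (q - 1) ≠ ∞ := by finiteness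
  calc energy μ p t f U = limsup (fun _ : ℕ => energy μ p t f U) atTop := limsup_const _ |>.symm
    _ ≤ limsup (fun n => 2 ^ (q - 1) * (C * energy μ p (r n) (u n) W +
          Kt * ∫⁻ x, ‖u n x - f x‖ₑ ^ q ∂μ)) atTop := limsup_le_limsup hev
    _ ≤ 2 ^ (q - 1) * (C * limsup (fun n => energy μ p (r n) (u n) W) atTop + 0) := by
        rw [ENNReal.limsup_const_mul_of_ne_top hK2, ← hrem.limsup_eq,
          ← ENNReal.limsup_const_mul_of_ne_top hC]
        gcongr
        exact limsup_add_le_ennreal _ _ _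
    _ ≤ _ := by
        rw [add_zero, mul_assoc]
        gcongr

/-- The energies along a sequence of scales are bounded by the lower limit over all scales. -/
theorem exists_liminf_energy_le (hD : IsDoubling μ) (hP : SatisfiesPoincare μ p)
    [hp1 : Fact (1 ≤ p)] (hq : 1 ≤ p.toReal) :
    ∃ C : ℝ≥0∞, C ≠ ∞ ∧ ∀ r : ℕ → ℝ, (∀ n, 0 < r n) → Tendsto r atTop (𝓝 0) →
      ∀ (f : Lp ℝ p μ) (V W : Opens X), CompactlyIn V W →
      liminf (fun n => energy μ p (r n) f V) atTop ≤
        C * liminf (fun t : ℝ => energy μ p t f W) (𝓝[>] (0 : ℝ)) := by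
  obtain ⟨C, c, hC, hc, H⟩ := exists_energy_le_energy hD hP hq
  refine ⟨C, hC, fun r hr hr0 f V W hVW => ?_⟩
  obtain ⟨δ, hδ, hδW⟩ := hVW.exists_thickening
  have hfm : Measurable f := (Lp.stronglyMeasurable f).measurable
  -- For each large `n`, all scales `s < r n` satisfy the monotonicity estimate, so the energy at `r
  -- n` is already below the lower limit over `s`.
  refine liminf_le_of_frequently_le (Eventually.frequently ?_)
  filter_upwards [hr0.eventually (gt_mem_nhds (show 0 < δ / c by positivity))] with n hn
  have hct : c * r n ≤ δ := by
    have := (lt_div_iff₀ (by positivity : 0 < c)).1 hn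
    linarith
  rw [← ENNReal.liminf_const_mul_of_ne_top hC]
  refine le_liminf_of_le (by isBoundedDefault) ?_
  filter_upwards [Ioo_mem_nhdsGT (hr n)] with s hs
  refine (H f hfm (Lp.memLp f) V V.isOpen.measurableSet hVW.isBounded s (r n) hs.1 hs.2.le).trans ?_
  gcongr
  exact energy_mono_set ((thickening_mono hct _).trans hδW) _ _

end

end KorevaarSchoen

/-! ### The main theorem -/

theorem theoremT {X : Type*} [MetricSpace X] [CompleteSpace X] [LocallyCompactSpace X]
    [MeasurableSpace X] [BorelSpace X] (μ : Measure X) [μ.Regular]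
    (p : ℝ≥0∞) [Fact (1 ≤ p)] (hp1 : 1 < p) (hp : p ≠ ∞)
    (hD : KorevaarSchoen.IsDoubling μ) (hP : KorevaarSchoen.SatisfiesPoincare μ p) :
    -- every sequence of scales has a subsequence along which both limits exist
    (∀ s : ℕ → ℝ, (∀ n, 0 < s n) → Tendsto s atTop (𝓝 0) →
      ∃ (φ : ℕ → ℕ) (Ep : Lp ℝ p μ → ℝ≥0∞) (Gp : Lp ℝ p μ → Opens X → ℝ≥0∞),
        StrictMono φ ∧ KorevaarSchoen.IsEnergyLimit μ p (fun n => s (φ n)) Ep Gp) ∧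
    ∃ C₁ C₂ : ℝ≥0, 0 < C₁ ∧ 0 < C₂ ∧
      ∀ r : ℕ → ℝ, (∀ n, 0 < r n) → Tendsto r atTop (𝓝 0) →
      ∀ (Ep : Lp ℝ p μ → ℝ≥0∞) (Gp : Lp ℝ p μ → Opens X → ℝ≥0∞),
        KorevaarSchoen.IsEnergyLimit μ p r Ep Gp →
        ∀ f ∈ KorevaarSchoen.KS μ p,
          (∃ ν : Measure X, IsFiniteMeasure ν ∧ ν.Regular ∧
            (∀ U : Opens X, ν (U : Set X) = Gp f U) ∧ ν Set.univ = Ep f) ∧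
          ∀ U V W : Opens X, KorevaarSchoen.CompactlyIn U V → KorevaarSchoen.CompactlyIn V W →
            C₁ * limsup (fun t : ℝ => KorevaarSchoen.energy μ p t f U) (𝓝[>] (0 : ℝ)) ≤ Gp f V ∧
            Gp f V ≤ liminf (fun n => KorevaarSchoen.energy μ p (r n) f V) atTop ∧
            liminf (fun n => KorevaarSchoen.energy μ p (r n) f V) atTop ≤
              C₂ * liminf (fun t : ℝ => KorevaarSchoen.energy μ p t f W) (𝓝[>] (0 : ℝ)) := by
  obtain ⟨_, _⟩ : SecondCountableTopology X ∧ SigmaFinite μ :=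
    ⟨hD.secondCountableTopology, hD.sigmaFinite⟩
  have hq : 1 < p.toReal := by
    rw [← ENNReal.toReal_one]
    exact (ENNReal.toReal_lt_toReal ENNReal.one_ne_top hp).2 hp1
  -- Makes separability of `Lp` available, which the compactness argument requires.
  have : Fact (p ≠ ∞) := ⟨hp⟩
  refine ⟨fun s _ _ => ?_, ?_⟩
  · obtain ⟨φ, F, G, hφ, hF, hG⟩ := KorevaarSchoen.exists_gammaBarConverges_subseq
      (fun n (f : Lp ℝ p μ) (U : Set X) => KorevaarSchoen.energy μ p (s n) f U)
      (fun n f U V hUV => KorevaarSchoen.energy_mono_set hUV _ _)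
    exact ⟨φ, F, G, hφ, hF, hG⟩
  · obtain ⟨C, hC, H⟩ := KorevaarSchoen.exists_limsup_energy_le_gammaBar hD hP hp hq.le
    obtain ⟨C', hC', H'⟩ := KorevaarSchoen.exists_liminf_energy_le hD hP hq.le
    lift C to ℝ≥0 using hC
    lift C' to ℝ≥0 using hC'
    -- Adding one makes both constants positive and the inverse meaningful.
    refine ⟨(C + 1)⁻¹, C' + 1, by positivity, by positivity, fun r hr hr0 Ep Gp hlim f hf =>
      ⟨KorevaarSchoen.exists_measure_eq_gammaBar hD hp hq hr hr0 hlim hf,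
        fun U V W hUV hVW => ⟨?_, hlim.2.1 f V (fun _ => f) tendsto_const_nhds, ?_⟩⟩⟩
    · rw [ENNReal.coe_inv (by positivity), ENNReal.inv_mul_le_iff (by simp) ENNReal.coe_ne_top]
      refine (H r hr hr0 Gp hlim.2 f U V hUV).trans ?_
      gcongr
      exact le_self_add
    · refine (H' r hr hr0 f V W hVW).trans ?_
      gcongr
      exact le_self_add
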